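/- Let $J$ be the counterclockwise rotation of $\mathbb{R}^2$ by $\pi/2$ and $\mathbb{S}^1=\mathbb{R}/2\pi\mathbb{Z}$. A (smooth, closed) Legendre curve is a smooth map $\gamma:\mathbb{S}^1\to\mathbb{R}^2$ together with a smooth unit field $\nu:\mathbb{S}^1\to\mathbb{S}^1\subset\mathbb{R}^2$ such that $\langle\gamma',\nu\rangle=0$. Put $\mu=J\nu$, $\ell=\langle\nu',\mu\rangle$, $\beta=\langle\gamma',\mu\rangle$, $p=\langle\gamma,\nu\rangle$; the curve is $\ell$-convex if $\ell>0$ everywhere. Put $$L=\int_0^{2\pi}\beta\,du,\qquad A=\frac12\int_0^{2\pi}p\,\beta\,du,\qquad S=\frac1\pi\int_0^{2\pi}p\,\nu\,\ell\,du$$ (algebraic length, algebraic area, Steiner point). Let $$f=\frac{\beta}{\ell}-\lambda,\qquad \lambda=\frac1L\int_0^{2\pi}\Big(\frac{\beta}{\ell}\Big)^2\ell\,du .$$ Here $\beta/\ell$ is the value of $\beta$ in the parametrization by the normal angle $\theta$, $d\theta=\ell\,du$, in which $\ell=1$; in that parametrization $f=\beta-\lambda$ and $\lambda=\frac1L\int_0^{2\pi}\beta^2\,d\theta$.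 The inverse curvature flow is $$\frac{\partial\gamma}{\partial t}=\frac{\ell f'}{\ell^2+\beta^2}\,\mu+f\,\nu,\qquad \frac{\partial\nu}{\partial t}=-\frac{\beta f'}{\ell^2+\beta^2}\,\mu, \tag{1}$$ and, after a tangential field is added, it takes the normalized form $$\frac{\partial\gamma}{\partial t}=\frac{f'}{\ell}\,\mu+f\,\nu,\qquad \frac{\partial\nu}{\partial t}=0. \tag{2}$$ **Theorem 1.1.** Let $(\gamma_0,\nu_0)$ be a Legendre curve with $\ell=1$ and algebraic area $A_0>0$. Let $L_0$ be its algebraic length and $S_0$ its Steiner point, put $r=\sqrt{A_0/\pi}$, and let $\varepsilon\in\{-1,0,1\}$ be the sign of $L_0$. For each of the flows (1) and (2) there is a solution $(\gamma(\cdot,t),\nu(\cdot,t))$ with initial value $(\gamma_0,\nu_0)$ for all $t\in[0,\infty)$, smooth on $\mathbb{S}^1\times[0,\infty)$, and every such solution has the following properties. 1. For every $t\ge0$, $(\gamma(\cdot,t),\nu(\cdot,t))$ is an $\ell$-convex Legendre curve (with $\ell=1$ in the case of (2)), its algebraic area is $A_0$ and its Steiner point is $S_0$. 2. As $t\to\infty$,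 $\gamma(\cdot,t)$ converges in $C^\infty(\mathbb{S}^1)$ to a curve $\gamma_\infty$ that traces the circle of radius $r=\sqrt{A_0/\pi}$ centred at $S_0$ exactly once. In the case of (1), $\nu(\cdot,t)$ converges in $C^\infty(\mathbb{S}^1)$ to a field $\nu_\infty$ such that $(\gamma_\infty,\nu_\infty)$ is an $\ell$-convex Legendre curve and $\gamma_\infty=S_0+\varepsilon r\,\nu_\infty$; in the case of (2), $\gamma_\infty=S_0+\varepsilon r\,\nu_0$. -/

import Mathlib

open scoped ContDiff

namespace LegendreFlow

noncomputable section

/- The Euclidean plane is `ℂ` with the real inner product `inner ℝ z w = Re (conj z * w)`; the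
counterclockwise rotation `J` by `π / 2` is multiplication by `Complex.I`. Maps on the circle `𝕊¹`
are `2π`-periodic maps on `ℝ`. -/

/-- A smooth closed Legendre curve `γ` together with its unit normal field `ν`. -/
structure IsLegendreCurve (γ ν : ℝ → ℂ) : Prop where
  smooth_curve : ContDiff ℝ ∞ γ
  smooth_normal : ContDiff ℝ ∞ ν
  periodic_curve : Function.Periodic γ (2 * Real.pi)
  periodic_normal : Function.Periodic ν (2 * Real.pi)
  norm_normal : ∀ u, ‖ν u‖ = 1
  orthogonal : ∀ u, inner ℝ (deriv γ u) (ν u) = 0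

/-- The second frame vector `μ = J ν`. -/
def mu (ν : ℝ → ℂ) (u : ℝ) : ℂ := Complex.I * ν u

/-- First entry of the curvature pair: `ℓ = ⟨ν', μ⟩`. -/
def ell (ν : ℝ → ℂ) (u : ℝ) : ℝ := inner ℝ (deriv ν u) (mu ν u)

/-- Second entry of the curvature pair: `β = ⟨γ', μ⟩`, so that `γ' = β μ` for a Legendre curve. -/
def beta (γ ν : ℝ → ℂ) (u : ℝ) : ℝ := inner ℝ (deriv γ u) (mu ν u)

/-- An `ℓ`-convex Legendre curve: `ℓ > 0` everywhere. -/
def IsEllConvex (γ ν : ℝ → ℂ) : Prop := IsLegendreCurve γ ν ∧ ∀ u, 0 < ell ν u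

/-- The support function `p = ⟨γ, ν⟩`. -/
def support (γ ν : ℝ → ℂ) (u : ℝ) : ℝ := inner ℝ (γ u) (ν u)

/-- Algebraic length `L = ∫ β`; it does not depend on the parametrization. -/
def algLength (γ ν : ℝ → ℂ) : ℝ := ∫ u in (0 : ℝ)..(2 * Real.pi), beta γ ν u

/-- Algebraic area `A = (1/2) ∫ p β`; it does not depend on the parametrization. -/
def algArea (γ ν : ℝ → ℂ) : ℝ :=
  (1 / 2) * ∫ u in (0 : ℝ)..(2 * Real.pi), support γ ν u * beta γ ν u

/-- Steiner point `(1/π) ∫ p ν dθ`, where `dθ = ℓ du` is the normal-angle measure. -/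
def steinerPoint (γ ν : ℝ → ℂ) : ℂ :=
  (1 / Real.pi : ℝ) • ∫ u in (0 : ℝ)..(2 * Real.pi), (support γ ν u * ell ν u) • ν u

/-- The value of `β` in the parametrization with `ℓ = 1`, at the point with parameter `u`.
Under a change of parameter `β` and `ℓ` are multiplied by the same factor, so this is `β / ℓ`
(the signed radius of curvature), and it is `β` itself if `ℓ = 1`. -/
def betaNormalized (γ ν : ℝ → ℂ) (u : ℝ) : ℝ := beta γ ν u / ell ν u

/-- The nonlocal term `λ = (1/L) ∫ β² dθ`, with `β` and `θ` those of the parametrization with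
`ℓ = 1`, i.e. `β / ℓ` and `dθ = ℓ du`. -/
def nonlocalTerm (γ ν : ℝ → ℂ) : ℝ :=
  (1 / algLength γ ν) * ∫ u in (0 : ℝ)..(2 * Real.pi), betaNormalized γ ν u ^ 2 * ell ν u

/-- The normal speed `f = β - λ`, with `β` normalized as above. -/
def speed (γ ν : ℝ → ℂ) (u : ℝ) : ℝ := betaNormalized γ ν u - nonlocalTerm γ ν

/-- Right-hand side, for `(γ, ν)`, of the inverse curvature flow
`γ_t = ℓ f' / (ℓ² + β²) μ + f ν`, `ν_t = - β f' / (ℓ² + β²) μ`. -/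
def flowVelocity (γ ν : ℝ → ℂ) (u : ℝ) : ℂ × ℂ :=
  ((ell ν u * deriv (speed γ ν) u / (ell ν u ^ 2 + beta γ ν u ^ 2)) • mu ν u
      + speed γ ν u • ν u,
    (-(beta γ ν u * deriv (speed γ ν) u / (ell ν u ^ 2 + beta γ ν u ^ 2))) • mu ν u)

/-- Right-hand side of the same flow with the tangential field added which keeps `ν` fixed:
`γ_t = (f' / ℓ) μ + f ν`, `ν_t = 0`. -/
def normalizedFlowVelocity (γ ν : ℝ → ℂ) (u : ℝ) : ℂ × ℂ :=
  ((deriv (speed γ ν) u / ell ν u) • mu ν u + speed γ ν u • ν u, 0)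

/-- `(γ t, ν t)`, `t ≥ 0`, is a family of pairs of closed curves, smooth on `[0, ∞) × 𝕊¹`, which
starts at `(γ₀, ν₀)` and satisfies `∂(γ, ν)/∂t = V (γ, ν)`. Neither the Legendre condition nor
`ℓ > 0` is required for `t > 0`. -/
structure EvolvesBy (V : (ℝ → ℂ) → (ℝ → ℂ) → ℝ → ℂ × ℂ) (γ₀ ν₀ : ℝ → ℂ)
    (γ ν : ℝ → ℝ → ℂ) : Prop where
  smooth_curve : ContDiffOn ℝ ∞ (fun x : ℝ × ℝ => γ x.1 x.2) (Set.Ici 0 ×ˢ Set.univ)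
  smooth_normal : ContDiffOn ℝ ∞ (fun x : ℝ × ℝ => ν x.1 x.2) (Set.Ici 0 ×ˢ Set.univ)
  periodic_curve : ∀ t, 0 ≤ t → Function.Periodic (γ t) (2 * Real.pi)
  periodic_normal : ∀ t, 0 ≤ t → Function.Periodic (ν t) (2 * Real.pi)
  initial_curve : γ 0 = γ₀
  initial_normal : ν 0 = ν₀
  evolution_curve : ∀ t, 0 ≤ t → ∀ u,
    HasDerivWithinAt (fun s => γ s u) (V (γ t) (ν t) u).1 (Set.Ici 0) t
  evolution_normal : ∀ t, 0 ≤ t → ∀ u,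
    HasDerivWithinAt (fun s => ν s u) (V (γ t) (ν t) u).2 (Set.Ici 0) t

/-- `γ t → γ_∞` in `C^∞(𝕊¹)` as `t → ∞`: all derivatives in the curve parameter converge
uniformly. -/
def ConvergesSmoothly (γ : ℝ → ℝ → ℂ) (γ_lim : ℝ → ℂ) : Prop :=
  ∀ k : ℕ, TendstoUniformly (fun t u => iteratedDeriv k (γ t) u)
    (fun u => iteratedDeriv k γ_lim u) Filter.atTop

end

end LegendreFlow

/-!
# The inverse curvature flow of Legendre curves

In the normal angle `θ` a closed curve with normal `ν = e^{iθ}` is determined by its support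
function `p`. Subtracting from `p` its mean `ρ` and the part `⟨S, ν⟩` of the Steiner point `S` leaves
a function `q` without the Fourier modes `0, ±1`; the radius of curvature is `B = ρ + q + q''`
(`supportCurve`, `Admissible`). Under the normalized flow `q` solves the linear equation
`q_t = q + q''`, whose modes `|n| ≥ 2` decay like `e^{(1 - n²) t}`. The nonlocal term makes the
algebraic area `A = π ρ² - E(q)` constant, where `E(q) = -(1/2) ∫ q (q + q'') ≥ 0` by Wirtinger's
inequality (`deficit`). Hence `ρ` is determined by `q`: it is `ε √((A + E(q)) / π)`, with `ε` the sign
of the algebraic length. It never vanishes when `A > 0`, and this gives an explicit solution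
(`LinearFlow`, `modelCurve`).

All exponents `n² - 1` are positive integers, so that the solution is a smooth function of
`τ = e^{-t}`, up to `τ = 0` (`exists_linear_flow`). This turns convergence in `C^∞` into continuity
at `τ = 0` (`convergesSmoothly_of_smooth`), where `q = 0` and the curve is a circle of radius
`√(A / π)` centred at `S`. The flow which is not normalized moves the normal angle of the same
curves by an ordinary differential equation. Its right-hand side is also smooth in `τ` up to `τ = 0`,
because `∂_θ (q + q'')` is divisible by `τ`; its flow `Θ` (`exists_smooth_flow`) therefore yields a
solution with the same properties (`LinearFlow.evolvesBy_flow`).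

For uniqueness, let a solution be given on a time interval on which `ℓ > 0`. Both flows have the form
`γ_t = f ν + h μ`, `ν_t = -g μ` with `f' = ℓ h + β g`, and this implies that the Legendre condition is
preserved and that the moments `∫ γ ν^m dθ` satisfy uncoupled linear equations for `m ≠ -1`
(`FlowSegment.hasDerivAt_moment`). The exponentials being complete, the curve coincides with the
explicit solution up to its mean radius (`FlowSegment.exists_eq_supportCurve`), and a differential
inequality for the square of the mean radius settles the rest (`FlowSegment.eq_modelCurve`). Then the
normal angle has to follow `Θ`, which is increasing in the parameter, so that `ℓ` cannot become zero
(`EvolvesBy.ell_pos`), and the description holds for all times.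
-/

/-! ### Calculus of smooth functions of two real variables -/

namespace LegendreFlow

open Set Filter Topology MeasureTheory

section TwoVariables

variable {E : Type*} [NormedAddCommGroup E] [NormedSpace ℝ E] {F : ℝ → ℝ → E} {I : Set ℝ}
  {n : WithTop ℕ∞}

lemma contDiff_slice (h : ContDiffOn ℝ n (fun x : ℝ × ℝ => F x.1 x.2) (I ×ˢ univ)) {t : ℝ}
    (ht : t ∈ I) : ContDiff ℝ n (F t) := by
  rw [← contDiffOn_univ]
  exact h.comp (f := fun u : ℝ => ((t, u) : ℝ × ℝ)) (by fun_prop) (fun u _ => ⟨ht, mem_univ _⟩)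

lemma contDiffAt_of_mem_interior
    (h : ContDiffOn ℝ n (fun x : ℝ × ℝ => F x.1 x.2) (I ×ˢ univ)) {t : ℝ}
    (ht : t ∈ interior I) (u : ℝ) : ContDiffAt ℝ n (fun x : ℝ × ℝ => F x.1 x.2) (t, u) :=
  h.contDiffAt (prod_mem_nhds (mem_interior_iff_mem_nhds.1 ht) univ_mem)

/-- The `u`-derivative of a smooth function on `I × ℝ` is smooth on `I × ℝ`, also where `I`
contains boundary points. -/
lemma contDiffOn_deriv_snd (hI : UniqueDiffOn ℝ I)
    (h : ContDiffOn ℝ ∞ (fun x : ℝ × ℝ => F x.1 x.2) (I ×ˢ univ)) :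
    ContDiffOn ℝ ∞ (fun x : ℝ × ℝ => deriv (F x.1) x.2) (I ×ˢ univ) := by
  have hS : UniqueDiffOn ℝ (I ×ˢ (univ : Set ℝ)) := hI.prod uniqueDiffOn_univ
  have h1 : ContDiffOn ℝ ∞ (fun x : ℝ × ℝ =>
      fderivWithin ℝ (fun x : ℝ × ℝ => F x.1 x.2) (I ×ˢ univ) x (0, 1)) (I ×ˢ univ) :=
    (h.fderivWithin hS (by simp)).clm_apply contDiffOn_const
  refine h1.congr fun x hx => ?_
  have h2 := ((h.differentiableOn (by simp)) x hx).hasFDerivWithinAt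
  have h3 : HasDerivWithinAt (fun u : ℝ => ((x.1, u) : ℝ × ℝ)) ((0, 1) : ℝ × ℝ) univ x.2 :=
    ((hasDerivAt_const x.2 x.1).prodMk (hasDerivAt_id x.2)).hasDerivWithinAt
  have h4 := h2.comp_hasDerivWithinAt x.2 h3 (t := I ×ˢ (univ : Set ℝ))
    (fun u _ => (⟨hx.1, mem_univ _⟩ : ((x.1, u) : ℝ × ℝ) ∈ I ×ˢ (univ : Set ℝ)))
  rw [hasDerivWithinAt_univ] at h4
  exact h4.deriv

lemma hasDerivAt_fst (h : ContDiffOn ℝ ∞ (fun x : ℝ × ℝ => F x.1 x.2) (I ×ˢ univ)) {t : ℝ}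
    (ht : t ∈ interior I) (u : ℝ) :
    HasDerivAt (fun s => F s u)
      (fderiv ℝ (fun x : ℝ × ℝ => F x.1 x.2) (t, u) (1, 0)) t := by
  have h2 := ((contDiffAt_of_mem_interior h ht u).differentiableAt (by simp)).hasFDerivAt
  exact h2.comp_hasDerivAt (f := fun s : ℝ => ((s, u) : ℝ × ℝ)) t
    ((hasDerivAt_id t).prodMk (hasDerivAt_const t u))

lemma hasDerivAt_snd (h : ContDiffOn ℝ ∞ (fun x : ℝ × ℝ => F x.1 x.2) (I ×ˢ univ)) {t : ℝ}
    (ht : t ∈ interior I) (u : ℝ) :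
    HasDerivAt (F t) (fderiv ℝ (fun x : ℝ × ℝ => F x.1 x.2) (t, u) (0, 1)) u := by
  have h2 := ((contDiffAt_of_mem_interior h ht u).differentiableAt (by simp)).hasFDerivAt
  exact h2.comp_hasDerivAt (f := fun v : ℝ => ((t, v) : ℝ × ℝ)) u
    ((hasDerivAt_const u t).prodMk (hasDerivAt_id u))

lemma contDiffOn_deriv_fst
    (h : ContDiffOn ℝ ∞ (fun x : ℝ × ℝ => F x.1 x.2) (I ×ˢ univ)) :
    ContDiffOn ℝ ∞ (fun x : ℝ × ℝ => deriv (fun s => F s x.2) x.1) (interior I ×ˢ univ) := by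
  have h' := h.mono (prod_mono_left (t := (univ : Set ℝ)) interior_subset)
  have h1 : ContDiffOn ℝ ∞ (fun x : ℝ × ℝ =>
      fderiv ℝ (fun x : ℝ × ℝ => F x.1 x.2) x (1, 0)) (interior I ×ˢ univ) :=
    (h'.fderiv_of_isOpen (isOpen_interior.prod isOpen_univ) (by simp)).clm_apply contDiffOn_const
  exact h1.congr fun x hx => (hasDerivAt_fst h hx.1 x.2).deriv

/-- Symmetry of the mixed second derivatives, at interior times. -/
lemma hasDerivAt_deriv_snd
    (h : ContDiffOn ℝ ∞ (fun x : ℝ × ℝ => F x.1 x.2) (I ×ˢ univ)) {t : ℝ}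
    (ht : t ∈ interior I) (u : ℝ) :
    HasDerivAt (fun s => deriv (F s) u) (deriv (fun v => deriv (fun s => F s v) t) u) t := by
  set G : ℝ × ℝ → E := fun x => F x.1 x.2 with hG
  have hc := contDiffAt_of_mem_interior h ht u
  have hsymm : IsSymmSndFDerivAt ℝ G (t, u) :=
    hc.isSymmSndFDerivAt (by
      rw [minSmoothness_of_isRCLikeNormedField]
      exact WithTop.coe_le_coe.2 (le_top : (2 : ℕ∞) ≤ ⊤))
  have hD : HasFDerivAt (fderiv ℝ G) (fderiv ℝ (fderiv ℝ G) (t, u)) (t, u) :=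
    ((hc.fderiv_right (m := 1) (by norm_cast)).differentiableAt (by simp)).hasFDerivAt
  have e1 : HasDerivAt (fun s => fderiv ℝ G (s, u) (0, 1))
      (fderiv ℝ (fderiv ℝ G) (t, u) (1, 0) (0, 1)) t :=
    (hD.comp_hasDerivAt (f := fun s : ℝ => ((s, u) : ℝ × ℝ)) t
      ((hasDerivAt_id t).prodMk (hasDerivAt_const t u))).clm_apply
      (hasDerivAt_const t ((0, 1) : ℝ × ℝ)) |>.congr_deriv (by simp)
  have e2 : HasDerivAt (fun v => fderiv ℝ G (t, v) (1, 0))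
      (fderiv ℝ (fderiv ℝ G) (t, u) (0, 1) (1, 0)) u :=
    (hD.comp_hasDerivAt (f := fun v : ℝ => ((t, v) : ℝ × ℝ)) u
      ((hasDerivAt_const u t).prodMk (hasDerivAt_id u))).clm_apply
      (hasDerivAt_const u ((1, 0) : ℝ × ℝ)) |>.congr_deriv (by simp)
  have e3 : deriv (fun v => deriv (fun s => F s v) t) u
      = fderiv ℝ (fderiv ℝ G) (t, u) (1, 0) (0, 1) := by
    rw [hsymm.eq (1, 0) (0, 1), ← e2.deriv]
    congr 1
    funext v
    exact (hasDerivAt_fst h ht v).deriv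
  rw [e3]
  refine e1.congr_of_eventuallyEq ?_
  filter_upwards [isOpen_interior.mem_nhds ht] with s hs
  exact (hasDerivAt_snd h hs u).deriv

lemma continuousOn_integral (h : ContinuousOn (fun x : ℝ × ℝ => F x.1 x.2) (I ×ˢ univ))
    (a b : ℝ) : ContinuousOn (fun t => ∫ u in a..b, F t u) I := by
  rw [continuousOn_iff_continuous_domRestrict]
  have h1 : Continuous (fun p : I × ℝ => F p.1 p.2) := by
    have := continuousOn_iff_continuous_domRestrict.1 h
    exact this.comp (f := fun p : I × ℝ => (⟨(p.1, p.2), p.1.2, mem_univ _⟩ : ↥(I ×ˢ univ)))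
      (by fun_prop)
  exact intervalIntegral.continuous_parametric_intervalIntegral_of_continuous'
    (f := fun (t : I) u => F t u) h1 a b

/-- Differentiation under the integral sign for smooth integrands. -/
lemma hasDerivAt_integral [CompleteSpace E] {a b : ℝ} (hab : a ≤ b)
    (h : ContDiffOn ℝ 1 (fun x : ℝ × ℝ => F x.1 x.2) (I ×ˢ univ)) {t : ℝ}
    (ht : t ∈ interior I) {F' : ℝ → E} (hF' : ∀ u, HasDerivAt (fun s => F s u) (F' u) t) :
    HasDerivAt (fun s => ∫ u in a..b, F s u) (∫ u in a..b, F' u) t := by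
  set G : ℝ × ℝ → E := fun x => F x.1 x.2 with hG
  have hopen : IsOpen (interior I ×ˢ (univ : Set ℝ)) := isOpen_interior.prod isOpen_univ
  have h' := h.mono (prod_mono_left (t := (univ : Set ℝ)) interior_subset)
  have hcont : ContinuousOn (fun x : ℝ × ℝ => fderiv ℝ G x (1, 0)) (interior I ×ˢ univ) :=
    (h'.continuousOn_fderiv_of_isOpen hopen (by simp)).clm_apply continuousOn_const
  have hd : ∀ s ∈ interior I, ∀ u, HasDerivAt (fun s => F s u) (fderiv ℝ G (s, u) (1, 0)) s := by
    intro s hs u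
    have h2 := ((contDiffAt_of_mem_interior h hs u).differentiableAt (by simp)).hasFDerivAt
    exact h2.comp_hasDerivAt (f := fun s : ℝ => ((s, u) : ℝ × ℝ)) s
      ((hasDerivAt_id s).prodMk (hasDerivAt_const s u))
  obtain ⟨ε, hε, hball⟩ := Metric.isOpen_iff.1 isOpen_interior t ht
  have hsub : Metric.closedBall t (ε / 2) ⊆ interior I :=
    (Metric.closedBall_subset_ball (by linarith)).trans hball
  obtain ⟨C, hC⟩ := ((isCompact_closedBall t (ε / 2)).prod (isCompact_Icc (a := a) (b := b))
    ).exists_bound_of_continuousOn (hcont.mono (prod_mono hsub (subset_univ _)))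
  have hslice : ∀ s ∈ interior I, Continuous (F s) := fun s hs =>
    (contDiff_slice h (interior_subset hs)).continuous
  have key := intervalIntegral.hasDerivAt_integral_of_dominated_loc_of_deriv_le
    (𝕜 := ℝ) (μ := volume) (F := F) (F' := fun s u => fderiv ℝ G (s, u) (1, 0)) (x₀ := t)
    (a := a) (b := b) (s := Metric.ball t (ε / 2)) (bound := fun _ => C)
    (Metric.ball_mem_nhds t (by linarith)) ?_ ?_ ?_ ?_ ?_ ?_
  · refine key.2.congr_deriv (intervalIntegral.integral_congr fun u _ => ?_)
    exact (hd t ht u).unique (hF' u)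
  · filter_upwards [isOpen_interior.mem_nhds ht] with s hs
    exact (hslice s hs).aestronglyMeasurable
  · exact (hslice t ht).intervalIntegrable _ _
  · have : Continuous (fun u => fderiv ℝ G (t, u) (1, 0)) := by
      rw [← continuousOn_univ]
      exact hcont.comp (f := fun u : ℝ => ((t, u) : ℝ × ℝ)) (by fun_prop)
        (fun u _ => ⟨ht, mem_univ _⟩)
    exact this.aestronglyMeasurable
  · refine ae_of_all _ fun u hu s hs => hC (s, u) ⟨Metric.ball_subset_closedBall hs, ?_⟩
    rw [uIoc_of_le hab] at hu
    exact Ioc_subset_Icc_self hu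
  · exact intervalIntegrable_const
  · exact ae_of_all _ fun u _ s hs => hd s (hsub (Metric.ball_subset_closedBall hs)) u

/-- A function of two variables whose partial derivatives are `C^k` is `C^(k+1)`. -/
lemma contDiff_succ_of_partial {k : ℕ} {F₁ F₂ : ℝ → ℝ → E}
    (h₁ : ∀ t u, HasDerivAt (fun s => F s u) (F₁ t u) t)
    (h₂ : ∀ t u, HasDerivAt (F t) (F₂ t u) u)
    (c₁ : ContDiff ℝ k (fun x : ℝ × ℝ => F₁ x.1 x.2))
    (c₂ : ContDiff ℝ k (fun x : ℝ × ℝ => F₂ x.1 x.2)) :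
    ContDiff ℝ (k + 1) (fun x : ℝ × ℝ => F x.1 x.2) := by
  rw [contDiff_succ_iff_hasFDerivAt]
  refine ⟨fun x => (ContinuousLinearMap.toSpanSingleton ℝ (F₁ x.1 x.2)).coprod
    (ContinuousLinearMap.toSpanSingleton ℝ (F₂ x.1 x.2)), ?_, fun x => ?_⟩
  · have e : (fun x : ℝ × ℝ => (ContinuousLinearMap.toSpanSingleton ℝ (F₁ x.1 x.2)).coprod
        (ContinuousLinearMap.toSpanSingleton ℝ (F₂ x.1 x.2)))
        = fun x => (ContinuousLinearMap.fst ℝ ℝ ℝ).smulRight (F₁ x.1 x.2)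
          + (ContinuousLinearMap.snd ℝ ℝ ℝ).smulRight (F₂ x.1 x.2) := by
      funext x
      ext <;> simp
    rw [e]
    exact (contDiff_const.smulRight c₁).add (contDiff_const.smulRight c₂)
  · have := hasStrictFDerivAt_uncurry_coprod (𝕜 := ℝ) (u := x) (f := F)
      (f₁ := fun t u => ContinuousLinearMap.toSpanSingleton ℝ (F₁ t u))
      (f₂ := fun t u => ContinuousLinearMap.toSpanSingleton ℝ (F₂ t u))
      (.of_forall fun v => (h₁ v.1 v.2).hasFDerivAt) (.of_forall fun v => (h₂ v.1 v.2).hasFDerivAt)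
      ?_ ?_
    · exact this.hasFDerivAt
    · exact ((ContinuousLinearMap.toSpanSingletonCLE (𝕜 := ℝ) (E := E)).continuous.comp
        c₁.continuous).continuousAt
    · exact ((ContinuousLinearMap.toSpanSingletonCLE (𝕜 := ℝ) (E := E)).continuous.comp
        c₂.continuous).continuousAt

end TwoVariables

section Global

variable {E : Type*} [NormedAddCommGroup E] [NormedSpace ℝ E] {F : ℝ → ℝ → E}

lemma contDiff_deriv_snd (h : ContDiff ℝ ∞ (fun x : ℝ × ℝ => F x.1 x.2)) :
    ContDiff ℝ ∞ (fun x : ℝ × ℝ => deriv (F x.1) x.2) := by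
  rw [← contDiffOn_univ, ← univ_prod_univ] at h ⊢
  exact contDiffOn_deriv_snd uniqueDiffOn_univ h

lemma contDiff_deriv_fst (h : ContDiff ℝ ∞ (fun x : ℝ × ℝ => F x.1 x.2)) :
    ContDiff ℝ ∞ (fun x : ℝ × ℝ => deriv (fun s => F s x.2) x.1) := by
  rw [← contDiffOn_univ, ← univ_prod_univ] at h
  rw [← contDiffOn_univ, ← univ_prod_univ]
  simpa using contDiffOn_deriv_fst h

lemma contDiff_comp_mk {n : WithTop ℕ∞} (h : ContDiff ℝ n (fun x : ℝ × ℝ => F x.1 x.2)) (t : ℝ) :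
    ContDiff ℝ n (F t) :=
  h.comp (f := fun u : ℝ => ((t, u) : ℝ × ℝ)) (by fun_prop)

lemma contDiff_comp_mk_left {n : WithTop ℕ∞} (h : ContDiff ℝ n (fun x : ℝ × ℝ => F x.1 x.2))
    (u : ℝ) : ContDiff ℝ n (fun s => F s u) :=
  h.comp (f := fun s : ℝ => ((s, u) : ℝ × ℝ)) (by fun_prop)

/-- An integral depending smoothly on a parameter is a smooth function of the parameter. -/
lemma contDiff_integral [CompleteSpace E] {a b : ℝ} (hab : a ≤ b)
    (h : ContDiff ℝ ∞ (fun x : ℝ × ℝ => F x.1 x.2)) :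
    ContDiff ℝ ∞ (fun t => ∫ u in a..b, F t u) := by
  rw [contDiff_infty]
  intro n
  induction n generalizing F with
  | zero =>
    refine contDiff_zero.2 ?_
    exact intervalIntegral.continuous_parametric_intervalIntegral_of_continuous' h.continuous a b
  | succ n ih =>
    have hd : ∀ t, HasDerivAt (fun t => ∫ u in a..b, F t u)
        (∫ u in a..b, deriv (fun s => F s u) t) t := by
      intro t
      have h1 : ContDiffOn ℝ 1 (fun x : ℝ × ℝ => F x.1 x.2) ((univ : Set ℝ) ×ˢ univ) :=
        (h.of_le (by norm_cast)).contDiffOn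
      refine hasDerivAt_integral hab h1 (by simp) fun u => ?_
      exact ((contDiff_comp_mk_left h u).differentiable (by simp) t).hasDerivAt
    rw [show ((n + 1 : ℕ) : WithTop ℕ∞) = (n : WithTop ℕ∞) + 1 by norm_cast,
      contDiff_succ_iff_deriv]
    refine ⟨fun t => (hd t).differentiableAt, by simp, ?_⟩
    rw [show deriv (fun t => ∫ u in a..b, F t u)
      = fun t => ∫ u in a..b, deriv (fun s => F s u) t from funext fun t => (hd t).deriv]
    exact ih (F := fun t u => deriv (fun s => F s u) t) (contDiff_deriv_fst h)

/-- A primitive, in the first variable, of a `C^k` function of two variables is `C^k`. -/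
lemma contDiff_primitive [CompleteSpace E] {a : ℝ} {k : ℕ}
    (h : ContDiff ℝ k (fun x : ℝ × ℝ => F x.1 x.2)) :
    ContDiff ℝ k (fun x : ℝ × ℝ => ∫ s in a..x.1, F s x.2) := by
  induction k generalizing F with
  | zero =>
    have hc : Continuous (fun x : ℝ × ℝ => F x.1 x.2) := h.continuous
    refine contDiff_zero.2 ?_
    refine intervalIntegral.continuous_parametric_intervalIntegral_of_continuous
      (f := fun (x : ℝ × ℝ) s => F s x.2) ?_ continuous_fst
    exact hc.comp (f := fun p : (ℝ × ℝ) × ℝ => ((p.2, p.1.2) : ℝ × ℝ)) (by fun_prop)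
  | succ k ih =>
    have hk : ((k + 1 : ℕ) : WithTop ℕ∞) = (k : WithTop ℕ∞) + 1 := by norm_cast
    have h1 : ContDiff ℝ 1 (fun x : ℝ × ℝ => F x.1 x.2) :=
      h.of_le (by rw [hk]; exact le_add_self)
    have hswap : ContDiff ℝ 1 (fun x : ℝ × ℝ => F x.2 x.1) :=
      h1.comp (f := fun x : ℝ × ℝ => ((x.2, x.1) : ℝ × ℝ)) (by fun_prop)
    set F₂ : ℝ → ℝ → E := fun t u => fderiv ℝ (fun x : ℝ × ℝ => F x.1 x.2) (t, u) (0, 1) with hF₂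
    have hF₂c : ContDiff ℝ k (fun x : ℝ × ℝ => F₂ x.1 x.2) :=
      (h.fderiv_right (m := k) (by rw [hk])).clm_apply contDiff_const
    have hd : ∀ t u, HasDerivAt (F t) (F₂ t u) u := fun t u =>
      ((h1.differentiable (by simp)) (t, u)).hasFDerivAt.comp_hasDerivAt
        (f := fun v : ℝ => ((t, v) : ℝ × ℝ)) u ((hasDerivAt_const u t).prodMk (hasDerivAt_id u))
    have hcs : ∀ u, Continuous (fun s => F s u) := fun u =>
      h.continuous.comp (f := fun s : ℝ => ((s, u) : ℝ × ℝ)) (by fun_prop)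
    rw [hk]
    refine contDiff_succ_of_partial (F := fun t u => ∫ s in a..t, F s u) (F₁ := F)
      (F₂ := fun t u => ∫ s in a..t, F₂ s u) (fun t u => ?_) (fun t u => ?_)
      (h.of_le (by rw [hk]; exact le_self_add)) (ih hF₂c)
    · exact intervalIntegral.integral_hasDerivAt_right ((hcs u).intervalIntegrable _ _)
        ((hcs u).stronglyMeasurableAtFilter _ _) (hcs u).continuousAt
    · have hF : ContDiffOn ℝ 1 (fun x : ℝ × ℝ => F x.2 x.1) ((univ : Set ℝ) ×ˢ univ) :=
        hswap.contDiffOn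
      rcases le_total a t with hat | hta
      · exact hasDerivAt_integral (F := fun u s => F s u) (I := univ) hat hF (by simp)
          fun s => hd s u
      · have := hasDerivAt_integral (F := fun u s => F s u) (I := univ) hta hF
          (by simp) fun s => hd s u
        rw [intervalIntegral.integral_symm]
        refine this.neg.congr_of_eventuallyEq (.of_forall fun v => ?_)
        simp only [Pi.neg_apply]
        rw [intervalIntegral.integral_symm]

end Global

end LegendreFlow

/-! ### Fourier coefficients of periodic functions -/

namespace LegendreFlow

open Set Filter Topology MeasureTheory

lemma integral_deriv_eq_zero_of_periodic {E : Type*} [NormedAddCommGroup E] [NormedSpace ℝ E]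
    [CompleteSpace E] {f f' : ℝ → E} (hf : ∀ x, HasDerivAt f (f' x) x) (hc : Continuous f')
    (hp : Function.Periodic f (2 * Real.pi)) : ∫ x in (0 : ℝ)..(2 * Real.pi), f' x = 0 := by
  rw [intervalIntegral.integral_eq_sub_of_hasDerivAt (fun x _ => hf x)
    (hc.intervalIntegrable _ _), ← zero_add (2 * Real.pi), hp 0, sub_self]

lemma periodic_deriv {E : Type*} [NormedAddCommGroup E] [NormedSpace ℝ E] {f : ℝ → E} {c : ℝ}
    (hp : Function.Periodic f c) : Function.Periodic (deriv f) c := by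
  intro x
  rw [← deriv_comp_add_const, show (fun x => f (x + c)) = f from funext hp]

lemma exp_periodic (n : ℤ) :
    Function.Periodic (fun x : ℝ => Complex.exp (n * x * Complex.I)) (2 * Real.pi) := by
  intro x
  rw [Complex.exp_eq_exp_iff_exists_int]
  exact ⟨n, by push_cast; ring⟩

lemma hasDerivAt_exp_mul (n : ℤ) (x : ℝ) :
    HasDerivAt (fun x : ℝ => Complex.exp (n * x * Complex.I))
      (n * Complex.I * Complex.exp (n * x * Complex.I)) x := by
  have h1 : HasDerivAt (fun x : ℝ => (n : ℂ) * x * Complex.I) (n * Complex.I) x := by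
    simpa using ((Complex.ofRealCLM.hasDerivAt (x := x)).const_mul (n : ℂ)).mul_const Complex.I
  exact h1.cexp.congr_deriv (by ring)

lemma norm_exp_mul (n : ℤ) (x : ℝ) : ‖Complex.exp (n * x * Complex.I)‖ = 1 := by
  rw [show (n : ℂ) * x * Complex.I = ((n * x : ℝ) : ℂ) * Complex.I by push_cast; ring,
    Complex.norm_exp_ofReal_mul_I]

/-- The `n`-th Fourier coefficient `(1 / 2π) ∫ e^{-inx} f(x) dx` of a `2π`-periodic function. -/
noncomputable def circleCoeff (f : ℝ → ℂ) (n : ℤ) : ℂ :=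
  (1 / (2 * Real.pi) : ℝ) •
    ∫ x in (0 : ℝ)..(2 * Real.pi), Complex.exp ((-n : ℤ) * x * Complex.I) * f x

lemma fourierCoeff_lift_eq_circleCoeff [Fact (0 < 2 * Real.pi)] {f : ℝ → ℂ}
    (hp : Function.Periodic f (2 * Real.pi)) (n : ℤ) :
    fourierCoeff (T := 2 * Real.pi) hp.lift n = circleCoeff f n := by
  rw [fourierCoeff_eq_intervalIntegral _ _ 0, zero_add, circleCoeff]
  congr 1
  refine intervalIntegral.integral_congr fun x _ => ?_
  simp only [Function.Periodic.lift_coe, fourier_coe_apply, smul_eq_mul]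
  congr 2
  have : (Real.pi : ℂ) ≠ 0 := by exact_mod_cast Real.pi_ne_zero
  push_cast
  field_simp

lemma fourierCoeffOn_eq_circleCoeff (f : ℝ → ℂ) (n : ℤ) :
    fourierCoeffOn Real.two_pi_pos f n = circleCoeff f n := by
  rw [fourierCoeffOn_eq_integral, sub_zero, circleCoeff]
  congr 1
  refine intervalIntegral.integral_congr fun x _ => ?_
  simp only [fourier_coe_apply, smul_eq_mul]
  congr 2
  have : (Real.pi : ℂ) ≠ 0 := by exact_mod_cast Real.pi_ne_zero
  push_cast
  field_simp

lemma hasSum_circleCoeff {f : ℝ → ℂ} (hf : Continuous f)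
    (hp : Function.Periodic f (2 * Real.pi)) (hs : Summable (circleCoeff f)) (x : ℝ) :
    HasSum (fun n : ℤ => circleCoeff f n * Complex.exp (n * x * Complex.I)) (f x) := by
  have : Fact (0 < 2 * Real.pi) := ⟨Real.two_pi_pos⟩
  let g : C(AddCircle (2 * Real.pi), ℂ) := ⟨hp.lift, hf.quotient_lift _⟩
  have hg : fourierCoeff g = circleCoeff f := funext fun n => fourierCoeff_lift_eq_circleCoeff hp n
  have := has_pointwise_sum_fourier_series_of_summable (f := g) (by rw [hg]; exact hs)
    (x : AddCircle (2 * Real.pi))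
  rw [hg] at this
  convert! this using 1
  funext n
  rw [fourier_coe_apply, smul_eq_mul]
  congr 2
  have : (Real.pi : ℂ) ≠ 0 := by exact_mod_cast Real.pi_ne_zero
  push_cast
  field_simp

lemma eq_zero_of_circleCoeff_eq_zero {f : ℝ → ℂ} (hf : Continuous f)
    (hp : Function.Periodic f (2 * Real.pi)) (h : ∀ n, circleCoeff f n = 0) (x : ℝ) :
    f x = 0 := by
  have h0 : circleCoeff f = 0 := funext h
  have := hasSum_circleCoeff hf hp (by rw [h0]; exact summable_zero) x
  simp only [h0, Pi.zero_apply, zero_mul] at this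
  exact this.unique hasSum_zero

/-- Completeness of the exponentials in the angle variable: if `θ` is an increasing
reparametrization of the circle, a continuous periodic function which is orthogonal to all
`e^{inθ}` with respect to `dθ` vanishes. -/
lemma eq_zero_of_integral_angle {θ θ' : ℝ → ℝ} {d : ℝ → ℂ} (hθ : ∀ u, HasDerivAt θ (θ' u) u)
    (hθ' : Continuous θ') (hpos : ∀ u, 0 < θ' u) (hper : ∀ u, θ (u + 2 * Real.pi) = θ u + 2 * Real.pi)
    (hd : Continuous d) (hdp : Function.Periodic d (2 * Real.pi))
    (h : ∀ n : ℤ, ∫ u in (0 : ℝ)..(2 * Real.pi),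
      d u * Complex.exp (n * θ u * Complex.I) * θ' u = 0) (u : ℝ) : d u = 0 := by
  have hmono : StrictMono θ := strictMono_of_hasDerivAt_pos hθ hpos
  have hcont : Continuous θ := continuous_iff_continuousAt.2 fun u => (hθ u).continuousAt
  have hiter : ∀ (k : ℤ) u, θ (u + k * (2 * Real.pi)) = θ u + k * (2 * Real.pi) := by
    intro k u
    have hq : Function.Periodic (fun u => θ u - u) (2 * Real.pi) := fun v => by
      simp only [hper]; ring
    have h1 : θ (u + k * (2 * Real.pi)) - (u + k * (2 * Real.pi)) = θ u - u := hq.int_mul k u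
    linarith
  have hsurj : Function.Surjective θ := by
    intro y
    have hlow : ∃ a, θ a ≤ y := by
      refine ⟨0 + (⌊(y - θ 0) / (2 * Real.pi)⌋ : ℤ) * (2 * Real.pi), ?_⟩
      rw [hiter]
      have := Int.floor_le ((y - θ 0) / (2 * Real.pi))
      rw [le_div_iff₀ Real.two_pi_pos] at this
      linarith
    have hup : ∃ b, y ≤ θ b := by
      refine ⟨0 + (⌈(y - θ 0) / (2 * Real.pi)⌉ : ℤ) * (2 * Real.pi), ?_⟩
      rw [hiter]
      have := Int.le_ceil ((y - θ 0) / (2 * Real.pi))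
      rw [div_le_iff₀ Real.two_pi_pos] at this
      linarith
    obtain ⟨a, ha⟩ := hlow
    obtain ⟨b, hb⟩ := hup
    exact mem_range_of_exists_le_of_exists_ge hcont ⟨a, ha⟩ ⟨b, hb⟩
  let e : ℝ ≃o ℝ := hmono.orderIsoOfSurjective θ hsurj
  have he : ∀ u, e u = θ u := fun u => rfl
  set D : ℝ → ℂ := fun x => d (e.symm x) with hD
  have hDθ : ∀ u, D (θ u) = d u := fun u => by simp only [hD, ← he, e.symm_apply_apply]
  have hDc : Continuous D := hd.comp e.symm.continuous
  have hDp : Function.Periodic D (2 * Real.pi) := by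
    intro x
    obtain ⟨v, rfl⟩ := hsurj x
    rw [← hper, hDθ, hDθ, hdp]
  have hz := eq_zero_of_circleCoeff_eq_zero hDc hDp (fun n => ?_) (θ u)
  · rwa [hDθ] at hz
  · rw [circleCoeff]
    have hg : Continuous fun x : ℝ => Complex.exp ((-n : ℤ) * x * Complex.I) * D x := by fun_prop
    have hgp : Function.Periodic (fun x : ℝ => Complex.exp ((-n : ℤ) * x * Complex.I) * D x)
        (2 * Real.pi) := (exp_periodic (-n)).mul hDp
    have e1 := hgp.intervalIntegral_add_eq 0 (θ 0)
    rw [zero_add, ← hper 0, zero_add] at e1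
    have e2 := intervalIntegral.integral_deriv_smul_comp (a := 0) (b := 2 * Real.pi) (f := θ)
      (f' := θ') (fun x _ => hθ x) hθ'.continuousOn hg
    rw [e1, ← e2]
    have e3 : ∫ x in (0 : ℝ)..(2 * Real.pi), θ' x •
        ((fun x : ℝ => Complex.exp ((-n : ℤ) * x * Complex.I) * D x) ∘ θ) x = 0 := by
      rw [← h (-n)]
      refine intervalIntegral.integral_congr fun x _ => ?_
      simp only [Function.comp_apply, hDθ, Complex.real_smul]
      ring
    rw [e3, smul_zero]

/-- Change of variables to the normal angle. -/
lemma integral_comp_angle {E : Type*} [NormedAddCommGroup E] [NormedSpace ℝ E]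
    {θ θ' : ℝ → ℝ} {G : ℝ → E} (hθ : ∀ u, HasDerivAt θ (θ' u) u) (hθ' : Continuous θ')
    (hper : ∀ u, θ (u + 2 * Real.pi) = θ u + 2 * Real.pi) (hG : Continuous G)
    (hGp : Function.Periodic G (2 * Real.pi)) :
    ∫ u in (0 : ℝ)..(2 * Real.pi), θ' u • G (θ u) = ∫ x in (0 : ℝ)..(2 * Real.pi), G x := by
  have e1 := hGp.intervalIntegral_add_eq 0 (θ 0)
  rw [zero_add, ← hper 0, zero_add] at e1
  rw [e1, ← intervalIntegral.integral_deriv_smul_comp (fun x _ => hθ x) hθ'.continuousOn hG]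
  rfl

lemma circleCoeff_deriv {f f' : ℝ → ℂ} (hf : ∀ x, HasDerivAt f (f' x) x) (hc : Continuous f')
    (hp : Function.Periodic f (2 * Real.pi)) (n : ℤ) :
    circleCoeff f' n = n * Complex.I * circleCoeff f n := by
  have hfc : Continuous f := continuous_iff_continuousAt.2 fun u => (hf u).continuousAt
  have h1 := integral_deriv_eq_zero_of_periodic
    (fun x => (hasDerivAt_exp_mul (-n) x).mul (hf x)) (by fun_prop) ((exp_periodic (-n)).mul hp)
  rw [intervalIntegral.integral_add
    (Continuous.intervalIntegrable (by fun_prop) _ _)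
    (Continuous.intervalIntegrable (by fun_prop) _ _)] at h1
  have h2 : ∫ x in (0 : ℝ)..(2 * Real.pi), ((-n : ℤ) : ℂ) * Complex.I *
      Complex.exp ((-n : ℤ) * x * Complex.I) * f x = ((-n : ℤ) : ℂ) * Complex.I *
      ∫ x in (0 : ℝ)..(2 * Real.pi), Complex.exp ((-n : ℤ) * x * Complex.I) * f x := by
    rw [← intervalIntegral.integral_const_mul]
    refine intervalIntegral.integral_congr fun x _ => ?_
    simp only [mul_assoc]
  rw [h2] at h1
  rw [circleCoeff, circleCoeff, eq_neg_of_add_eq_zero_right h1]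
  simp only [Complex.real_smul]
  push_cast
  ring

lemma norm_circleCoeff_le {f : ℝ → ℂ} (hf : Continuous f) :
    ∃ C, ∀ n, ‖circleCoeff f n‖ ≤ C := by
  obtain ⟨C, hC⟩ := (isCompact_Icc (a := 0) (b := 2 * Real.pi)).exists_bound_of_continuousOn
    hf.continuousOn
  refine ⟨‖(1 / (2 * Real.pi) : ℝ)‖ * (C * |2 * Real.pi - 0|), fun n => ?_⟩
  rw [circleCoeff, norm_smul]
  gcongr
  refine intervalIntegral.norm_integral_le_of_norm_le_const fun x hx => ?_
  rw [norm_mul, norm_exp_mul, one_mul]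
  rw [uIoc_of_le Real.two_pi_pos.le] at hx
  exact hC x (Ioc_subset_Icc_self hx)

/-- The Fourier coefficients of a smooth function decay faster than any power. -/
lemma circleCoeff_decay {f : ℝ → ℂ} (hf : ContDiff ℝ ∞ f)
    (hp : Function.Periodic f (2 * Real.pi)) (k : ℕ) :
    ∃ C, ∀ n : ℤ, |(n : ℝ)| ^ k * ‖circleCoeff f n‖ ≤ C := by
  induction k generalizing f with
  | zero => simpa using norm_circleCoeff_le hf.continuous
  | succ k ih =>
    have hd : ContDiff ℝ ∞ (deriv f) := (contDiff_infty_iff_deriv.1 hf).2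
    obtain ⟨C, hC⟩ := ih hd (periodic_deriv hp)
    refine ⟨C, fun n => (le_of_eq ?_).trans (hC n)⟩
    rw [circleCoeff_deriv (fun x => (hf.differentiable (by simp) x).hasDerivAt) hd.continuous hp]
    rw [norm_mul, norm_mul, Complex.norm_I, mul_one, Complex.norm_intCast]
    ring

lemma summable_circleCoeff {f : ℝ → ℂ} (hf : ContDiff ℝ ∞ f)
    (hp : Function.Periodic f (2 * Real.pi)) (k : ℕ) :
    Summable (fun n : ℤ => ((n : ℝ) ^ 2 + 1) ^ k * ‖circleCoeff f n‖) := by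
  obtain ⟨C, hC⟩ := circleCoeff_decay hf hp (2 * k + 2)
  have hs : Summable (fun n : ℤ => 2 ^ k * C * (1 / (n : ℝ) ^ 2)) :=
    (Real.summable_one_div_int_pow.2 (by norm_num)).mul_left _
  refine Summable.of_norm_bounded_eventually hs ?_
  filter_upwards [(Set.finite_singleton (0 : ℤ)).compl_mem_cofinite] with n hn
  have hn0 : n ≠ 0 := hn
  have h1 : (1 : ℝ) ≤ (n : ℝ) ^ 2 := by
    have : 0 < n ^ 2 := by positivity
    have : 1 ≤ n ^ 2 := this
    exact_mod_cast this
  have h2 : 0 < (n : ℝ) ^ 2 := by linarith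
  rw [norm_mul, norm_norm, Real.norm_of_nonneg (by positivity), mul_one_div, le_div_iff₀ h2]
  calc ((n : ℝ) ^ 2 + 1) ^ k * ‖circleCoeff f n‖ * (n : ℝ) ^ 2
      ≤ (2 * (n : ℝ) ^ 2) ^ k * ‖circleCoeff f n‖ * (n : ℝ) ^ 2 := by gcongr; linarith
    _ = 2 ^ k * (|(n : ℝ)| ^ (2 * k + 2) * ‖circleCoeff f n‖) := by
        rw [pow_add, pow_mul, sq_abs, mul_pow]; ring
    _ ≤ 2 ^ k * C := by gcongr; exact hC n

/-- **Wirtinger's inequality**. -/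
lemma integral_sq_le_integral_deriv_sq {f : ℝ → ℝ} (hf : ContDiff ℝ 1 f)
    (hp : Function.Periodic f (2 * Real.pi)) (h0 : ∫ x in (0 : ℝ)..(2 * Real.pi), f x = 0) :
    ∫ x in (0 : ℝ)..(2 * Real.pi), f x ^ 2 ≤ ∫ x in (0 : ℝ)..(2 * Real.pi), deriv f x ^ 2 := by
  have hdc : Continuous (deriv f) := hf.continuous_deriv (by simp)
  have hmem : ∀ g : ℝ → ℝ, Continuous g → MemLp (fun x => (g x : ℂ)) 2
      (volume.restrict (Ioc 0 (2 * Real.pi))) := by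
    intro g hg
    have hgc : Continuous fun x => (g x : ℂ) := Complex.continuous_ofReal.comp hg
    obtain ⟨C, hC⟩ := (isCompact_Icc (a := 0) (b := 2 * Real.pi)).exists_bound_of_continuousOn
      hgc.continuousOn
    refine MemLp.of_bound hgc.aestronglyMeasurable C ?_
    exact (ae_restrict_iff' measurableSet_Ioc).2
      (ae_of_all _ fun x hx => hC x (Ioc_subset_Icc_self hx))
  have s1 := hasSum_sq_fourierCoeffOn Real.two_pi_pos (hmem f hf.continuous)
  have s2 := hasSum_sq_fourierCoeffOn Real.two_pi_pos (hmem _ hdc)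
  simp only [fourierCoeffOn_eq_circleCoeff, Complex.norm_real, Real.norm_eq_abs, sq_abs] at s1 s2
  have hle := hasSum_le (fun n => ?_) s1 s2
  · simp only [smul_eq_mul, sub_zero] at hle
    exact le_of_mul_le_mul_left hle (inv_pos.2 Real.two_pi_pos)
  · have hd := circleCoeff_deriv (f := fun x => (f x : ℂ)) (f' := fun x => ((deriv f x : ℝ) : ℂ))
      (fun x => ((hf.differentiable (by simp) x).hasDerivAt).ofReal_comp)
      (Complex.continuous_ofReal.comp hdc) (fun x => by simp only [hp x]) n
    rcases eq_or_ne n 0 with rfl | hn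
    · have : circleCoeff (fun x => (f x : ℂ)) 0 = 0 := by
        simp [circleCoeff, intervalIntegral.integral_ofReal, h0]
      rw [this]
      simp
    · rw [hd, norm_mul, norm_mul, Complex.norm_I, mul_one, Complex.norm_intCast, mul_pow, sq_abs]
      have h1 : (1 : ℝ) ≤ (n : ℝ) ^ 2 := by
        have h2 : 0 < n ^ 2 := by positivity
        have h3 : 1 ≤ n ^ 2 := h2
        exact_mod_cast h3
      nlinarith [sq_nonneg ‖circleCoeff (fun x => (f x : ℂ)) n‖]

end LegendreFlow

/-! ### Smooth extension of the heat flow in the compactified time variable -/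

namespace LegendreFlow

open Set Filter Topology MeasureTheory

/-- `f i` is smooth at scale `1 / r i` on `S i`: its `k`-th derivatives are bounded there by
`C * r i ^ k`, with `C` depending only on `k`. -/
def ScaleBound {ι V A : Type*} [NormedAddCommGroup V] [NormedSpace ℝ V] [NormedAddCommGroup A]
    [NormedSpace ℝ A] (S : ι → Set V) (f : ι → V → A) (r : ι → ℝ) : Prop :=
  ∀ k : ℕ, ∃ C, 0 ≤ C ∧ ∀ i, ∀ x ∈ S i, ‖iteratedFDeriv ℝ k (f i) x‖ ≤ C * r i ^ k

lemma ScaleBound.mul {ι V A : Type*} [NormedAddCommGroup V] [NormedSpace ℝ V] [NormedRing A]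
    [NormedAlgebra ℝ A] {S : ι → Set V} {f g : ι → V → A} {r : ι → ℝ} (hr : ∀ i, 0 ≤ r i)
    (hf : ScaleBound S f r) (hg : ScaleBound S g r) (cf : ∀ i, ContDiff ℝ ∞ (f i))
    (cg : ∀ i, ContDiff ℝ ∞ (g i)) : ScaleBound S (fun i x => f i x * g i x) r := by
  intro k
  choose C hC0 hC using hf
  choose D hD0 hD using hg
  refine ⟨∑ j ∈ Finset.range (k + 1), (k.choose j : ℝ) * C j * D (k - j),
    Finset.sum_nonneg fun j _ => by have := hC0 j; have := hD0 (k - j); positivity,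
    fun i x hx => ?_⟩
  refine (norm_iteratedFDeriv_mul_le (cf i) (cg i) x (n := k) (by norm_cast; exact le_top)).trans ?_
  rw [Finset.sum_mul]
  refine Finset.sum_le_sum fun j hj => ?_
  have hjk : j ≤ k := Nat.lt_succ_iff.1 (Finset.mem_range.1 hj)
  calc (k.choose j : ℝ) * ‖iteratedFDeriv ℝ j (f i) x‖ * ‖iteratedFDeriv ℝ (k - j) (g i) x‖
      ≤ (k.choose j : ℝ) * (C j * r i ^ j) * (D (k - j) * r i ^ (k - j)) := by
        have := hC0 j; have := hD0 (k - j); have := hr i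
        gcongr
        · exact hC j i x hx
        · exact hD (k - j) i x hx
    _ = (k.choose j : ℝ) * C j * D (k - j) * r i ^ k := by
        rw [← Nat.add_sub_of_le hjk, pow_add, Nat.add_sub_cancel_left]; ring

lemma norm_iteratedDeriv_smoothTransition_le (k : ℕ) :
    ∃ C, ∀ x, ‖iteratedDeriv k Real.smoothTransition x‖ ≤ C := by
  have hc : Continuous (iteratedDeriv k Real.smoothTransition) :=
    (Real.smoothTransition.contDiff (n := ⊤)).continuous_iteratedDeriv k
      (by norm_cast; exact le_top)
  obtain ⟨C, hC⟩ := (isCompact_Icc (a := (0 : ℝ)) (b := 1)).exists_bound_of_continuousOn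
    hc.continuousOn
  refine ⟨max C 1, fun x => ?_⟩
  have hconst : ∀ c : ℝ, ‖c‖ ≤ 1 → Real.smoothTransition =ᶠ[𝓝 x] (fun _ => c) →
      ‖iteratedDeriv k Real.smoothTransition x‖ ≤ max C 1 := by
    intro c hc1 he
    rw [he.iteratedDeriv_eq, iteratedDeriv_const]
    split_ifs
    · exact hc1.trans (le_max_right _ _)
    · simp
  rcases lt_or_ge x 0 with hx | hx
  · refine hconst 0 (by simp) ?_
    filter_upwards [Iio_mem_nhds hx] with y hy
    exact Real.smoothTransition.zero_of_nonpos (le_of_lt hy)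
  rcases lt_or_ge 1 x with hx1 | hx1
  · refine hconst 1 (by simp) ?_
    filter_upwards [Ioi_mem_nhds hx1] with y hy
    exact Real.smoothTransition.one_of_one_le (le_of_lt hy)
  · exact (hC x ⟨hx, hx1⟩).trans (le_max_left _ _)

/-- A cut-off at scale `1 / m`: it is `1` on `[-1, 1]` and vanishes for `m (|τ| - 1) ≥ 1`. -/
noncomputable def scaleCutoff (m : ℕ) (τ : ℝ) : ℝ :=
  Real.smoothTransition ((1 + m) + (-m) * τ) * Real.smoothTransition ((1 + m) + m * τ)

/-- A smooth function on `ℝ` which equals `τ ^ m` on `[-1, 1]` and whose `k`-th derivative is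
bounded by a multiple of `m ^ k` on all of `ℝ`. -/
noncomputable def cutoffPow (m : ℕ) (τ : ℝ) : ℝ := τ ^ m * scaleCutoff m τ

lemma contDiff_smoothTransition_affine (a b : ℝ) :
    ContDiff ℝ ∞ fun τ : ℝ => Real.smoothTransition (a + b * τ) :=
  (Real.smoothTransition.contDiff (n := ⊤)).comp (by fun_prop)

lemma contDiff_scaleCutoff (m : ℕ) : ContDiff ℝ ∞ (scaleCutoff m) :=
  (contDiff_smoothTransition_affine _ _).mul (contDiff_smoothTransition_affine _ _)

lemma contDiff_cutoffPow (m : ℕ) : ContDiff ℝ ∞ (cutoffPow m) :=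
  (contDiff_id.pow m).mul (contDiff_scaleCutoff m)

lemma cutoffPow_eq_pow (m : ℕ) {τ : ℝ} (hτ : τ ∈ Icc (-1 : ℝ) 1) : cutoffPow m τ = τ ^ m := by
  have hm : (0 : ℝ) ≤ m := Nat.cast_nonneg m
  rw [cutoffPow, scaleCutoff, Real.smoothTransition.one_of_one_le (by nlinarith [hτ.2]),
    Real.smoothTransition.one_of_one_le (by nlinarith [hτ.1])]
  ring

lemma scaleBound_smoothTransition_affine (S : ℕ → Set ℝ) (a b : ℕ → ℝ) (hb : ∀ m, |b m| = m) :
    ScaleBound S (fun m τ => Real.smoothTransition (a m + b m * τ)) (fun m => (m : ℝ)) := by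
  intro k
  obtain ⟨C, hC⟩ := norm_iteratedDeriv_smoothTransition_le k
  refine ⟨C, (norm_nonneg _).trans (hC 0), fun m τ _ => ?_⟩
  rw [norm_iteratedFDeriv_eq_norm_iteratedDeriv]
  have h1 : iteratedDeriv k (fun τ => Real.smoothTransition (a m + b m * τ)) =
      fun τ => b m ^ k * iteratedDeriv k Real.smoothTransition (a m + b m * τ) := by
    have := iteratedDeriv_comp_const_mul (n := k)
      (f := fun y => Real.smoothTransition (a m + y))
      ((Real.smoothTransition.contDiff (n := ⊤)).comp (by fun_prop) |>.of_le
        (by norm_cast; exact le_top)) (b m)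
    rw [this, iteratedDeriv_comp_const_add]
  rw [h1, norm_mul, norm_pow, Real.norm_eq_abs, hb, mul_comm]
  gcongr
  exact hC _

lemma abs_pow_le_exp_one {m : ℕ} {τ : ℝ} (hτ : m * (|τ| - 1) ≤ 1) {j : ℕ} (hj : j ≤ m) :
    |τ| ^ j ≤ Real.exp 1 := by
  rcases le_total |τ| 1 with h | h
  · exact (pow_le_one₀ (abs_nonneg _) h).trans (by simp)
  · rcases Nat.eq_zero_or_pos m with rfl | hm
    · rw [Nat.le_zero.1 hj, pow_zero]; simp
    have hm' : (0 : ℝ) < m := by exact_mod_cast hm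
    have h2 : |τ| ≤ Real.exp (1 / m) := by
      have h3 : |τ| - 1 ≤ 1 / m := by rw [le_div_iff₀ hm']; linarith
      linarith [Real.add_one_le_exp (1 / (m : ℝ))]
    calc |τ| ^ j ≤ |τ| ^ m := pow_le_pow_right₀ h hj
      _ ≤ Real.exp (1 / m) ^ m := by gcongr
      _ = Real.exp 1 := by rw [← Real.exp_nat_mul, mul_one_div, div_self hm'.ne']

/-- On `|τ| ≤ 1 + 1 / m` the powers `τ ^ j`, `j ≤ m`, are bounded by `e`, which is why the cut-off has
this scale. -/
lemma scaleBound_pow :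
    ScaleBound (fun m : ℕ => {τ : ℝ | m * (|τ| - 1) ≤ 1}) (fun m τ => τ ^ m)
      (fun m => (m : ℝ)) := by
  intro k
  refine ⟨Real.exp 1, (Real.exp_pos 1).le, fun m τ hτ => ?_⟩
  rw [norm_iteratedFDeriv_eq_norm_iteratedDeriv, iteratedDeriv_pow]
  rw [norm_mul, norm_pow, Real.norm_natCast, Real.norm_eq_abs, mul_comm]
  gcongr
  · exact abs_pow_le_exp_one hτ (Nat.sub_le _ _)
  · show ((m.descFactorial k : ℕ) : ℝ) ≤ (m : ℝ) ^ k
    exact_mod_cast Nat.descFactorial_le_pow m k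

lemma scaleBound_cutoffPow (k : ℕ) :
    ∃ C, 0 ≤ C ∧ ∀ (m : ℕ) (τ : ℝ), ‖iteratedFDeriv ℝ k (cutoffPow m) τ‖ ≤ C * (m : ℝ) ^ k := by
  have h0 : ∀ m : ℕ, (0 : ℝ) ≤ m := fun m => Nat.cast_nonneg m
  have h1 := (scaleBound_pow.mul h0 ((scaleBound_smoothTransition_affine _ _ _
      (fun m => by rw [abs_neg, abs_of_nonneg (h0 m)])).mul h0
      (scaleBound_smoothTransition_affine _ _ _ fun m => abs_of_nonneg (h0 m))
      (fun m => contDiff_smoothTransition_affine (1 + m) _)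
      fun m => contDiff_smoothTransition_affine (1 + m) _)
    (fun m => contDiff_id.pow m) contDiff_scaleCutoff) k
  obtain ⟨C, hC0, hC⟩ := h1
  refine ⟨C, hC0, fun m τ => ?_⟩
  by_cases hτ : m * (|τ| - 1) ≤ 1
  · exact hC m τ hτ
  · -- outside the closed region `m (|τ| - 1) ≤ 1` the function vanishes near `τ`
    have hev : cutoffPow m =ᶠ[𝓝 τ] fun _ => 0 := by
      have hopen : IsOpen {τ : ℝ | 1 < m * (|τ| - 1)} :=
        isOpen_lt continuous_const (by fun_prop)
      filter_upwards [hopen.mem_nhds (not_le.1 hτ)] with y hy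
      have hy' : 1 < m * (|y| - 1) := hy
      rw [cutoffPow, scaleCutoff]
      rcases le_total 0 y with h | h
      · rw [abs_of_nonneg h] at hy'
        rw [Real.smoothTransition.zero_of_nonpos (x := (1 + m) + (-m) * y) (by linarith)]
        ring
      · rw [abs_of_nonpos h] at hy'
        rw [Real.smoothTransition.zero_of_nonpos (x := (1 + m) + m * y) (by linarith)]
        ring
    rw [norm_iteratedFDeriv_eq_norm_iteratedDeriv, hev.iteratedDeriv_eq, iteratedDeriv_const,
      ite_self, norm_zero]
    positivity

/-- The mode `τ ^ (n² - 1) e^{inθ}` of the linear flow, extended from `[-1, 1]` to all `τ` by a cut-off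
at the scale `1 / (n² - 1)`, so that no derivative grows faster than on `[-1, 1]`. For `n = 0` the
exponent is truncated to `0`; this mode does not occur in the data. -/
noncomputable def heatMode (n : ℤ) (x : ℝ × ℝ) : ℂ :=
  (cutoffPow (n.natAbs ^ 2 - 1) x.1 : ℂ) * Complex.exp (n * x.2 * Complex.I)

lemma contDiff_exp_mul (n : ℤ) : ContDiff ℝ ∞ fun x : ℝ => Complex.exp (n * x * Complex.I) := by
  have h : ContDiff ℝ ∞ fun x : ℝ => (x : ℂ) := Complex.ofRealCLM.contDiff
  exact ((contDiff_const.mul h).mul contDiff_const).cexp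

lemma iteratedDeriv_exp_mul (n : ℤ) (k : ℕ) :
    iteratedDeriv k (fun x : ℝ => Complex.exp (n * x * Complex.I)) =
      fun x : ℝ => (n * Complex.I) ^ k * Complex.exp (n * x * Complex.I) := by
  induction k with
  | zero => simp
  | succ k ih =>
    rw [iteratedDeriv_succ, ih]
    funext x
    rw [((hasDerivAt_exp_mul n x).const_mul _).deriv]
    ring

lemma contDiff_heatMode (n : ℤ) : ContDiff ℝ ∞ (heatMode n) := by
  have h1 : ContDiff ℝ ∞ fun x : ℝ × ℝ => (cutoffPow (n.natAbs ^ 2 - 1) x.1 : ℂ) :=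
    Complex.ofRealCLM.contDiff.comp ((contDiff_cutoffPow _).comp contDiff_fst)
  exact h1.mul ((contDiff_exp_mul n).comp contDiff_snd)

lemma natAbs_sq_sub_one_le (n : ℤ) : ((n.natAbs ^ 2 - 1 : ℕ) : ℝ) ≤ (n : ℝ) ^ 2 + 1 := by
  have h1 : ((n.natAbs ^ 2 - 1 : ℕ) : ℝ) ≤ ((n.natAbs ^ 2 : ℕ) : ℝ) := by
    exact_mod_cast Nat.sub_le _ _
  have h2 : ((n.natAbs ^ 2 : ℕ) : ℝ) = (n : ℝ) ^ 2 := by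
    rw [Nat.cast_pow, Nat.cast_natAbs, Int.cast_abs, sq_abs]
  linarith

lemma abs_intCast_le (n : ℤ) : |(n : ℝ)| ≤ (n : ℝ) ^ 2 + 1 := by
  rw [← sq_abs]; nlinarith [sq_nonneg (|(n : ℝ)| - 1), abs_nonneg (n : ℝ)]

lemma norm_iteratedFDeriv_comp_clm_le {V A : Type*} [NormedAddCommGroup V] [NormedSpace ℝ V]
    [NormedAddCommGroup A] [NormedSpace ℝ A] {L : V →L[ℝ] ℝ} (hL : ‖L‖ ≤ 1) {f : ℝ → A}
    (hf : ContDiff ℝ ∞ f) (k : ℕ) (x : V) :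
    ‖iteratedFDeriv ℝ k (fun x => f (L x)) x‖ ≤ ‖iteratedFDeriv ℝ k f (L x)‖ := by
  have := L.iteratedFDeriv_comp_right hf x (i := k) (by norm_cast; exact le_top)
  rw [show (fun x => f (L x)) = f ∘ L from rfl, this]
  refine (ContinuousMultilinearMap.norm_compContinuousLinearMap_le _ _).trans ?_
  refine mul_le_of_le_one_right (norm_nonneg _) ?_
  exact Finset.prod_le_one (fun _ _ => norm_nonneg _) fun _ _ => hL

/-- The `k`-th derivatives of the modes grow like `(n² + 1) ^ k` only, uniformly in `τ`, and are
summable against rapidly decreasing coefficients. -/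
lemma scaleBound_heatMode :
    ScaleBound (fun _ : ℤ => univ) heatMode (fun n => (n : ℝ) ^ 2 + 1) := by
  have c1 : ∀ n : ℤ, ContDiff ℝ ∞ fun τ : ℝ => (cutoffPow (n.natAbs ^ 2 - 1) τ : ℂ) := fun n =>
    Complex.ofRealCLM.contDiff.comp (contDiff_cutoffPow _)
  refine ScaleBound.mul (fun n => by positivity) (fun k => ?_) (fun k => ?_)
    (fun n => (c1 n).comp contDiff_fst) (fun n => (contDiff_exp_mul n).comp contDiff_snd)
  · obtain ⟨C, hC0, hC⟩ := scaleBound_cutoffPow k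
    refine ⟨C, hC0, fun n x _ => ?_⟩
    refine (norm_iteratedFDeriv_comp_clm_le (L := ContinuousLinearMap.fst ℝ ℝ ℝ)
      (ContinuousLinearMap.norm_fst_le ℝ ℝ ℝ) (c1 n) k x).trans ?_
    have := Complex.ofRealLI.norm_iteratedFDeriv_comp_left (f := cutoffPow (n.natAbs ^ 2 - 1))
      (x := x.1) (contDiff_cutoffPow _).contDiffAt (i := k) (by norm_cast; exact le_top)
    refine (le_of_eq this).trans ((hC _ _).trans ?_)
    gcongr
    exact natAbs_sq_sub_one_le n
  · refine ⟨1, zero_le_one, fun n x _ => ?_⟩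
    refine (norm_iteratedFDeriv_comp_clm_le (L := ContinuousLinearMap.snd ℝ ℝ ℝ)
      (ContinuousLinearMap.norm_snd_le ℝ ℝ ℝ) (contDiff_exp_mul n) k x).trans ?_
    rw [norm_iteratedFDeriv_eq_norm_iteratedDeriv, iteratedDeriv_exp_mul, norm_mul, norm_pow,
      norm_mul, Complex.norm_I, mul_one, Complex.norm_intCast, norm_exp_mul, mul_one, one_mul]
    gcongr
    exact abs_intCast_le n

lemma integral_exp_mul {k : ℤ} (hk : k ≠ 0) :
    ∫ x in (0 : ℝ)..(2 * Real.pi), Complex.exp (k * x * Complex.I) = 0 := by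
  have h := integral_deriv_eq_zero_of_periodic (hasDerivAt_exp_mul k) (by fun_prop)
    (exp_periodic k)
  rw [intervalIntegral.integral_const_mul] at h
  have : (k : ℂ) * Complex.I ≠ 0 := mul_ne_zero (by exact_mod_cast hk) Complex.I_ne_zero
  exact (mul_eq_zero.1 h).resolve_left this

/-- The solution of the linear flow with initial Fourier coefficients `c n`. -/
noncomputable def heatSeries (c : ℤ → ℂ) (τ θ : ℝ) : ℂ := ∑' n, c n * heatMode n (τ, θ)

section Series

variable {c : ℤ → ℂ}

lemma contDiff_heatSeries (hc : ∀ k : ℕ, Summable fun n : ℤ => ((n : ℝ) ^ 2 + 1) ^ k * ‖c n‖) :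
    ContDiff ℝ ∞ (fun x : ℝ × ℝ => heatSeries c x.1 x.2) := by
  choose C hC0 hC using scaleBound_heatMode
  refine contDiff_tsum (N := ⊤) (v := fun k (n : ℤ) => C k * (((n : ℝ) ^ 2 + 1) ^ k * ‖c n‖))
    (fun (n : ℤ) => contDiff_const.mul (contDiff_heatMode n)) (fun k _ => (hc k).mul_left _)
    fun k n x _ => ?_
  have h := iteratedFDeriv_const_smul_apply (𝕜 := ℝ) (i := k) (a := c n) (f := heatMode n) (x := x)
    ((contDiff_heatMode n).contDiffAt.of_le (by norm_cast))
  have h2 : iteratedFDeriv ℝ k (fun x => c n * heatMode n x) x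
      = c n • iteratedFDeriv ℝ k (heatMode n) x := h
  have h3 : ‖c n • iteratedFDeriv ℝ k (heatMode n) x‖
      = ‖c n‖ * ‖iteratedFDeriv ℝ k (heatMode n) x‖ := norm_smul _ _
  rw [h2, h3]
  have := hC k n x (mem_univ _)
  calc ‖c n‖ * ‖iteratedFDeriv ℝ k (heatMode n) x‖
      ≤ ‖c n‖ * (C k * ((n : ℝ) ^ 2 + 1) ^ k) := by gcongr
    _ = _ := by ring

lemma summable_heatMode_bound
    (hc : ∀ k : ℕ, Summable fun n : ℤ => ((n : ℝ) ^ 2 + 1) ^ k * ‖c n‖) {g : ℤ → ℂ} (C : ℝ) (k : ℕ)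
    (hg : ∀ n, ‖g n‖ ≤ C * ((n : ℝ) ^ 2 + 1) ^ k) : Summable fun n => c n * g n := by
  refine Summable.of_norm_bounded ((hc k).mul_left C) fun n => ?_
  rw [norm_mul]
  calc ‖c n‖ * ‖g n‖ ≤ ‖c n‖ * (C * ((n : ℝ) ^ 2 + 1) ^ k) := by gcongr; exact hg n
    _ = _ := by ring

lemma exists_norm_heatMode_le : ∃ C, 0 ≤ C ∧ ∀ n x, ‖heatMode n x‖ ≤ C := by
  obtain ⟨C, hC0, hC⟩ := scaleBound_heatMode 0
  exact ⟨C, hC0, fun n x => by simpa using hC n x (mem_univ _)⟩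

lemma summable_heatSeries (hc : ∀ k : ℕ, Summable fun n : ℤ => ((n : ℝ) ^ 2 + 1) ^ k * ‖c n‖)
    (x : ℝ × ℝ) : Summable fun n => c n * heatMode n x := by
  obtain ⟨C, _, hC⟩ := exists_norm_heatMode_le
  exact summable_heatMode_bound hc C 0 fun n => by simpa using hC n x

lemma periodic_heatSeries (τ : ℝ) : Function.Periodic (heatSeries c τ) (2 * Real.pi) := by
  intro θ
  refine tsum_congr fun n => ?_
  have := exp_periodic n θ
  simp only at this
  simp only [heatMode, this]

lemma hasDerivAt_heatMode_snd (n : ℤ) (τ θ : ℝ) :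
    HasDerivAt (fun v => heatMode n (τ, v)) (n * Complex.I * heatMode n (τ, θ)) θ :=
  ((hasDerivAt_exp_mul n θ).const_mul (cutoffPow (n.natAbs ^ 2 - 1) τ : ℂ)).congr_deriv
    (by rw [heatMode]; ring)

lemma deriv_heatSeries (hc : ∀ k : ℕ, Summable fun n : ℤ => ((n : ℝ) ^ 2 + 1) ^ k * ‖c n‖)
    (τ θ : ℝ) : HasDerivAt (heatSeries c τ) (heatSeries (fun n => n * Complex.I * c n) τ θ) θ := by
  obtain ⟨C, hC0, hC⟩ := exists_norm_heatMode_le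
  have h := hasDerivAt_tsum (𝕜 := ℝ) (g := fun n v => c n * heatMode n (τ, v))
    (g' := fun n v => c n * (n * Complex.I * heatMode n (τ, v))) (y₀ := 0)
    ((hc 1).mul_left C) (fun n v => (hasDerivAt_heatMode_snd n τ v).const_mul (c n))
    (fun n v => ?_) (summable_heatSeries hc _) θ
  · exact h.congr_deriv (tsum_congr fun n => by ring)
  · rw [norm_mul, norm_mul, norm_mul, Complex.norm_I, mul_one, Complex.norm_intCast]
    have h1 := abs_intCast_le n
    have h2 := hC n (τ, v)
    calc ‖c n‖ * (|(n : ℝ)| * ‖heatMode n (τ, v)‖)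
        ≤ ‖c n‖ * (((n : ℝ) ^ 2 + 1) * C) := by gcongr
      _ = _ := by ring

lemma summable_mul_coeff (hc : ∀ k : ℕ, Summable fun n : ℤ => ((n : ℝ) ^ 2 + 1) ^ k * ‖c n‖)
    (k : ℕ) : Summable fun n : ℤ => ((n : ℝ) ^ 2 + 1) ^ k * ‖n * Complex.I * c n‖ := by
  refine Summable.of_nonneg_of_le (fun n => by positivity) (fun n => ?_) (hc (k + 1))
  rw [norm_mul, norm_mul, Complex.norm_I, mul_one, Complex.norm_intCast, pow_succ ((n : ℝ) ^ 2 + 1) k, mul_assoc]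
  have h1 := abs_intCast_le n
  gcongr

/-- The linear flow equation `-τ ∂Q/∂τ = Q + Q''`, in the variable `τ = e^{-t}`. -/
lemma hasDerivAt_heatSeries_fst
    (hc : ∀ k : ℕ, Summable fun n : ℤ => ((n : ℝ) ^ 2 + 1) ^ k * ‖c n‖)
    (h0 : c 0 = 0) {τ : ℝ} (hτ : τ ∈ Ioo (0 : ℝ) 1) (θ : ℝ) :
    HasDerivAt (fun s => heatSeries c s θ)
      (-(τ⁻¹ : ℝ) * (heatSeries c τ θ + deriv (deriv (heatSeries c τ)) θ)) τ := by
  obtain ⟨C, hC0, hC⟩ := scaleBound_cutoffPow 1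
  have hd : ∀ (n : ℤ) (s : ℝ), HasDerivAt (fun s => heatMode n (s, θ))
      ((deriv (cutoffPow (n.natAbs ^ 2 - 1)) s : ℝ) * Complex.exp (n * θ * Complex.I)) s := by
    intro n s
    have := ((contDiff_cutoffPow (n.natAbs ^ 2 - 1)).differentiable (by simp) s).hasDerivAt
    exact this.ofReal_comp.mul_const (Complex.exp (n * θ * Complex.I))
  have h := hasDerivAt_tsum (𝕜 := ℝ) (g := fun n s => c n * heatMode n (s, θ))
    (g' := fun n s => c n * ((deriv (cutoffPow (n.natAbs ^ 2 - 1)) s : ℝ)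
      * Complex.exp (n * θ * Complex.I))) (y₀ := 0)
    ((hc 1).mul_left C) (fun n v => (hd n v).const_mul (c n))
    (fun n s => ?_) (summable_heatSeries hc _) τ
  · refine h.congr_deriv ?_
    have e1 : deriv (heatSeries c τ) = heatSeries (fun n => n * Complex.I * c n) τ :=
      funext fun v => (deriv_heatSeries hc τ v).deriv
    have hc' := summable_mul_coeff hc
    have e2 := (deriv_heatSeries hc' τ θ).deriv
    rw [e1, e2, heatSeries, heatSeries,
      ← (summable_heatSeries hc (τ, θ)).tsum_add (summable_heatSeries (summable_mul_coeff hc') _),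
      ← tsum_mul_left]
    refine tsum_congr fun n => ?_
    rcases eq_or_ne n 0 with rfl | hn
    · simp [h0]
    · have hev : cutoffPow (n.natAbs ^ 2 - 1) =ᶠ[𝓝 τ] fun s => s ^ (n.natAbs ^ 2 - 1) := by
        filter_upwards [Ioo_mem_nhds hτ.1 hτ.2] with s hs
        exact cutoffPow_eq_pow _ ⟨by linarith [hs.1], hs.2.le⟩
      have hτ0 : (τ : ℂ) ≠ 0 := by exact_mod_cast hτ.1.ne'
      rw [hev.deriv_eq, heatMode, hev.self_of_nhds]
      simp only [deriv_pow_field]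
      have hn1 : 1 ≤ n.natAbs ^ 2 := Nat.one_le_pow _ _ (Int.natAbs_pos.2 hn)
      have hcast : ((n.natAbs ^ 2 - 1 : ℕ) : ℂ) = (n : ℂ) ^ 2 - 1 := by
        rw [Nat.cast_sub hn1]
        have h2 : (((n.natAbs : ℤ) ^ 2 : ℤ) : ℂ) = ((n ^ 2 : ℤ) : ℂ) := by rw [Int.natAbs_sq]
        rw [Int.cast_pow, Int.cast_natCast, Int.cast_pow] at h2
        rw [Nat.cast_pow, h2, Nat.cast_one]
      generalize n.natAbs ^ 2 - 1 = m at hcast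
      push_cast
      rcases Nat.eq_zero_or_pos m with rfl | hm
      · simp only [Nat.cast_zero, zero_mul, mul_zero, pow_zero, one_mul]
        have : (n : ℂ) ^ 2 - 1 = 0 := by rw [← hcast]; simp
        have h3 : (n : ℂ) * Complex.I * (n * Complex.I * c n) = -((n : ℂ) ^ 2) * c n := by
          linear_combination (n : ℂ) ^ 2 * c n * Complex.I_sq
        rw [h3]
        linear_combination (-(τ : ℂ)⁻¹ * c n * Complex.exp (n * θ * Complex.I)) * this
      · have h4 : (τ : ℂ) ^ m = τ * (τ : ℂ) ^ (m - 1) := by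
          rw [← pow_succ', Nat.sub_add_cancel hm]
        have h3 : (n : ℂ) * Complex.I * (n * Complex.I * c n) = -((n : ℂ) ^ 2) * c n := by
          linear_combination (n : ℂ) ^ 2 * c n * Complex.I_sq
        rw [h3, h4, hcast]
        field_simp
        ring
  · rw [norm_mul, norm_mul, norm_exp_mul, mul_one, Complex.norm_real]
    have h1 := hC (n.natAbs ^ 2 - 1) s
    rw [norm_iteratedFDeriv_eq_norm_iteratedDeriv, iteratedDeriv_one, pow_one] at h1
    have h2 := natAbs_sq_sub_one_le n
    calc ‖c n‖ * ‖deriv (cutoffPow (n.natAbs ^ 2 - 1)) s‖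
        ≤ ‖c n‖ * (C * ((n : ℝ) ^ 2 + 1)) := by
          gcongr
          exact h1.trans (by gcongr)
      _ = _ := by ring

lemma integral_exp_mul_heatSeries
    (hc : ∀ k : ℕ, Summable fun n : ℤ => ((n : ℝ) ^ 2 + 1) ^ k * ‖c n‖) (τ : ℝ) {j : ℤ}
    (hj : c (-j) = 0) :
    ∫ x in (0 : ℝ)..(2 * Real.pi), Complex.exp (j * x * Complex.I) * heatSeries c τ x = 0 := by
  obtain ⟨C, hC0, hC⟩ := exists_norm_heatMode_le
  have hcont : ∀ n, Continuous fun x : ℝ => heatMode n (τ, x) := fun n =>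
    (contDiff_heatMode n).continuous.comp (by fun_prop)
  have h := intervalIntegral.hasSum_integral_of_dominated_convergence (a := 0) (b := 2 * Real.pi)
    (μ := volume) (F := fun (n : ℤ) (x : ℝ) =>
      Complex.exp (j * x * Complex.I) * (c n * heatMode n (τ, x)))
    (f := fun x => Complex.exp (j * x * Complex.I) * heatSeries c τ x)
    (fun n _ => C * (((n : ℝ) ^ 2 + 1) ^ 0 * ‖c n‖)) (fun n => ?_) (fun n => ?_) ?_ ?_ ?_
  · have hz : ∀ n : ℤ, ∫ x in (0 : ℝ)..(2 * Real.pi),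
        Complex.exp (j * x * Complex.I) * (c n * heatMode n (τ, x)) = 0 := by
      intro n
      rcases eq_or_ne (j + n) 0 with hjn | hjn
      · rw [show n = -j by omega]
        simp [hj]
      · have : ∀ x : ℝ, Complex.exp (j * x * Complex.I) * (c n * heatMode n (τ, x))
            = (c n * (cutoffPow (n.natAbs ^ 2 - 1) τ : ℂ)) *
              Complex.exp ((j + n : ℤ) * x * Complex.I) := by
          intro x
          rw [heatMode]
          push_cast
          rw [add_mul, add_mul, Complex.exp_add]
          ring
        simp_rw [this]
        rw [intervalIntegral.integral_const_mul, integral_exp_mul hjn, mul_zero]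
    simp_rw [hz] at h
    exact h.unique hasSum_zero
  · have := hcont n
    exact (Continuous.aestronglyMeasurable (by fun_prop))
  · refine ae_of_all _ fun x _ => ?_
    rw [norm_mul, norm_exp_mul, one_mul, norm_mul, pow_zero, one_mul, mul_comm]
    gcongr
    exact hC _ _
  · exact ae_of_all _ fun x _ => (hc 0).mul_left C
  · exact intervalIntegrable_const
  · exact ae_of_all _ fun x _ => (summable_heatSeries hc (τ, x)).hasSum.mul_left _

end Series

lemma deriv_re {f : ℝ → ℂ} (hf : Differentiable ℝ f) :
    deriv (fun x => (f x).re) = fun x => (deriv f x).re :=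
  funext fun x => (Complex.reCLM.hasFDerivAt.comp_hasDerivAt x (hf x).hasDerivAt).deriv

/-- The linear flow `Q_t = Q + Q''` for initial data without modes `0, ±1`, as a function of
`τ = e^{-t}` and the normal angle. Since the modes decay like `τ ^ (n² - 1)`, it is smooth up to
`τ = 0`, i.e. `t = ∞`. -/
theorem exists_linear_flow {q : ℝ → ℝ} (hq : ContDiff ℝ ∞ q)
    (hp : Function.Periodic q (2 * Real.pi))
    (h0 : ∫ x in (0 : ℝ)..(2 * Real.pi), q x = 0)
    (hcos : ∫ x in (0 : ℝ)..(2 * Real.pi), q x * Real.cos x = 0)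
    (hsin : ∫ x in (0 : ℝ)..(2 * Real.pi), q x * Real.sin x = 0) :
    ∃ Q : ℝ → ℝ → ℝ, ContDiff ℝ ∞ (fun x : ℝ × ℝ => Q x.1 x.2) ∧
      (∀ τ, Function.Periodic (Q τ) (2 * Real.pi)) ∧
      (∀ τ, ∫ x in (0 : ℝ)..(2 * Real.pi), Q τ x = 0) ∧
      (∀ τ, ∫ x in (0 : ℝ)..(2 * Real.pi), Q τ x * Real.cos x = 0) ∧
      (∀ τ, ∫ x in (0 : ℝ)..(2 * Real.pi), Q τ x * Real.sin x = 0) ∧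
      (∀ x, Q 0 x = 0) ∧ Q 1 = q ∧
      ∀ τ ∈ Icc (0 : ℝ) 1, ∀ x,
        τ * deriv (fun s => Q s x) τ = -(Q τ x + deriv (deriv (Q τ)) x) := by
  set f : ℝ → ℂ := fun x => (q x : ℂ) with hf
  have hfs : ContDiff ℝ ∞ f := Complex.ofRealCLM.contDiff.comp hq
  have hfp : Function.Periodic f (2 * Real.pi) := fun x => by simp only [hf, hp x]
  set c := circleCoeff f with hcdef
  have hc : ∀ k : ℕ, Summable fun n : ℤ => ((n : ℝ) ^ 2 + 1) ^ k * ‖c n‖ :=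
    summable_circleCoeff hfs hfp
  have hexp : ∀ x : ℝ, Complex.exp (x * Complex.I) = Real.cos x + Real.sin x * Complex.I := by
    intro x
    rw [Complex.exp_mul_I, Complex.ofReal_cos, Complex.ofReal_sin]
  have hexp' : ∀ x : ℝ, Complex.exp (-(x * Complex.I)) = Real.cos x - Real.sin x * Complex.I := by
    intro x
    rw [← neg_mul, Complex.exp_mul_I, Complex.ofReal_cos, Complex.ofReal_sin, Complex.cos_neg,
      Complex.sin_neg]
    ring
  have hqc := hq.continuous
  have hIcos : ∫ x in (0 : ℝ)..(2 * Real.pi), ((q x * Real.cos x : ℝ) : ℂ) = 0 := by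
    rw [intervalIntegral.integral_ofReal, hcos, Complex.ofReal_zero]
  have hIsin : ∫ x in (0 : ℝ)..(2 * Real.pi), ((q x * Real.sin x : ℝ) : ℂ) = 0 := by
    rw [intervalIntegral.integral_ofReal, hsin, Complex.ofReal_zero]
  have hc0 : c 0 = 0 := by
    simp [hcdef, circleCoeff, hf, intervalIntegral.integral_ofReal, h0]
  have key : ∀ s : ℂ, ∫ x in (0 : ℝ)..(2 * Real.pi), (((q x * Real.cos x : ℝ) : ℂ)
      + s * ((q x * Real.sin x : ℝ) : ℂ)) = 0 := by
    intro s
    rw [intervalIntegral.integral_add (Continuous.intervalIntegrable (by fun_prop) _ _)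
      (Continuous.intervalIntegrable (by fun_prop) _ _), intervalIntegral.integral_const_mul,
      hIcos, hIsin, mul_zero, add_zero]
  have hc1 : c 1 = 0 := by
    rw [hcdef, circleCoeff]
    refine smul_eq_zero_of_right _
      ((intervalIntegral.integral_congr fun x _ => ?_).trans (key (-Complex.I)))
    simp only [hf]
    rw [show ((-1 : ℤ) : ℂ) * x * Complex.I = -(x * Complex.I) by push_cast; ring, hexp']
    push_cast
    ring
  have hcm1 : c (-1) = 0 := by
    rw [hcdef, circleCoeff]
    refine smul_eq_zero_of_right _
      ((intervalIntegral.integral_congr fun x _ => ?_).trans (key Complex.I))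
    simp only [hf]
    rw [show ((- -1 : ℤ) : ℂ) * x * Complex.I = x * Complex.I by push_cast; ring, hexp]
    push_cast
    ring
  have hS : ContDiff ℝ ∞ (fun x : ℝ × ℝ => heatSeries c x.1 x.2) := contDiff_heatSeries hc
  have hQ : ContDiff ℝ ∞ (fun x : ℝ × ℝ => (heatSeries c x.1 x.2).re) :=
    Complex.reCLM.contDiff.comp hS
  have hSc : ∀ τ, Continuous (heatSeries c τ) := fun τ => (contDiff_comp_mk hS τ).continuous
  have hre : ∀ {g : ℝ → ℂ}, Continuous g → ∫ x in (0 : ℝ)..(2 * Real.pi), g x = 0 →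
      ∫ x in (0 : ℝ)..(2 * Real.pi), (g x).re = 0 := by
    intro g hg h
    have := Complex.reCLM.intervalIntegral_comp_comm (hg.intervalIntegrable (μ := volume) 0 (2 * Real.pi))
    simp only [Complex.reCLM_apply] at this
    rw [this, h, Complex.zero_re]
  have i0 := fun τ => integral_exp_mul_heatSeries hc τ (j := 0) (by simpa using hc0)
  have i1 := fun τ => integral_exp_mul_heatSeries hc τ (j := 1) hcm1
  have i2 := fun τ => integral_exp_mul_heatSeries hc τ (j := -1) (by simpa using hc1)
  have cexp : ∀ j : ℤ, Continuous fun x : ℝ => Complex.exp (j * x * Complex.I) := fun j =>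
    (contDiff_exp_mul j).continuous
  have comb : ∀ (s : ℂ) (τ : ℝ), ∫ x in (0 : ℝ)..(2 * Real.pi),
      (Complex.exp ((1 : ℤ) * x * Complex.I) * heatSeries c τ x
        + s * (Complex.exp ((-1 : ℤ) * x * Complex.I) * heatSeries c τ x)) = 0 := by
    intro s τ
    have hSτ := hSc τ
    rw [intervalIntegral.integral_add (Continuous.intervalIntegrable (by fun_prop) _ _)
      (Continuous.intervalIntegrable (by fun_prop) _ _),
      intervalIntegral.integral_const_mul, i1, i2, mul_zero, add_zero]
  refine ⟨fun τ x => (heatSeries c τ x).re, hQ, fun τ x => ?_, fun τ => ?_, fun τ => ?_,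
    fun τ => ?_, fun x => ?_, ?_, fun τ hτ x => ?_⟩
  · simp only [periodic_heatSeries τ x]
  · refine hre (hSc τ) ?_
    simpa using i0 τ
  · have h2 := hre (g := fun x => ((1 / 2 : ℝ) : ℂ) *
      (Complex.exp ((1 : ℤ) * x * Complex.I) * heatSeries c τ x
        + 1 * (Complex.exp ((-1 : ℤ) * x * Complex.I) * heatSeries c τ x)))
      (continuous_const.mul (((cexp 1).mul (hSc τ)).add
        (continuous_const.mul ((cexp (-1)).mul (hSc τ)))))
      (by rw [intervalIntegral.integral_const_mul, comb 1 τ, mul_zero])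
    refine (intervalIntegral.integral_congr fun x _ => ?_).trans h2
    simp only
    rw [show ((-1 : ℤ) : ℂ) * x * Complex.I = -(x * Complex.I) by push_cast; ring, hexp',
      show ((1 : ℤ) : ℂ) * x * Complex.I = x * Complex.I by push_cast; ring, hexp,
      Complex.re_ofReal_mul]
    simp only [Complex.add_re, Complex.mul_re, Complex.sub_re, Complex.sub_im, Complex.add_im,
      Complex.ofReal_re, Complex.ofReal_im, Complex.mul_im, Complex.I_re, Complex.I_im,
      Complex.one_re, Complex.one_im]
    ring
  · have h2 := hre (g := fun x => (((1 / 2 : ℝ) : ℂ) * -Complex.I) *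
      (Complex.exp ((1 : ℤ) * x * Complex.I) * heatSeries c τ x
        + (-1) * (Complex.exp ((-1 : ℤ) * x * Complex.I) * heatSeries c τ x)))
      (continuous_const.mul (((cexp 1).mul (hSc τ)).add
        (continuous_const.mul ((cexp (-1)).mul (hSc τ)))))
      (by rw [intervalIntegral.integral_const_mul, comb (-1) τ, mul_zero])
    refine (intervalIntegral.integral_congr fun x _ => ?_).trans h2
    simp only
    rw [show ((-1 : ℤ) : ℂ) * x * Complex.I = -(x * Complex.I) by push_cast; ring, hexp',
      show ((1 : ℤ) : ℂ) * x * Complex.I = x * Complex.I by push_cast; ring, hexp,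
      mul_assoc, Complex.re_ofReal_mul]
    simp only [Complex.add_re, Complex.mul_re, Complex.sub_re, Complex.sub_im, Complex.add_im,
      Complex.ofReal_re, Complex.ofReal_im, Complex.mul_im, Complex.I_re, Complex.I_im,
      Complex.one_re, Complex.one_im, Complex.neg_re, Complex.neg_im]
    ring
  · have : heatSeries c 0 x = 0 := by
      refine (tsum_congr fun n => ?_).trans (tsum_zero (β := ℤ))
      by_cases hn : 2 ≤ n.natAbs
      · have hm : n.natAbs ^ 2 - 1 ≠ 0 := by
          have : 2 ^ 2 ≤ n.natAbs ^ 2 := Nat.pow_le_pow_left hn 2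
          omega
        rw [heatMode, cutoffPow_eq_pow _ ⟨by norm_num, by norm_num⟩, zero_pow hm]
        simp
      · have hn' : n = 0 ∨ n = 1 ∨ n = -1 := by omega
        rcases hn' with rfl | rfl | rfl
        · rw [hc0, zero_mul]
        · rw [hc1, zero_mul]
        · rw [hcm1, zero_mul]
    simp only [this, Complex.zero_re]
  · funext x
    have hs := hasSum_circleCoeff hfs.continuous hfp
      (Summable.of_norm (by simpa using hc 0)) x
    have : heatSeries c 1 x = f x := by
      rw [← hs.tsum_eq, heatSeries]
      refine tsum_congr fun n => ?_
      rw [heatMode, cutoffPow_eq_pow _ ⟨by norm_num, le_rfl⟩]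
      simp [hcdef]
    simp only [this, hf, Complex.ofReal_re]
  · -- the equation holds for `0 < τ < 1` and extends to the closed interval by continuity
    have hQ1 := contDiff_deriv_fst (F := fun τ x => (heatSeries c τ x).re) hQ
    have hQ2 := contDiff_deriv_snd (F := fun τ x => deriv (fun x => (heatSeries c τ x).re) x)
      (contDiff_deriv_snd (F := fun τ x => (heatSeries c τ x).re) hQ)
    have cl : IsClosed {τ : ℝ | τ * deriv (fun s => (heatSeries c s x).re) τ
        = -((heatSeries c τ x).re + deriv (deriv (fun x => (heatSeries c τ x).re)) x)} := by
      refine isClosed_eq ?_ ?_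
      · exact continuous_id.mul (contDiff_comp_mk_left
          (F := fun τ x => deriv (fun s => (heatSeries c s x).re) τ) hQ1 x).continuous
      · exact ((contDiff_comp_mk_left (F := fun τ x => (heatSeries c τ x).re) hQ x).continuous.add (contDiff_comp_mk_left
          (F := fun τ x => deriv (deriv (fun x => (heatSeries c τ x).re)) x) hQ2 x).continuous).neg
    have hsub : Ioo (0 : ℝ) 1 ⊆ {τ : ℝ | τ * deriv (fun s => (heatSeries c s x).re) τ
        = -((heatSeries c τ x).re + deriv (deriv (fun x => (heatSeries c τ x).re)) x)} := by
      intro s hs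
      have hd := hasDerivAt_heatSeries_fst hc hc0 hs x
      have hd2 := (Complex.reCLM.hasFDerivAt.comp_hasDerivAt s hd).deriv
      have hsm : ContDiff ℝ ∞ (heatSeries c s) := contDiff_comp_mk hS s
      have e1 : deriv (deriv (fun x => (heatSeries c s x).re)) x
          = (deriv (deriv (heatSeries c s)) x).re := by
        rw [deriv_re (hsm.differentiable (by simp)),
          deriv_re ((contDiff_infty_iff_deriv.1 hsm).2.differentiable (by simp))]
      have e3 : deriv (fun s => (heatSeries c s x).re) s = -s⁻¹ * ((heatSeries c s x).re
          + (deriv (deriv (heatSeries c s)) x).re) := by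
        refine hd2.trans ?_
        rw [Complex.reCLM_apply, ← Complex.ofReal_neg, Complex.re_ofReal_mul, Complex.add_re]
      rw [mem_ofPred_eq, e1, e3]
      have := hs.1.ne'
      field_simp
    have := (closure_minimal hsub cl)
    rw [closure_Ioo (by norm_num)] at this
    exact this hτ

end LegendreFlow

/-! ### The flow of a smooth vector field on the circle -/

namespace LegendreFlow

open Set Filter Topology MeasureTheory

section Flow

variable {W : ℝ → ℝ → ℝ}

lemma exists_bound_of_periodic {G : ℝ → ℝ → ℝ} (hG : Continuous fun x : ℝ × ℝ => G x.1 x.2)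
    (hp : ∀ τ, Function.Periodic (G τ) (2 * Real.pi)) (a b : ℝ) :
    ∃ M, ∀ τ ∈ Icc a b, ∀ x, ‖G τ x‖ ≤ M := by
  obtain ⟨M, hM⟩ := ((isCompact_Icc (a := a) (b := b)).prod
    (isCompact_Icc (a := 0) (b := 2 * Real.pi))).exists_bound_of_continuousOn hG.continuousOn
  refine ⟨M, fun τ hτ x => ?_⟩
  obtain ⟨y, hy, hxy⟩ := (hp τ).exists_mem_Ico₀ Real.two_pi_pos x
  rw [hxy]
  exact hM (τ, y) ⟨hτ, Ico_subset_Icc_self hy⟩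

lemma exists_lipschitz (hW : ContDiff ℝ ∞ fun x : ℝ × ℝ => W x.1 x.2)
    (hp : ∀ τ, Function.Periodic (W τ) (2 * Real.pi)) (a b : ℝ) :
    ∃ K : NNReal, ∀ τ ∈ Icc a b, LipschitzWith K (W τ) := by
  obtain ⟨M, hM⟩ := exists_bound_of_periodic (contDiff_deriv_snd hW).continuous
    (fun τ => periodic_deriv (hp τ)) a b
  refine ⟨M.toNNReal, fun τ hτ => ?_⟩
  refine lipschitzWith_of_nnnorm_deriv_le ((contDiff_comp_mk hW τ).differentiable (by simp))
    fun x => ?_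
  rw [← NNReal.coe_le_coe, coe_nnnorm]
  exact (hM τ hτ x).trans (Real.le_coe_toNNReal M)

lemma unique_of_hasDerivAt (hW : ContDiff ℝ ∞ fun x : ℝ × ℝ => W x.1 x.2)
    (hp : ∀ τ, Function.Periodic (W τ) (2 * Real.pi)) {t₀ R : ℝ} {y z : ℝ → ℝ}
    (hy : ∀ τ ∈ Ioo (t₀ - R) (t₀ + R), HasDerivAt y (W τ (y τ)) τ)
    (hz : ∀ τ ∈ Ioo (t₀ - R) (t₀ + R), HasDerivAt z (W τ (z τ)) τ) (h0 : y t₀ = z t₀) :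
    EqOn y z (Ioo (t₀ - R) (t₀ + R)) := by
  obtain ⟨K, hK⟩ := exists_lipschitz hW hp (t₀ - R) (t₀ + R)
  rcases le_or_gt R 0 with hR | hR
  · rw [Ioo_eq_empty (by linarith)]; exact eqOn_empty _ _
  exact ODE_solution_unique_of_mem_Ioo (s := fun _ => univ) (v := W) (K := K)
    (fun t ht => (hK t (Ioo_subset_Icc_self ht)).lipschitzOnWith) (t₀ := t₀)
    ⟨by linarith, by linarith⟩ (fun t ht => ⟨hy t ht, mem_univ _⟩)
    (fun t ht => ⟨hz t ht, mem_univ _⟩) h0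

lemma exists_solution_Ioo (hW : ContDiff ℝ ∞ fun x : ℝ × ℝ => W x.1 x.2)
    (hp : ∀ τ, Function.Periodic (W τ) (2 * Real.pi)) (t₀ u : ℝ) {R : ℝ} (hR : 0 ≤ R) :
    ∃ y : ℝ → ℝ, y t₀ = u ∧ ∀ τ ∈ Ioo (t₀ - R) (t₀ + R), HasDerivAt y (W τ (y τ)) τ := by
  obtain ⟨K, hK⟩ := exists_lipschitz hW hp (t₀ - R) (t₀ + R)
  obtain ⟨M, hM⟩ := exists_bound_of_periodic hW.continuous hp (t₀ - R) (t₀ + R)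
  have ht₀ : t₀ ∈ Icc (t₀ - R) (t₀ + R) := ⟨by linarith, by linarith⟩
  have hPL : IsPicardLindelof W (⟨t₀, ht₀⟩ : Icc (t₀ - R) (t₀ + R)) u
      (M.toNNReal * R.toNNReal) 0 M.toNNReal K :=
    { lipschitzOnWith := fun t ht => (hK t ht).lipschitzOnWith
      continuousOn := fun x _ => (contDiff_comp_mk_left hW x).continuous.continuousOn
      norm_le := fun t ht x _ => (hM t ht x).trans (Real.le_coe_toNNReal M)
      mul_max_le := by
        simp [Real.coe_toNNReal R hR] }
  obtain ⟨y, hy0, hy⟩ := hPL.exists_eq_forall_mem_Icc_hasDerivWithinAt₀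
  exact ⟨y, hy0, fun τ hτ => (hy τ (Ioo_subset_Icc_self hτ)).hasDerivAt (Icc_mem_nhds hτ.1 hτ.2)⟩

lemma exists_global_solution (hW : ContDiff ℝ ∞ fun x : ℝ × ℝ => W x.1 x.2)
    (hp : ∀ τ, Function.Periodic (W τ) (2 * Real.pi)) (t₀ u : ℝ) :
    ∃ y : ℝ → ℝ, y t₀ = u ∧ ∀ τ, HasDerivAt y (W τ (y τ)) τ := by
  choose y hy0 hy using fun N : ℕ => exists_solution_Ioo hW hp t₀ u (Nat.cast_nonneg N)
  have heq : ∀ {M N : ℕ}, M ≤ N → EqOn (y M) (y N) (Ioo (t₀ - M) (t₀ + M)) := by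
    intro M N hMN
    have hMN' : (M : ℝ) ≤ N := by exact_mod_cast hMN
    exact unique_of_hasDerivAt hW hp (hy M)
      (fun τ hτ => hy N τ ⟨by linarith [hτ.1], by linarith [hτ.2]⟩) (by rw [hy0, hy0])
  set z : ℝ → ℝ := fun τ => y (⌈|τ - t₀|⌉₊ + 1) τ with hz
  have hzy : ∀ N : ℕ, EqOn z (y N) (Ioo (t₀ - N) (t₀ + N)) := by
    intro N τ hτ
    have h1 : |τ - t₀| < N := by rw [abs_lt]; constructor <;> linarith [hτ.1, hτ.2]
    have h2 : τ ∈ Ioo (t₀ - (⌈|τ - t₀|⌉₊ + 1 : ℕ)) (t₀ + (⌈|τ - t₀|⌉₊ + 1 : ℕ)) := by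
      have h3 := Nat.le_ceil |τ - t₀|
      have h4 := abs_le.1 h3
      push_cast
      constructor <;> linarith [h4.1, h4.2]
    rcases le_total (⌈|τ - t₀|⌉₊ + 1) N with h | h
    · exact heq h h2
    · exact (heq h hτ).symm
  refine ⟨z, by simp only [hz, hy0], fun τ => ?_⟩
  obtain ⟨N, hN⟩ := exists_nat_gt |τ - t₀|
  have hmem : τ ∈ Ioo (t₀ - N) (t₀ + N) := by
    have := abs_lt.1 hN
    constructor <;> linarith [this.1, this.2]
  rw [hzy N hmem]
  refine (hy N τ hmem).congr_of_eventuallyEq ?_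
  filter_upwards [Ioo_mem_nhds hmem.1 hmem.2] with s hs using hzy N hs

/-- The averaged slope of the vector field between two points: `W y - W z = (y - z) * slope`. -/
noncomputable def meanSlope (W : ℝ → ℝ → ℝ) (τ y z : ℝ) : ℝ :=
  ∫ x in (0 : ℝ)..1, deriv (W τ) (z + x * (y - z))

lemma continuous_meanSlope (hW : ContDiff ℝ ∞ fun x : ℝ × ℝ => W x.1 x.2) :
    Continuous fun p : ℝ × ℝ × ℝ => meanSlope W p.1 p.2.1 p.2.2 := by
  refine intervalIntegral.continuous_parametric_intervalIntegral_of_continuous'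
    (f := fun (p : ℝ × ℝ × ℝ) (x : ℝ) => deriv (W p.1) (p.2.2 + x * (p.2.1 - p.2.2))) ?_ 0 1
  exact (contDiff_deriv_snd hW).continuous.comp
    (f := fun q : (ℝ × ℝ × ℝ) × ℝ => ((q.1.1, q.1.2.2 + q.2 * (q.1.2.1 - q.1.2.2)) : ℝ × ℝ))
    (by fun_prop)

lemma sub_eq_mul_meanSlope (hW : ContDiff ℝ ∞ fun x : ℝ × ℝ => W x.1 x.2) (τ y z : ℝ) :
    W τ y - W τ z = (y - z) * meanSlope W τ y z := by
  have hWτ := contDiff_comp_mk hW τ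
  have hd : ∀ x : ℝ, HasDerivAt (fun x => W τ (z + x * (y - z)))
      (deriv (W τ) (z + x * (y - z)) * (y - z)) x := by
    intro x
    have h1 : HasDerivAt (fun x : ℝ => z + x * (y - z)) (y - z) x := by
      simpa using ((hasDerivAt_id x).mul_const (y - z)).const_add z
    exact (hWτ.differentiable (by simp) _).hasDerivAt.comp x h1
  have hc : Continuous fun x : ℝ => deriv (W τ) (z + x * (y - z)) * (y - z) := by
    have := hWτ.continuous_deriv (by simp)
    fun_prop
  have h2 := intervalIntegral.integral_eq_sub_of_hasDerivAt (a := 0) (b := 1) (fun x _ => hd x)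
    (hc.intervalIntegrable _ _)
  rw [intervalIntegral.integral_mul_const] at h2
  simp only [one_mul, zero_mul, add_zero] at h2
  rw [show z + (y - z) = y by ring] at h2
  rw [← h2, mul_comm, meanSlope]

/-- A time-dependent smooth vector field on the circle has a global flow, which is smooth in time
and initial value and consists of orientation preserving diffeomorphisms. The derivative in the
initial value is the exponential of an integral along the solution, so that smoothness follows by
induction on the order, starting from continuity. -/
theorem exists_smooth_flow (hW : ContDiff ℝ ∞ fun x : ℝ × ℝ => W x.1 x.2)
    (hp : ∀ τ, Function.Periodic (W τ) (2 * Real.pi)) (t₀ : ℝ) :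
    ∃ Θ : ℝ → ℝ → ℝ, ContDiff ℝ ∞ (fun x : ℝ × ℝ => Θ x.1 x.2) ∧ (∀ u, Θ t₀ u = u) ∧
      (∀ τ u, HasDerivAt (fun s => Θ s u) (W τ (Θ τ u)) τ) ∧
      (∀ τ u, 0 < deriv (Θ τ) u) ∧ ∀ τ u, Θ τ (u + 2 * Real.pi) = Θ τ u + 2 * Real.pi := by
  choose y hy0 hy using exists_global_solution hW hp t₀
  set Θ : ℝ → ℝ → ℝ := fun τ u => y u τ with hΘ
  have hcu : ∀ u, Continuous fun s => Θ s u := fun u =>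
    continuous_iff_continuousAt.2 fun s => (hy u s).continuousAt
  have hms := continuous_meanSlope hW
  -- the difference of two solutions solves a linear equation
  have hdiff : ∀ τ u v, Θ τ v - Θ τ u =
      (v - u) * Real.exp (∫ s in t₀..τ, meanSlope W s (Θ s v) (Θ s u)) := by
    intro τ u v
    set g : ℝ → ℝ := fun s => meanSlope W s (Θ s v) (Θ s u) with hg
    have hgc : Continuous g := hms.comp
      (f := fun s => ((s, Θ s v, Θ s u) : ℝ × ℝ × ℝ))
      (continuous_id.prodMk ((hcu v).prodMk (hcu u)))
    have hG : ∀ s, HasDerivAt (fun s => ∫ r in t₀..s, g r) (g s) s := fun s =>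
      intervalIntegral.integral_hasDerivAt_right (hgc.intervalIntegrable _ _)
        (hgc.stronglyMeasurableAtFilter _ _) hgc.continuousAt
    have hconst : ∀ s, HasDerivAt
        (fun s => (Θ s v - Θ s u) * Real.exp (-∫ r in t₀..s, g r)) 0 s := by
      intro s
      refine (((hy v s).sub (hy u s)).mul (hG s).neg.exp).congr_deriv ?_
      have := sub_eq_mul_meanSlope hW s (y v s) (y u s)
      simp only [this, hg, hΘ, Pi.sub_apply]
      ring
    have h1 := is_const_of_deriv_eq_zero (fun s => (hconst s).differentiableAt)
      (fun s => (hconst s).deriv) τ t₀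
    simp only [intervalIntegral.integral_same, neg_zero, Real.exp_zero, mul_one] at h1
    rw [Real.exp_neg] at h1
    have h2 := Real.exp_pos (∫ r in t₀..τ, g r)
    have h3 : Θ t₀ v - Θ t₀ u = v - u := by simp only [hΘ, hy0]
    rw [h3] at h1
    rw [← h1]
    field_simp
  have hcont : Continuous fun x : ℝ × ℝ => Θ x.1 x.2 := by
    rw [continuous_iff_continuousAt]
    rintro ⟨τ, u⟩
    obtain ⟨K, hK⟩ := exists_bound_of_periodic (contDiff_deriv_snd hW).continuous
      (fun τ => periodic_deriv (hp τ)) (min t₀ (τ - 1)) (max t₀ (τ + 1))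
    have hK0 : 0 ≤ K := (norm_nonneg _).trans (hK t₀ ⟨min_le_left _ _, le_max_left _ _⟩ 0)
    have hlip : ∀ s ∈ Ioo (τ - 1) (τ + 1), ∀ v w, |Θ s v - Θ s w| ≤
        Real.exp (K * (|τ - t₀| + 1)) * |v - w| := by
      intro s hs v w
      rw [hdiff s w v, abs_mul, mul_comm, abs_of_pos (Real.exp_pos _)]
      gcongr
      have hb := intervalIntegral.norm_integral_le_of_norm_le_const (a := t₀) (b := s) (C := K)
        (f := fun s => meanSlope W s (Θ s v) (Θ s w)) (fun r hr => ?_)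
      · refine (le_abs_self _).trans (hb.trans ?_)
        gcongr
        have : |s - τ| ≤ 1 := by rw [abs_le]; constructor <;> linarith [hs.1, hs.2]
        calc |s - t₀| ≤ |s - τ| + |τ - t₀| := abs_sub_le _ _ _
          _ ≤ _ := by linarith
      · have hr' : r ∈ Icc (min t₀ (τ - 1)) (max t₀ (τ + 1)) := by
          have := uIoc_subset_uIcc hr
          rw [uIcc, mem_Icc] at this
          refine ⟨le_trans ?_ this.1, this.2.trans ?_⟩
          · exact min_le_min_left _ hs.1.le
          · exact max_le_max_left _ hs.2.le
        have := intervalIntegral.norm_integral_le_of_norm_le_const (a := 0) (b := 1) (C := K)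
          (f := fun x => deriv (W r) (Θ r w + x * (Θ r v - Θ r w))) (fun x _ => hK r hr' _)
        simpa [meanSlope] using this
    rw [ContinuousAt, tendsto_iff_dist_tendsto_zero]
    have hz : Tendsto (fun x : ℝ × ℝ => Real.exp (K * (|τ - t₀| + 1)) * |x.2 - u|
        + |Θ x.1 u - Θ τ u|) (𝓝 (τ, u)) (𝓝 0) := by
      have hc : Continuous fun x : ℝ × ℝ => Real.exp (K * (|τ - t₀| + 1)) * |x.2 - u|
          + |Θ x.1 u - Θ τ u| := by
        have := hcu u
        fun_prop
      simpa using hc.tendsto (τ, u)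
    refine squeeze_zero' (.of_forall fun _ => dist_nonneg) ?_ hz
    have hmem : Ioo (τ - 1) (τ + 1) ×ˢ (univ : Set ℝ) ∈ 𝓝 (τ, u) :=
      prod_mem_nhds (Ioo_mem_nhds (by linarith) (by linarith)) univ_mem
    filter_upwards [hmem] with x hx
    rw [Real.dist_eq]
    calc |Θ x.1 x.2 - Θ τ u| ≤ |Θ x.1 x.2 - Θ x.1 u| + |Θ x.1 u - Θ τ u| := abs_sub_le _ _ _
      _ ≤ _ := by gcongr; exact hlip x.1 hx.1 x.2 u
  have hdu : ∀ τ u, HasDerivAt (Θ τ)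
      (Real.exp (∫ s in t₀..τ, deriv (W s) (Θ s u))) u := by
    intro τ u
    rw [hasDerivAt_iff_tendsto_slope]
    have hc : Continuous fun v => Real.exp (∫ s in t₀..τ, meanSlope W s (Θ s v) (Θ s u)) := by
      refine Real.continuous_exp.comp
        (intervalIntegral.continuous_parametric_intervalIntegral_of_continuous'
          (f := fun (v s : ℝ) => meanSlope W s (Θ s v) (Θ s u)) ?_ t₀ τ)
      exact hms.comp (f := fun p : ℝ × ℝ => ((p.2, Θ p.2 p.1, Θ p.2 u) : ℝ × ℝ × ℝ))
        (continuous_snd.prodMk ((hcont.comp (f := fun p : ℝ × ℝ => ((p.2, p.1) : ℝ × ℝ))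
          (by fun_prop)).prodMk ((hcu u).comp continuous_snd)))
    have h1 := (hc.tendsto u).mono_left (nhdsWithin_le_nhds (s := {u}ᶜ))
    have h2 : ∀ s, meanSlope W s (Θ s u) (Θ s u) = deriv (W s) (Θ s u) := by
      intro s; simp [meanSlope]
    simp only [h2] at h1
    refine h1.congr' ?_
    filter_upwards [self_mem_nhdsWithin] with v hv
    have hvu : v - u ≠ 0 := sub_ne_zero.2 hv
    rw [slope_def_field, hdiff τ u v]
    field_simp
  have hsmooth : ∀ k : ℕ, ContDiff ℝ k fun x : ℝ × ℝ => Θ x.1 x.2 := by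
    intro k
    induction k with
    | zero => exact contDiff_zero.2 hcont
    | succ k ih =>
      have hpair : ContDiff ℝ k fun x : ℝ × ℝ => ((x.1, Θ x.1 x.2) : ℝ × ℝ) :=
        contDiff_fst.prodMk ih
      have hk : ((k : ℕ) : WithTop ℕ∞) ≤ ∞ := by norm_cast; exact le_top
      have c1 : ContDiff ℝ k fun x : ℝ × ℝ => W x.1 (Θ x.1 x.2) :=
        (hW.of_le hk).comp hpair
      have c2 : ContDiff ℝ k fun x : ℝ × ℝ => deriv (W x.1) (Θ x.1 x.2) :=
        ((contDiff_deriv_snd hW).of_le hk).comp hpair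
      have c3 := (contDiff_primitive (a := t₀) (F := fun s u => deriv (W s) (Θ s u)) c2).exp
      exact contDiff_succ_of_partial (F₁ := fun τ u => W τ (Θ τ u))
        (F₂ := fun τ u => Real.exp (∫ s in t₀..τ, deriv (W s) (Θ s u)))
        (fun τ u => hy u τ) hdu c1 c3
  refine ⟨Θ, contDiff_infty.2 hsmooth, fun u => hy0 u, fun τ u => hy u τ, fun τ u => ?_,
    fun τ u => ?_⟩
  · rw [(hdu τ u).deriv]
    exact Real.exp_pos _
  · have h1 : ∀ s ∈ Ioo (t₀ - (|τ - t₀| + 1)) (t₀ + (|τ - t₀| + 1)),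
        HasDerivAt (fun s => y u s + 2 * Real.pi) (W s (y u s + 2 * Real.pi)) s := by
      intro s _
      rw [hp s]
      exact (hy u s).add_const _
    have h2 := unique_of_hasDerivAt hW hp (fun s _ => hy (u + 2 * Real.pi) s) h1
      (by simp only [hy0])
    refine h2 ⟨?_, ?_⟩
    · linarith [neg_abs_le (τ - t₀)]
    · linarith [le_abs_self (τ - t₀)]

end Flow

end LegendreFlow

/-! ### Curves given by a support function -/

namespace LegendreFlow

open Set Filter Topology MeasureTheory

/-- The unit vector `e^{ix}`. -/
noncomputable def circ (x : ℝ) : ℂ := Complex.exp (x * Complex.I)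

lemma contDiff_circ : ContDiff ℝ ∞ circ := by
  have h : ContDiff ℝ ∞ fun x : ℝ => (x : ℂ) := Complex.ofRealCLM.contDiff
  exact (h.mul contDiff_const).cexp

lemma hasDerivAt_circ (x : ℝ) : HasDerivAt circ (Complex.I * circ x) x := by
  have h : circ = fun x : ℝ => Complex.exp ((1 : ℤ) * x * Complex.I) := by funext y; simp [circ]
  rw [h]
  simpa using hasDerivAt_exp_mul 1 x

lemma circ_periodic : Function.Periodic circ (2 * Real.pi) := by
  have h : circ = fun x : ℝ => Complex.exp ((1 : ℤ) * x * Complex.I) := by funext y; simp [circ]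
  rw [h]
  exact exp_periodic 1

lemma norm_circ (x : ℝ) : ‖circ x‖ = 1 := Complex.norm_exp_ofReal_mul_I x

lemma inner_eq (z w : ℂ) : inner ℝ z w = z.re * w.re + z.im * w.im := by
  rw [Complex.inner]; simp [mul_comm]

lemma circ_re (x : ℝ) : (circ x).re = Real.cos x := Complex.exp_ofReal_mul_I_re x
lemma circ_im (x : ℝ) : (circ x).im = Real.sin x := Complex.exp_ofReal_mul_I_im x

/-- A smooth periodic function without Fourier modes `0, ±1`: the part of a support function which
does not come from the radius and the Steiner point. -/
structure Admissible (q : ℝ → ℝ) : Prop where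
  smooth : ContDiff ℝ ∞ q
  periodic : Function.Periodic q (2 * Real.pi)
  integral_eq : ∫ x in (0 : ℝ)..(2 * Real.pi), q x = 0
  integral_cos : ∫ x in (0 : ℝ)..(2 * Real.pi), q x * Real.cos x = 0
  integral_sin : ∫ x in (0 : ℝ)..(2 * Real.pi), q x * Real.sin x = 0

/-- The deviation `q + q''` of the radius of curvature from its mean. -/
noncomputable def radiusPart (q : ℝ → ℝ) (x : ℝ) : ℝ := q x + deriv (deriv q) x

/-- The isoperimetric deficit `-(1/2) ∫ q (q + q'')`. -/
noncomputable def deficit (q : ℝ → ℝ) : ℝ :=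
  -(1 / 2) * ∫ x in (0 : ℝ)..(2 * Real.pi), q x * radiusPart q x

/-- The curve with Steiner point `S`, mean radius `ρ` and support function
`⟨S, e^{ix}⟩ + ρ + q x`, parametrized by its normal angle `x`. -/
noncomputable def supportCurve (S : ℂ) (ρ : ℝ) (q : ℝ → ℝ) (x : ℝ) : ℂ :=
  S + ((ρ + q x : ℝ) + (deriv q x : ℝ) * Complex.I) * circ x

lemma integral_mul_deriv_deriv {f g : ℝ → ℝ} (hf : ContDiff ℝ ∞ f) (hg : ContDiff ℝ ∞ g)
    (hfp : Function.Periodic f (2 * Real.pi)) (hgp : Function.Periodic g (2 * Real.pi)) :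
    ∫ x in (0 : ℝ)..(2 * Real.pi), f x * deriv (deriv g) x
      = ∫ x in (0 : ℝ)..(2 * Real.pi), deriv (deriv f) x * g x := by
  have hf1 := (contDiff_infty_iff_deriv.1 hf).2
  have hg1 := (contDiff_infty_iff_deriv.1 hg).2
  have hf2 := (contDiff_infty_iff_deriv.1 hf1).2
  have hg2 := (contDiff_infty_iff_deriv.1 hg1).2
  have d : ∀ {h : ℝ → ℝ}, ContDiff ℝ ∞ h → ∀ x, HasDerivAt h (deriv h x) x := fun h x =>
    (h.differentiable (by simp) x).hasDerivAt
  have c1 := hf.continuous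
  have c2 := hg.continuous
  have c3 := hf2.continuous
  have c4 := hg2.continuous
  have key := integral_deriv_eq_zero_of_periodic
    (f := fun x => f x * deriv g x - deriv f x * g x)
    (f' := fun x => f x * deriv (deriv g) x - deriv (deriv f) x * g x)
    (fun x => (((d hf x).mul (d hg1 x)).sub ((d hf1 x).mul (d hg x))).congr_deriv (by ring))
    (by fun_prop) ((hfp.mul (periodic_deriv hgp)).sub ((periodic_deriv hfp).mul hgp))
  rw [intervalIntegral.integral_sub (Continuous.intervalIntegrable (by fun_prop) _ _)
    (Continuous.intervalIntegrable (by fun_prop) _ _)] at key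
  linarith

section Admissible

variable {q : ℝ → ℝ}

lemma contDiff_radiusPart (hq : ContDiff ℝ ∞ q) : ContDiff ℝ ∞ (radiusPart q) :=
  hq.add (contDiff_infty_iff_deriv.1 (contDiff_infty_iff_deriv.1 hq).2).2

lemma radiusPart_periodic (hq : Function.Periodic q (2 * Real.pi)) :
    Function.Periodic (radiusPart q) (2 * Real.pi) :=
  hq.add (periodic_deriv (periodic_deriv hq))

lemma contDiff_deriv_real (hq : ContDiff ℝ ∞ q) : ContDiff ℝ ∞ (deriv q) :=
  (contDiff_infty_iff_deriv.1 hq).2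

lemma hasDerivAt_real (hq : ContDiff ℝ ∞ q) (x : ℝ) : HasDerivAt q (deriv q x) x :=
  (hq.differentiable (by simp) x).hasDerivAt

lemma integral_mul_radiusPart {f : ℝ → ℝ} (hf : ContDiff ℝ ∞ f)
    (hfp : Function.Periodic f (2 * Real.pi)) (hq : ContDiff ℝ ∞ q)
    (hqp : Function.Periodic q (2 * Real.pi)) :
    ∫ x in (0 : ℝ)..(2 * Real.pi), f x * radiusPart q x
      = ∫ x in (0 : ℝ)..(2 * Real.pi), radiusPart f x * q x := by
  have c1 := hf.continuous
  have c2 := hq.continuous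
  have c3 := (contDiff_deriv_real (contDiff_deriv_real hf)).continuous
  have c4 := (contDiff_deriv_real (contDiff_deriv_real hq)).continuous
  simp only [radiusPart, mul_add, add_mul]
  rw [intervalIntegral.integral_add (Continuous.intervalIntegrable (by fun_prop) _ _)
    (Continuous.intervalIntegrable (by fun_prop) _ _),
    intervalIntegral.integral_add (Continuous.intervalIntegrable (by fun_prop) _ _)
    (Continuous.intervalIntegrable (by fun_prop) _ _), integral_mul_deriv_deriv hf hq hfp hqp]

lemma Admissible.integral_radiusPart (hq : Admissible q) :
    ∫ x in (0 : ℝ)..(2 * Real.pi), radiusPart q x = 0 := by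
  have := integral_mul_radiusPart (f := fun _ => 1) contDiff_const (fun _ => rfl) hq.smooth
    hq.periodic
  simp only [one_mul] at this
  rw [this]
  simp [radiusPart, hq.integral_eq]

lemma Admissible.integral_radiusPart_cos (hq : Admissible q) :
    ∫ x in (0 : ℝ)..(2 * Real.pi), radiusPart q x * Real.cos x = 0 := by
  have := integral_mul_radiusPart Real.contDiff_cos Real.cos_periodic hq.smooth hq.periodic
  simp only [mul_comm (radiusPart q _)]
  rw [this]
  simp [radiusPart]

lemma Admissible.integral_radiusPart_sin (hq : Admissible q) :
    ∫ x in (0 : ℝ)..(2 * Real.pi), radiusPart q x * Real.sin x = 0 := by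
  have := integral_mul_radiusPart Real.contDiff_sin Real.sin_periodic hq.smooth hq.periodic
  simp only [mul_comm (radiusPart q _)]
  rw [this]
  simp [radiusPart]

/-- The isoperimetric inequality, in the form of Wirtinger's inequality. -/
lemma Admissible.deficit_nonneg (hq : Admissible q) : 0 ≤ deficit q := by
  have h1 := integral_sq_le_integral_deriv_sq (hq.smooth.of_le (by norm_cast)) hq.periodic
    hq.integral_eq
  have s1 := contDiff_deriv_real hq.smooth
  have s2 := contDiff_deriv_real s1
  have c0 := hq.smooth.continuous
  have c1 := s1.continuous
  have c2 := s2.continuous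
  have key := integral_deriv_eq_zero_of_periodic (f := fun x => q x * deriv q x)
    (f' := fun x => deriv q x ^ 2 + q x * deriv (deriv q) x)
    (fun x => ((hasDerivAt_real hq.smooth x).mul (hasDerivAt_real s1 x)).congr_deriv (by ring))
    (by fun_prop) (hq.periodic.mul (periodic_deriv hq.periodic))
  rw [intervalIntegral.integral_add (Continuous.intervalIntegrable (by fun_prop) _ _)
    (Continuous.intervalIntegrable (by fun_prop) _ _)] at key
  have h2 : ∫ x in (0 : ℝ)..(2 * Real.pi), q x * radiusPart q x
      = (∫ x in (0 : ℝ)..(2 * Real.pi), q x ^ 2)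
        + ∫ x in (0 : ℝ)..(2 * Real.pi), q x * deriv (deriv q) x := by
    rw [← intervalIntegral.integral_add (Continuous.intervalIntegrable (by fun_prop) _ _)
      (Continuous.intervalIntegrable (by fun_prop) _ _)]
    refine intervalIntegral.integral_congr fun x _ => ?_
    simp only [radiusPart]
    ring
  rw [deficit, h2]
  linarith

lemma integral_cos_sq_period : ∫ x in (0 : ℝ)..(2 * Real.pi), Real.cos x * Real.cos x = Real.pi := by
  have := integral_cos_sq (a := 0) (b := 2 * Real.pi)
  simp only [pow_two] at this
  rw [this]; simp

lemma integral_sin_sq_period : ∫ x in (0 : ℝ)..(2 * Real.pi), Real.sin x * Real.sin x = Real.pi := by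
  have := integral_sin_sq (a := 0) (b := 2 * Real.pi)
  simp only [pow_two] at this
  rw [this]; simp

lemma integral_sin_cos_period : ∫ x in (0 : ℝ)..(2 * Real.pi), Real.sin x * Real.cos x = 0 := by
  rw [integral_sin_mul_cos₁]; simp

lemma integral_cos_period : ∫ x in (0 : ℝ)..(2 * Real.pi), Real.cos x = 0 := by simp

lemma integral_sin_period : ∫ x in (0 : ℝ)..(2 * Real.pi), Real.sin x = 0 := by simp

/-- Linearity of the integral over a period, for four continuous functions. -/
lemma integral_lin4 {f₁ f₂ f₃ f₄ : ℝ → ℝ} (h₁ : Continuous f₁) (h₂ : Continuous f₂)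
    (h₃ : Continuous f₃) (h₄ : Continuous f₄) (a₁ a₂ a₃ a₄ : ℝ) :
    ∫ x in (0 : ℝ)..(2 * Real.pi), (a₁ * f₁ x + a₂ * f₂ x + a₃ * f₃ x + a₄ * f₄ x)
      = a₁ * (∫ x in (0 : ℝ)..(2 * Real.pi), f₁ x) + a₂ * (∫ x in (0 : ℝ)..(2 * Real.pi), f₂ x)
        + a₃ * (∫ x in (0 : ℝ)..(2 * Real.pi), f₃ x)
        + a₄ * (∫ x in (0 : ℝ)..(2 * Real.pi), f₄ x) := by
  rw [intervalIntegral.integral_add (Continuous.intervalIntegrable (by fun_prop) _ _)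
    (Continuous.intervalIntegrable (by fun_prop) _ _),
    intervalIntegral.integral_add (Continuous.intervalIntegrable (by fun_prop) _ _)
    (Continuous.intervalIntegrable (by fun_prop) _ _),
    intervalIntegral.integral_add (Continuous.intervalIntegrable (by fun_prop) _ _)
    (Continuous.intervalIntegrable (by fun_prop) _ _),
    intervalIntegral.integral_const_mul, intervalIntegral.integral_const_mul,
    intervalIntegral.integral_const_mul, intervalIntegral.integral_const_mul]

lemma Admissible.integral_support_mul_radius (hq : Admissible q) (S : ℂ) (ρ : ℝ) :
    (1 / 2) * ∫ x in (0 : ℝ)..(2 * Real.pi),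
      (inner ℝ S (circ x) + (ρ + q x)) * (ρ + radiusPart q x)
      = Real.pi * ρ ^ 2 - deficit q := by
  have c0 := hq.smooth.continuous
  have c1 := (contDiff_radiusPart hq.smooth).continuous
  have e1 := integral_lin4 (f₁ := Real.cos) (f₂ := Real.sin) (f₃ := fun _ => 1) (f₄ := q)
    (by fun_prop) (by fun_prop) (by fun_prop) c0 (S.re * ρ) (S.im * ρ) (ρ ^ 2) ρ
  have e2 := integral_lin4 (f₁ := fun x => radiusPart q x * Real.cos x)
    (f₂ := fun x => radiusPart q x * Real.sin x) (f₃ := radiusPart q)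
    (f₄ := fun x => q x * radiusPart q x)
    (by fun_prop) (by fun_prop) c1 (by fun_prop) S.re S.im ρ 1
  rw [hq.integral_radiusPart_cos, hq.integral_radiusPart_sin, hq.integral_radiusPart] at e2
  rw [hq.integral_eq, integral_cos_period, integral_sin_period] at e1
  have e3 : ∫ x in (0 : ℝ)..(2 * Real.pi),
      (inner ℝ S (circ x) + (ρ + q x)) * (ρ + radiusPart q x)
      = (∫ x in (0 : ℝ)..(2 * Real.pi),
          (S.re * ρ * Real.cos x + S.im * ρ * Real.sin x + ρ ^ 2 * 1 + ρ * q x))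
        + ∫ x in (0 : ℝ)..(2 * Real.pi), (S.re * (radiusPart q x * Real.cos x)
          + S.im * (radiusPart q x * Real.sin x) + ρ * radiusPart q x
          + 1 * (q x * radiusPart q x)) := by
    rw [← intervalIntegral.integral_add (Continuous.intervalIntegrable (by fun_prop) _ _)
      (Continuous.intervalIntegrable (by fun_prop) _ _)]
    refine intervalIntegral.integral_congr fun x _ => ?_
    simp only [inner_eq, circ_re, circ_im]
    ring
  rw [e3, e1, e2, deficit]
  simp
  ring

lemma Admissible.integral_support_smul (hq : Admissible q) (S : ℂ) (ρ : ℝ) :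
    ∫ x in (0 : ℝ)..(2 * Real.pi), (inner ℝ S (circ x) + (ρ + q x)) • circ x
      = (Real.pi : ℝ) • S := by
  have c0 := hq.smooth.continuous
  have cc := contDiff_circ.continuous
  have e1 := integral_lin4 (f₁ := fun x => Real.cos x * Real.cos x)
    (f₂ := fun x => Real.sin x * Real.cos x)
    (f₃ := Real.cos) (f₄ := fun x => q x * Real.cos x)
    (by fun_prop) (by fun_prop) (by fun_prop) (by fun_prop) S.re S.im ρ 1
  have e2 := integral_lin4 (f₁ := fun x => Real.sin x * Real.cos x)
    (f₂ := fun x => Real.sin x * Real.sin x)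
    (f₃ := Real.sin) (f₄ := fun x => q x * Real.sin x)
    (by fun_prop) (by fun_prop) (by fun_prop) (by fun_prop) S.re S.im ρ 1
  rw [integral_cos_sq_period, integral_sin_cos_period, integral_cos_period, hq.integral_cos] at e1
  rw [integral_sin_sq_period, integral_sin_cos_period, integral_sin_period, hq.integral_sin] at e2
  have hcont : Continuous fun x => (inner ℝ S (circ x) + (ρ + q x)) • circ x := by
    simp only [inner_eq, circ_re, circ_im]
    fun_prop
  have hint := hcont.intervalIntegrable (μ := volume) 0 (2 * Real.pi)
  have r1 := Complex.reCLM.intervalIntegral_comp_comm hint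
  have r2 := Complex.imCLM.intervalIntegral_comp_comm hint
  simp only [Complex.reCLM_apply, Complex.imCLM_apply] at r1 r2
  refine Complex.ext ?_ ?_
  · rw [← r1]
    refine Eq.trans (intervalIntegral.integral_congr fun x _ => ?_) (e1.trans ?_)
    · simp only [Complex.real_smul, Complex.re_ofReal_mul, circ_re, inner_eq, circ_im]
      ring
    · simp [mul_comm]
  · rw [← r2]
    refine Eq.trans (intervalIntegral.integral_congr fun x _ => ?_) (e2.trans ?_)
    · simp only [Complex.real_smul, Complex.im_ofReal_mul, circ_re, inner_eq, circ_im]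
      ring
    · simp [mul_comm]

lemma hasDerivAt_supportCurve (hq : ContDiff ℝ ∞ q) (S : ℂ) (ρ x : ℝ) :
    HasDerivAt (supportCurve S ρ q)
      (((ρ + radiusPart q x : ℝ) : ℂ) * (Complex.I * circ x)) x := by
  have h1 := ((hasDerivAt_real hq x).const_add ρ).ofReal_comp
  have h2 := (hasDerivAt_real (contDiff_deriv_real hq) x).ofReal_comp.mul_const Complex.I
  refine (((h1.add h2).mul (hasDerivAt_circ x)).const_add S).congr_deriv ?_
  simp only [radiusPart, Pi.add_apply]
  push_cast
  linear_combination ((deriv q x : ℝ) : ℂ) * circ x * Complex.I_sq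

lemma contDiff_supportCurve (hq : ContDiff ℝ ∞ q) (S : ℂ) (ρ : ℝ) :
    ContDiff ℝ ∞ (supportCurve S ρ q) := by
  have h1 : ContDiff ℝ ∞ fun x => ((ρ + q x : ℝ) : ℂ) :=
    Complex.ofRealCLM.contDiff.comp (contDiff_const.add hq)
  have h2 : ContDiff ℝ ∞ fun x => ((deriv q x : ℝ) : ℂ) :=
    Complex.ofRealCLM.contDiff.comp (contDiff_deriv_real hq)
  exact contDiff_const.add ((h1.add (h2.mul contDiff_const)).mul contDiff_circ)

lemma supportCurve_periodic (hq : Function.Periodic q (2 * Real.pi)) (S : ℂ) (ρ : ℝ) :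
    Function.Periodic (supportCurve S ρ q) (2 * Real.pi) := by
  intro x
  simp only [supportCurve, hq x, periodic_deriv hq x, circ_periodic x]

end Admissible

/-- An orientation preserving reparametrization of the circle, lifted to `ℝ`. -/
structure IsAngle (θ : ℝ → ℝ) : Prop where
  smooth : ContDiff ℝ ∞ θ
  deriv_pos : ∀ u, 0 < deriv θ u
  add_period : ∀ u, θ (u + 2 * Real.pi) = θ u + 2 * Real.pi

section Reparametrized

variable {q θ : ℝ → ℝ} (hq : Admissible q) (hθ : IsAngle θ) (S : ℂ) (ρ : ℝ)

lemma hasDerivAt_circ_comp {θ : ℝ → ℝ} (hθ : ContDiff ℝ ∞ θ) (u : ℝ) :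
    HasDerivAt (fun u => circ (θ u)) (((deriv θ u : ℝ) : ℂ) * (Complex.I * circ (θ u))) u := by
  exact ((hasDerivAt_circ (θ u)).scomp u (hasDerivAt_real hθ u)).congr_deriv
    (by rw [Complex.real_smul])

lemma inner_smul_self_mu (r : ℝ) (x : ℝ) :
    inner ℝ ((r : ℂ) * (Complex.I * circ x)) (Complex.I * circ x) = r := by
  have := norm_circ x
  rw [← Complex.real_smul, real_inner_smul_left, real_inner_self_eq_norm_sq, norm_mul, this]
  simp

lemma inner_mu_circ (r : ℝ) (x : ℝ) :
    inner ℝ ((r : ℂ) * (Complex.I * circ x)) (circ x) = 0 := by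
  rw [inner_eq]
  simp
  ring

include hθ in
lemma ell_circ_comp (u : ℝ) : ell (fun u => circ (θ u)) u = deriv θ u := by
  rw [ell, mu, (hasDerivAt_circ_comp hθ.smooth u).deriv, inner_smul_self_mu]

include hq hθ in
lemma hasDerivAt_supportCurve_comp (u : ℝ) :
    HasDerivAt (fun u => supportCurve S ρ q (θ u))
      ((((ρ + radiusPart q (θ u)) * deriv θ u : ℝ) : ℂ) * (Complex.I * circ (θ u))) u := by
  refine ((hasDerivAt_supportCurve hq.smooth S ρ (θ u)).scomp u
    (hasDerivAt_real hθ.smooth u)).congr_deriv ?_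
  rw [Complex.real_smul]
  push_cast
  ring

include hq hθ in
lemma beta_supportCurve_comp (u : ℝ) :
    beta (fun u => supportCurve S ρ q (θ u)) (fun u => circ (θ u)) u
      = (ρ + radiusPart q (θ u)) * deriv θ u := by
  rw [beta, mu, (hasDerivAt_supportCurve_comp hq hθ S ρ u).deriv, inner_smul_self_mu]

include hq hθ in
lemma isEllConvex_supportCurve_comp :
    IsEllConvex (fun u => supportCurve S ρ q (θ u)) (fun u => circ (θ u)) := by
  refine ⟨⟨(contDiff_supportCurve hq.smooth S ρ).comp hθ.smooth, contDiff_circ.comp hθ.smooth,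
    fun u => ?_, fun u => ?_, fun u => norm_circ _, fun u => ?_⟩, fun u => ?_⟩
  · simp only [hθ.add_period, supportCurve_periodic hq.periodic S ρ (θ u)]
  · simp only [hθ.add_period, circ_periodic (θ u)]
  · rw [(hasDerivAt_supportCurve_comp hq hθ S ρ u).deriv, inner_mu_circ]
  · rw [ell_circ_comp hθ]
    exact hθ.deriv_pos u

lemma support_supportCurve (x : ℝ) :
    inner ℝ (supportCurve S ρ q x) (circ x) = inner ℝ S (circ x) + (ρ + q x) := by
  have h1 : Real.cos x ^ 2 + Real.sin x ^ 2 = 1 := Real.cos_sq_add_sin_sq x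
  simp only [supportCurve, inner_eq, Complex.add_re, Complex.add_im, Complex.mul_re,
    Complex.mul_im, Complex.ofReal_re, Complex.ofReal_im, Complex.I_re, Complex.I_im, circ_re,
    circ_im]
  linear_combination (ρ + q x) * h1

include hq in
lemma continuous_support : Continuous fun x => inner ℝ S (circ x) + (ρ + q x) := by
  have := hq.smooth.continuous
  simp only [inner_eq, circ_re, circ_im]
  fun_prop

include hq in
lemma support_periodic :
    Function.Periodic (fun x => inner ℝ S (circ x) + (ρ + q x)) (2 * Real.pi) := by
  intro x
  simp only [circ_periodic x, hq.periodic x]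

include hθ in
lemma integral_comp_isAngle {E : Type*} [NormedAddCommGroup E] [NormedSpace ℝ E] {G : ℝ → E}
    (hG : Continuous G) (hGp : Function.Periodic G (2 * Real.pi)) :
    ∫ u in (0 : ℝ)..(2 * Real.pi), deriv θ u • G (θ u)
      = ∫ x in (0 : ℝ)..(2 * Real.pi), G x :=
  integral_comp_angle (hasDerivAt_real hθ.smooth) (contDiff_deriv_real hθ.smooth).continuous
    hθ.add_period hG hGp

include hq hθ in
lemma algLength_supportCurve_comp :
    algLength (fun u => supportCurve S ρ q (θ u)) (fun u => circ (θ u)) = 2 * Real.pi * ρ := by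
  have c1 := (contDiff_radiusPart hq.smooth).continuous
  have h := integral_comp_isAngle hθ (G := fun x => ρ + radiusPart q x) (by fun_prop)
    (fun x => by simp only [radiusPart_periodic hq.periodic x])
  rw [algLength]
  simp only [beta_supportCurve_comp hq hθ]
  simp only [smul_eq_mul, mul_comm (deriv θ _)] at h
  rw [h, intervalIntegral.integral_add (Continuous.intervalIntegrable (by fun_prop) _ _)
    (Continuous.intervalIntegrable (by fun_prop) _ _), hq.integral_radiusPart]
  simp

include hq hθ in
lemma algArea_supportCurve_comp :
    algArea (fun u => supportCurve S ρ q (θ u)) (fun u => circ (θ u))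
      = Real.pi * ρ ^ 2 - deficit q := by
  have c1 := (contDiff_radiusPart hq.smooth).continuous
  have c2 := continuous_support hq S ρ
  have h := integral_comp_isAngle hθ
    (G := fun x => (inner ℝ S (circ x) + (ρ + q x)) * (ρ + radiusPart q x)) (by fun_prop)
    ((support_periodic hq S ρ).mul
      (fun x => by simp only [radiusPart_periodic hq.periodic x]))
  rw [algArea, ← hq.integral_support_mul_radius S ρ, ← h]
  congr 1
  refine intervalIntegral.integral_congr fun u _ => ?_
  simp only [support, support_supportCurve, beta_supportCurve_comp hq hθ, smul_eq_mul]
  ring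

include hq hθ in
lemma steinerPoint_supportCurve_comp :
    steinerPoint (fun u => supportCurve S ρ q (θ u)) (fun u => circ (θ u)) = S := by
  have c2 := continuous_support hq S ρ
  have cc := contDiff_circ.continuous
  have h := integral_comp_isAngle hθ
    (G := fun x => (inner ℝ S (circ x) + (ρ + q x)) • circ x) (by fun_prop)
    (fun x => by simp only [circ_periodic x, hq.periodic x])
  rw [steinerPoint]
  have e : ∫ u in (0 : ℝ)..(2 * Real.pi),
      (support (fun u => supportCurve S ρ q (θ u)) (fun u => circ (θ u)) u *
        ell (fun u => circ (θ u)) u) • circ (θ u) = (Real.pi : ℝ) • S := by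
    rw [← hq.integral_support_smul S ρ, ← h]
    refine intervalIntegral.integral_congr fun u _ => ?_
    simp only [support, support_supportCurve, ell_circ_comp hθ, smul_smul]
    rw [mul_comm]
  rw [e, smul_smul, one_div, inv_mul_cancel₀ Real.pi_ne_zero, one_smul]

include hq hθ in
lemma betaNormalized_supportCurve_comp (u : ℝ) :
    betaNormalized (fun u => supportCurve S ρ q (θ u)) (fun u => circ (θ u)) u
      = ρ + radiusPart q (θ u) := by
  rw [betaNormalized, beta_supportCurve_comp hq hθ, ell_circ_comp hθ,
    mul_div_cancel_right₀ _ (hθ.deriv_pos u).ne']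

include hq hθ in
lemma nonlocalTerm_supportCurve_comp (hρ : ρ ≠ 0) :
    nonlocalTerm (fun u => supportCurve S ρ q (θ u)) (fun u => circ (θ u))
      = ρ + (∫ x in (0 : ℝ)..(2 * Real.pi), radiusPart q x ^ 2) / (2 * Real.pi * ρ) := by
  have c1 := (contDiff_radiusPart hq.smooth).continuous
  have h := integral_comp_isAngle hθ (G := fun x => (ρ + radiusPart q x) ^ 2) (by fun_prop)
    (fun x => by simp only [radiusPart_periodic hq.periodic x])
  rw [nonlocalTerm, algLength_supportCurve_comp hq hθ]
  simp only [betaNormalized_supportCurve_comp hq hθ, ell_circ_comp hθ]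
  simp only [smul_eq_mul, mul_comm (deriv θ _)] at h
  have e := integral_lin4 (f₁ := fun _ => 1) (f₂ := radiusPart q)
    (f₃ := fun x => radiusPart q x ^ 2) (f₄ := fun _ => 0) (by fun_prop) c1 (by fun_prop)
    (by fun_prop) (ρ ^ 2) (2 * ρ) 1 0
  rw [hq.integral_radiusPart] at e
  have e2 : ∫ x in (0 : ℝ)..(2 * Real.pi), (ρ + radiusPart q x) ^ 2
      = ρ ^ 2 * (2 * Real.pi) + ∫ x in (0 : ℝ)..(2 * Real.pi), radiusPart q x ^ 2 := by
    refine Eq.trans (intervalIntegral.integral_congr fun x _ => ?_) (e.trans ?_)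
    · ring
    · simp
  rw [h, e2]
  have := Real.pi_ne_zero
  field_simp

include hq hθ in
lemma deriv_speed_supportCurve_comp (u : ℝ) :
    deriv (speed (fun u => supportCurve S ρ q (θ u)) (fun u => circ (θ u))) u
      = deriv (radiusPart q) (θ u) * deriv θ u := by
  have h1 : speed (fun u => supportCurve S ρ q (θ u)) (fun u => circ (θ u))
      = fun u => ρ + radiusPart q (θ u)
        - nonlocalTerm (fun u => supportCurve S ρ q (θ u)) (fun u => circ (θ u)) := by
    funext u
    rw [speed, betaNormalized_supportCurve_comp hq hθ]
  rw [h1]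
  have h2 := (hasDerivAt_real (contDiff_radiusPart hq.smooth) (θ u)).comp u
    (hasDerivAt_real hθ.smooth u)
  exact ((h2.const_add ρ).sub_const _).deriv

end Reparametrized

end LegendreFlow

/-! ### The explicit solution in the normal angle -/

namespace LegendreFlow

open Set Filter Topology MeasureTheory

/-- `Q` is a solution of the linear flow `Q_t = Q + Q''`, written in the variable `τ = e^{-t}`, with
values in the admissible functions, and smooth across `τ = 0` and `τ = 1`. The equation is required
only for `0 ≤ τ ≤ 1`. -/
structure LinearFlow (Q : ℝ → ℝ → ℝ) : Prop where
  smooth : ContDiff ℝ ∞ fun x : ℝ × ℝ => Q x.1 x.2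
  admissible : ∀ τ, Admissible (Q τ)
  at_zero : ∀ x, Q 0 x = 0
  equation : ∀ τ ∈ Icc (0 : ℝ) 1, ∀ x, τ * deriv (fun s => Q s x) τ = -radiusPart (Q τ) x

/-- The mean radius of curvature: the area `π ρ² - deficit` of the solution is kept equal to `A`, and
`ε = ±1` is the sign of the algebraic length. -/
noncomputable def meanRadius (ε A : ℝ) (Q : ℝ → ℝ → ℝ) (τ : ℝ) : ℝ :=
  ε * Real.sqrt ((A + deficit (Q τ)) / Real.pi)

/-- The solution of the normalized flow with Steiner point `S` and area `A`, as a function of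
`τ = e^{-t}` and of the normal angle. -/
noncomputable def modelCurve (S : ℂ) (ε A : ℝ) (Q : ℝ → ℝ → ℝ) (τ x : ℝ) : ℂ :=
  supportCurve S (meanRadius ε A Q τ) (Q τ) x

/-- The radius of curvature of `modelCurve`. -/
noncomputable def modelRadius (ε A : ℝ) (Q : ℝ → ℝ → ℝ) (τ x : ℝ) : ℝ :=
  meanRadius ε A Q τ + radiusPart (Q τ) x

/-- The velocity `dθ/dτ` of the normal angle under the flow which is not normalized. In the
variable `τ` it is smooth up to `τ = 0`, because `-Q_{τθ}` is a smooth extension of `B_θ / τ`. -/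
noncomputable def angleVelocity (ε A : ℝ) (Q : ℝ → ℝ → ℝ) (τ x : ℝ) : ℝ :=
  -(modelRadius ε A Q τ x * deriv (fun y => deriv (fun s => Q s y) τ) x) /
    (1 + modelRadius ε A Q τ x ^ 2)

section Velocity

variable {q θ : ℝ → ℝ}

/-- The integral of the squared deviation of the radius of curvature from its mean. -/
noncomputable def radiusVariance (q : ℝ → ℝ) : ℝ :=
  ∫ x in (0 : ℝ)..(2 * Real.pi), radiusPart q x ^ 2

lemma speed_supportCurve_comp (hq : Admissible q) (hθ : IsAngle θ) (S : ℂ) {ρ : ℝ} (hρ : ρ ≠ 0)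
    (u : ℝ) :
    speed (fun u => supportCurve S ρ q (θ u)) (fun u => circ (θ u)) u
      = radiusPart q (θ u) - radiusVariance q / (2 * Real.pi * ρ) := by
  rw [speed, betaNormalized_supportCurve_comp hq hθ, nonlocalTerm_supportCurve_comp hq hθ S ρ hρ,
    radiusVariance]
  ring

lemma flowVelocity_supportCurve_comp (hq : Admissible q) (hθ : IsAngle θ) (S : ℂ) {ρ : ℝ}
    (hρ : ρ ≠ 0) (u : ℝ) :
    flowVelocity (fun u => supportCurve S ρ q (θ u)) (fun u => circ (θ u)) u
      = ((deriv (radiusPart q) (θ u) / (1 + (ρ + radiusPart q (θ u)) ^ 2)) •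
            (Complex.I * circ (θ u))
          + (radiusPart q (θ u) - radiusVariance q / (2 * Real.pi * ρ)) • circ (θ u),
        (-((ρ + radiusPart q (θ u)) * deriv (radiusPart q) (θ u) /
          (1 + (ρ + radiusPart q (θ u)) ^ 2))) • (Complex.I * circ (θ u))) := by
  have h0 := (hθ.deriv_pos u).ne'
  have h1 : 1 + (ρ + radiusPart q (θ u)) ^ 2 ≠ 0 := by positivity
  have h2 : deriv θ u ^ 2 + ((ρ + radiusPart q (θ u)) * deriv θ u) ^ 2
      = deriv θ u ^ 2 * (1 + (ρ + radiusPart q (θ u)) ^ 2) := by ring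
  rw [flowVelocity, speed_supportCurve_comp hq hθ S hρ, ell_circ_comp hθ,
    beta_supportCurve_comp hq hθ, deriv_speed_supportCurve_comp hq hθ, mu, h2]
  congr 3
  · field_simp
  · field_simp

lemma normalizedFlowVelocity_supportCurve_comp (hq : Admissible q) (hθ : IsAngle θ) (S : ℂ)
    {ρ : ℝ} (hρ : ρ ≠ 0) (u : ℝ) :
    normalizedFlowVelocity (fun u => supportCurve S ρ q (θ u)) (fun u => circ (θ u)) u
      = (deriv (radiusPart q) (θ u) • (Complex.I * circ (θ u))
          + (radiusPart q (θ u) - radiusVariance q / (2 * Real.pi * ρ)) • circ (θ u), 0) := by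
  rw [normalizedFlowVelocity, speed_supportCurve_comp hq hθ S hρ, ell_circ_comp hθ,
    deriv_speed_supportCurve_comp hq hθ, mu, mul_div_cancel_right₀ _ (hθ.deriv_pos u).ne']

end Velocity

lemma hasDerivAt_comp_two {E : Type*} [NormedAddCommGroup E] [NormedSpace ℝ E] {F : ℝ → ℝ → E}
    (hF : ContDiff ℝ ∞ fun x : ℝ × ℝ => F x.1 x.2) {σ φ : ℝ → ℝ} {σ' φ' t : ℝ}
    (hσ : HasDerivAt σ σ' t) (hφ : HasDerivAt φ φ' t) :
    HasDerivAt (fun t => F (σ t) (φ t))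
      (σ' • deriv (fun s => F s (φ t)) (σ t) + φ' • deriv (F (σ t)) (φ t)) t := by
  have hF' : ContDiffOn ℝ ∞ (fun x : ℝ × ℝ => F x.1 x.2) ((univ : Set ℝ) ×ˢ univ) := hF.contDiffOn
  have hd := ((hF.differentiable (by simp)) (σ t, φ t)).hasFDerivAt
  refine (hd.comp_hasDerivAt t (hσ.prodMk hφ)).congr_deriv ?_
  have e : ((σ', φ') : ℝ × ℝ) = σ' • ((1, 0) : ℝ × ℝ) + φ' • ((0, 1) : ℝ × ℝ) := by simp
  rw [e, map_add, map_smul, map_smul, (hasDerivAt_fst hF' (by simp) _).deriv,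
    (hasDerivAt_snd hF' (by simp) _).deriv]

section Model

variable {Q : ℝ → ℝ → ℝ} {A ε : ℝ}

lemma LinearFlow.contDiff_radiusPart (hQ : LinearFlow Q) :
    ContDiff ℝ ∞ fun x : ℝ × ℝ => radiusPart (Q x.1) x.2 :=
  hQ.smooth.add (contDiff_deriv_snd (F := fun τ x => deriv (Q τ) x) (contDiff_deriv_snd hQ.smooth))

lemma LinearFlow.contDiff_deficit (hQ : LinearFlow Q) : ContDiff ℝ ∞ fun τ => deficit (Q τ) :=
  contDiff_const.mul (contDiff_integral (F := fun τ x => Q τ x * radiusPart (Q τ) x)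
    Real.two_pi_pos.le (hQ.smooth.mul hQ.contDiff_radiusPart))

lemma LinearFlow.area_pos (hQ : LinearFlow Q) (hA : 0 < A) (τ : ℝ) :
    0 < (A + deficit (Q τ)) / Real.pi :=
  div_pos (add_pos_of_pos_of_nonneg hA (hQ.admissible τ).deficit_nonneg) Real.pi_pos

lemma LinearFlow.contDiff_meanRadius (hQ : LinearFlow Q) (hA : 0 < A) :
    ContDiff ℝ ∞ (meanRadius ε A Q) :=
  contDiff_const.mul (ContDiff.sqrt ((contDiff_const.add hQ.contDiff_deficit).div_const _)
    fun τ => (hQ.area_pos hA τ).ne')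

lemma LinearFlow.meanRadius_sq (hQ : LinearFlow Q) (hA : 0 < A) (hε : ε ^ 2 = 1) (τ : ℝ) :
    meanRadius ε A Q τ ^ 2 = (A + deficit (Q τ)) / Real.pi := by
  rw [meanRadius, mul_pow, hε, one_mul, Real.sq_sqrt (hQ.area_pos hA τ).le]

lemma LinearFlow.meanRadius_ne_zero (hQ : LinearFlow Q) (hA : 0 < A) (hε : ε ^ 2 = 1) (τ : ℝ) :
    meanRadius ε A Q τ ≠ 0 := by
  intro h
  have := hQ.meanRadius_sq hA hε τ
  rw [h] at this
  have h2 := hQ.area_pos hA τ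
  rw [← this] at h2
  norm_num at h2

lemma LinearFlow.contDiff_modelCurve (hQ : LinearFlow Q) (hA : 0 < A) (S : ℂ) :
    ContDiff ℝ ∞ fun x : ℝ × ℝ => modelCurve S ε A Q x.1 x.2 := by
  have h1 : ContDiff ℝ ∞ fun x : ℝ × ℝ => ((meanRadius ε A Q x.1 + Q x.1 x.2 : ℝ) : ℂ) :=
    Complex.ofRealCLM.contDiff.comp (((hQ.contDiff_meanRadius hA).comp contDiff_fst).add hQ.smooth)
  have h2 : ContDiff ℝ ∞ fun x : ℝ × ℝ => ((deriv (Q x.1) x.2 : ℝ) : ℂ) :=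
    Complex.ofRealCLM.contDiff.comp (contDiff_deriv_snd hQ.smooth)
  exact contDiff_const.add ((h1.add (h2.mul contDiff_const)).mul (contDiff_circ.comp contDiff_snd))

lemma LinearFlow.contDiff_modelRadius (hQ : LinearFlow Q) (hA : 0 < A) :
    ContDiff ℝ ∞ fun x : ℝ × ℝ => modelRadius ε A Q x.1 x.2 :=
  ((hQ.contDiff_meanRadius hA).comp contDiff_fst).add hQ.contDiff_radiusPart

lemma LinearFlow.contDiff_angleVelocity (hQ : LinearFlow Q) (hA : 0 < A) :
    ContDiff ℝ ∞ fun x : ℝ × ℝ => angleVelocity ε A Q x.1 x.2 := by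
  have h1 := hQ.contDiff_modelRadius (ε := ε) hA
  have h2 := contDiff_deriv_snd (F := fun τ y => deriv (fun s => Q s y) τ)
    (contDiff_deriv_fst hQ.smooth)
  exact (h1.mul h2).neg.div (contDiff_const.add (h1.pow 2)) fun x => by positivity

lemma LinearFlow.modelRadius_periodic (hQ : LinearFlow Q) (τ : ℝ) :
    Function.Periodic (modelRadius ε A Q τ) (2 * Real.pi) := by
  intro x
  simp only [modelRadius, radiusPart_periodic (hQ.admissible τ).periodic x]

lemma LinearFlow.angleVelocity_periodic (hQ : LinearFlow Q) (τ : ℝ) :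
    Function.Periodic (angleVelocity ε A Q τ) (2 * Real.pi) := by
  have h : Function.Periodic (fun y => deriv (fun s => Q s y) τ) (2 * Real.pi) := by
    intro y
    simp only [fun s => (hQ.admissible s).periodic y]
  intro x
  simp only [angleVelocity, hQ.modelRadius_periodic τ x, periodic_deriv h x]

lemma LinearFlow.tau_mul_deriv (hQ : LinearFlow Q) {τ : ℝ} (hτ : τ ∈ Icc (0 : ℝ) 1) (x : ℝ) :
    τ * deriv (fun y => deriv (fun s => Q s y) τ) x = -deriv (radiusPart (Q τ)) x := by
  have h : (fun y => τ * deriv (fun s => Q s y) τ) = fun y => -radiusPart (Q τ) y :=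
    funext fun y => hQ.equation τ hτ y
  have h2 : Differentiable ℝ (fun y => deriv (fun s => Q s y) τ) :=
    (contDiff_comp_mk (F := fun τ y => deriv (fun s => Q s y) τ)
      (contDiff_deriv_fst hQ.smooth) τ).differentiable (by simp)
  have h3 := congrArg (fun f => deriv f x) h
  simp only [deriv.fun_neg] at h3
  rw [← h3, deriv_const_mul _ (h2 x)]

lemma LinearFlow.hasDerivAt_deriv (hQ : LinearFlow Q) (τ x : ℝ) :
    HasDerivAt (fun s => deriv (Q s) x) (deriv (fun y => deriv (fun s => Q s y) τ) x) τ :=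
  hasDerivAt_deriv_snd (I := univ) hQ.smooth.contDiffOn (by simp) x

lemma LinearFlow.hasDerivAt_radiusPart (hQ : LinearFlow Q) (τ x : ℝ) :
    HasDerivAt (fun s => radiusPart (Q s) x)
      (radiusPart (fun y => deriv (fun s => Q s y) τ) x) τ := by
  have h1 := ((contDiff_comp_mk_left hQ.smooth x).differentiable (by simp) τ).hasDerivAt
  have h2 := hasDerivAt_deriv_snd (I := univ) (F := fun τ y => deriv (Q τ) y) (t := τ)
    (contDiff_deriv_snd hQ.smooth).contDiffOn (by simp) x
  have h3 : (fun v => deriv (fun s => deriv (Q s) v) τ)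
      = deriv (fun y => deriv (fun s => Q s y) τ) :=
    funext fun v => (hQ.hasDerivAt_deriv τ v).deriv
  rw [h3] at h2
  exact h1.add h2

lemma LinearFlow.tau_mul_deriv_deficit (hQ : LinearFlow Q) {τ : ℝ} (hτ : τ ∈ Icc (0 : ℝ) 1) :
    τ * deriv (fun τ => deficit (Q τ)) τ = radiusVariance (Q τ) := by
  set q' : ℝ → ℝ := fun y => deriv (fun s => Q s y) τ with hq'
  have sq' : ContDiff ℝ ∞ q' := contDiff_comp_mk (F := fun τ y => deriv (fun s => Q s y) τ)
    (contDiff_deriv_fst hQ.smooth) τ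
  have pq' : Function.Periodic q' (2 * Real.pi) := by
    intro y
    simp only [hq', fun s => (hQ.admissible s).periodic y]
  have sq := (hQ.admissible τ).smooth
  have c1 := sq.continuous
  have c2 := (LegendreFlow.contDiff_radiusPart sq).continuous
  have c3 := sq'.continuous
  have c4 := (LegendreFlow.contDiff_radiusPart sq').continuous
  have hd := (hasDerivAt_integral (F := fun τ x => Q τ x * radiusPart (Q τ) x) (I := univ) (t := τ)
    Real.two_pi_pos.le
    ((hQ.smooth.mul hQ.contDiff_radiusPart).of_le (by norm_cast)).contDiffOn (by simp)
    (fun x => (((contDiff_comp_mk_left hQ.smooth x).differentiable (by simp) τ).hasDerivAt).mul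
      (hQ.hasDerivAt_radiusPart τ x))).const_mul (-(1 / 2))
  have hd' : deriv (fun τ => deficit (Q τ)) τ = -(1 / 2) * ∫ x in (0 : ℝ)..(2 * Real.pi),
      (q' x * radiusPart (Q τ) x + Q τ x * radiusPart q' x) := hd.deriv
  rw [hd', intervalIntegral.integral_add (Continuous.intervalIntegrable (by fun_prop) _ _)
    (Continuous.intervalIntegrable (by fun_prop) _ _),
    integral_mul_radiusPart sq (hQ.admissible τ).periodic sq' pq', radiusVariance]
  have e : τ * (∫ x in (0 : ℝ)..(2 * Real.pi), q' x * radiusPart (Q τ) x)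
      = -∫ x in (0 : ℝ)..(2 * Real.pi), radiusPart (Q τ) x ^ 2 := by
    rw [← intervalIntegral.integral_const_mul, ← intervalIntegral.integral_neg]
    refine intervalIntegral.integral_congr fun x _ => ?_
    show τ * (q' x * radiusPart (Q τ) x) = -radiusPart (Q τ) x ^ 2
    rw [← mul_assoc, hQ.equation τ hτ x]
    ring
  have e2 : (∫ x in (0 : ℝ)..(2 * Real.pi), radiusPart (Q τ) x * q' x)
      = ∫ x in (0 : ℝ)..(2 * Real.pi), q' x * radiusPart (Q τ) x :=
    intervalIntegral.integral_congr fun x _ => mul_comm _ _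
  rw [e2]
  linear_combination (-1) * e

lemma LinearFlow.tau_mul_deriv_meanRadius (hQ : LinearFlow Q) (hA : 0 < A) (hε : ε ^ 2 = 1) {τ : ℝ}
    (hτ : τ ∈ Icc (0 : ℝ) 1) :
    τ * deriv (meanRadius ε A Q) τ
      = radiusVariance (Q τ) / (2 * Real.pi * meanRadius ε A Q τ) := by
  have h1 := ((hQ.contDiff_meanRadius (ε := ε) hA).differentiable (by simp) τ).hasDerivAt.pow 2
  have h2 := (((hQ.contDiff_deficit.differentiable (by simp) τ).hasDerivAt).const_add A).div_const
    Real.pi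
  have h3 : (meanRadius ε A Q) ^ 2 = fun τ => (A + deficit (Q τ)) / Real.pi :=
    funext fun τ => hQ.meanRadius_sq hA hε τ
  rw [h3] at h1
  have h4 := h1.unique h2
  have h5 := hQ.tau_mul_deriv_deficit hτ
  have h6 := hQ.meanRadius_ne_zero hA hε τ
  have h7 := Real.pi_ne_zero
  rw [← h5]
  field_simp at h4 ⊢
  norm_num at h4
  linear_combination τ * h4

/-- The velocity of the explicit solution along a moving normal angle. -/
lemma LinearFlow.hasDerivAt_modelCurve (hQ : LinearFlow Q) (hA : 0 < A) (hε : ε ^ 2 = 1) (S : ℂ)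
    {t φ' : ℝ} (ht : 0 ≤ t) {φ : ℝ → ℝ} (hφ : HasDerivAt φ φ' t) :
    HasDerivAt (fun t => modelCurve S ε A Q (Real.exp (-t)) (φ t))
      ((deriv (radiusPart (Q (Real.exp (-t)))) (φ t)
          + modelRadius ε A Q (Real.exp (-t)) (φ t) * φ') • (Complex.I * circ (φ t))
        + (radiusPart (Q (Real.exp (-t))) (φ t) - radiusVariance (Q (Real.exp (-t))) /
          (2 * Real.pi * meanRadius ε A Q (Real.exp (-t)))) • circ (φ t)) t := by
  set τ := Real.exp (-t) with hτdef
  have hτ : τ ∈ Icc (0 : ℝ) 1 := ⟨(Real.exp_pos _).le, Real.exp_le_one_iff.2 (by linarith)⟩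
  have hσ : HasDerivAt (fun t => Real.exp (-t)) (-τ) t := by
    simpa using (hasDerivAt_neg t).exp
  refine (hasDerivAt_comp_two (F := modelCurve S ε A Q) (hQ.contDiff_modelCurve hA S) hσ
    hφ).congr_deriv ?_
  rw [← hτdef]
  have h1 : deriv (modelCurve S ε A Q τ) (φ t)
      = (modelRadius ε A Q τ (φ t) : ℂ) * (Complex.I * circ (φ t)) :=
    (hasDerivAt_supportCurve (hQ.admissible τ).smooth S (meanRadius ε A Q τ) (φ t)).deriv
  have d1 := ((hQ.contDiff_meanRadius (ε := ε) hA).differentiable (by simp) τ).hasDerivAt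
  have d2 := ((contDiff_comp_mk_left hQ.smooth (φ t)).differentiable (by simp) τ).hasDerivAt
  have d3 := hQ.hasDerivAt_deriv τ (φ t)
  have h2 := ((((d1.add d2).ofReal_comp.add (d3.ofReal_comp.mul_const Complex.I)).mul_const
    (circ (φ t))).const_add S).deriv
  have h2' : deriv (fun s => modelCurve S ε A Q s (φ t)) τ = _ := h2
  rw [h1, h2']
  have e1 := hQ.equation τ hτ (φ t)
  have e2 := hQ.tau_mul_deriv hτ (φ t)
  have e3 := hQ.tau_mul_deriv_meanRadius hA hε hτ
  rw [show deriv (radiusPart (Q τ)) (φ t)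
    = -(τ * deriv (fun y => deriv (fun s => Q s y) τ) (φ t)) by rw [e2, neg_neg],
    show radiusPart (Q τ) (φ t) = -(τ * deriv (fun s => Q s (φ t)) τ) by rw [e1, neg_neg],
    ← e3]
  simp only [Complex.real_smul]
  push_cast
  ring

end Model

end LegendreFlow

/-! ### Initial data, existence and convergence of the explicit solutions -/

namespace LegendreFlow

open Set Filter Topology MeasureTheory

lemma decomp_unit {n : ℂ} (hn : ‖n‖ = 1) (z : ℂ) :
    z = ((inner ℝ z n : ℝ) + (inner ℝ z (Complex.I * n) : ℝ) * Complex.I) * n := by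
  have h : n.re * n.re + n.im * n.im = 1 := by
    rw [← inner_eq, real_inner_self_eq_norm_sq, hn, one_pow]
  refine Complex.ext ?_ ?_
  · simp
    linear_combination (-z.re) * h
  · simp
    linear_combination (-z.im) * h

lemma deriv_normal {ν : ℝ → ℂ} (hν : Differentiable ℝ ν) (h1 : ∀ u, ‖ν u‖ = 1) (u : ℝ) :
    deriv ν u = ((ell ν u : ℝ) : ℂ) * (Complex.I * ν u) := by
  have hd := (hν u).hasDerivAt
  have h2 := hd.inner ℝ hd
  have h3 : (fun u => inner ℝ (ν u) (ν u)) = fun _ => (1 : ℝ) := by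
    funext v
    rw [real_inner_self_eq_norm_sq, h1, one_pow]
  rw [h3] at h2
  have h4 := h2.unique (hasDerivAt_const u (1 : ℝ))
  have h5 : inner ℝ (deriv ν u) (ν u) = 0 := by
    rw [real_inner_comm] at h4
    linarith
  have h6 := decomp_unit (h1 u) (deriv ν u)
  rw [h5] at h6
  rw [ell, mu]
  refine h6.trans ?_
  push_cast
  ring

lemma IsLegendreCurve.deriv_curve {γ ν : ℝ → ℂ} (h : IsLegendreCurve γ ν) (u : ℝ) :
    deriv γ u = ((beta γ ν u : ℝ) : ℂ) * (Complex.I * ν u) := by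
  have h6 := decomp_unit (h.norm_normal u) (deriv γ u)
  rw [h.orthogonal] at h6
  rw [beta, mu]
  refine h6.trans ?_
  push_cast
  ring

lemma circ_add (x y : ℝ) : circ (x + y) = circ x * circ y := by
  rw [circ, circ, circ, ← Complex.exp_add]
  congr 1
  push_cast
  ring

lemma exists_circ_eq {z : ℂ} (hz : ‖z‖ = 1) : ∃ c, z = circ c :=
  ⟨Complex.arg z, by
    have := Complex.norm_mul_exp_arg_mul_I z
    rw [hz, Complex.ofReal_one, one_mul] at this
    exact this.symm⟩

/-- A unit field is given by its normal angle: it is `circ θ` as soon as this holds at one point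
and `θ' = ℓ`. -/
lemma eq_circ_of_deriv {ν : ℝ → ℂ} (hν : Differentiable ℝ ν) (h1 : ∀ u, ‖ν u‖ = 1) {θ : ℝ → ℝ}
    (hθ : ∀ u, HasDerivAt θ (ell ν u) u) (h0 : ν 0 = circ (θ 0)) (u : ℝ) : ν u = circ (θ u) := by
  have hc : ∀ v, HasDerivAt (fun v => ν v * circ (-θ v)) 0 v := by
    intro v
    have h2 := (hν v).hasDerivAt
    rw [deriv_normal hν h1] at h2
    have h3 := ((hasDerivAt_circ (-θ v)).scomp v (hθ v).neg)
    refine (h2.mul h3).congr_deriv ?_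
    simp only [Function.comp_apply, Complex.real_smul, Pi.neg_apply]
    push_cast
    ring
  have h4 := is_const_of_deriv_eq_zero (fun v => (hc v).differentiableAt)
    (fun v => (hc v).deriv) u 0
  have h5 : ∀ x, circ x * circ (-x) = 1 := fun x => by
    rw [← circ_add, add_neg_cancel]
    simp [circ]
  rw [h0, h5] at h4
  calc ν u = ν u * circ (-θ u) * circ (θ u) := by
        rw [mul_assoc, mul_comm (circ (-θ u)), h5, mul_one]
    _ = circ (θ u) := by rw [h4, one_mul]

lemma isAngle_add (c : ℝ) : IsAngle fun u => u + c where
  smooth := by fun_prop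
  deriv_pos u := by simp
  add_period u := by ring

/-- A curve with unit normal `e^{ix}` is given by its support function. -/
lemma exists_supportCurve {γ₀ ν₀ : ℝ → ℂ} (h : IsLegendreCurve γ₀ ν₀) (hℓ : ∀ u, ell ν₀ u = 1) :
    ∃ (c ρ : ℝ) (q : ℝ → ℝ), Admissible q ∧
      (∀ u, γ₀ u = supportCurve (steinerPoint γ₀ ν₀) ρ q (u + c)) ∧ ∀ u, ν₀ u = circ (u + c) := by
  obtain ⟨c, hc⟩ := exists_circ_eq (h.norm_normal 0)
  have hν : ∀ u, ν₀ u = circ (u + c) := by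
    refine eq_circ_of_deriv (h.smooth_normal.differentiable (by simp)) h.norm_normal
      (θ := fun u => u + c) (fun u => ?_) (by rw [hc, zero_add])
    rw [hℓ]
    exact (hasDerivAt_id u).add_const c
  set S := steinerPoint γ₀ ν₀ with hS
  set P : ℝ → ℝ := fun x => inner ℝ (γ₀ (x - c)) (circ x) with hP
  have hsub : ContDiff ℝ ∞ fun x : ℝ => x - c := by fun_prop
  have hPs : ContDiff ℝ ∞ P := (h.smooth_curve.comp hsub).inner ℝ contDiff_circ
  have hPp : Function.Periodic P (2 * Real.pi) := by
    intro x
    simp only [hP, circ_periodic x, show x + 2 * Real.pi - c = x - c + 2 * Real.pi by ring,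
      h.periodic_curve (x - c)]
  have hPd : ∀ x, HasDerivAt P (inner ℝ (γ₀ (x - c)) (Complex.I * circ x)) x := by
    intro x
    have h1 := (h.smooth_curve.differentiable (by simp) (x - c)).hasDerivAt
    rw [h.deriv_curve] at h1
    have h2 := h1.scomp x ((hasDerivAt_id x).sub_const c)
    refine (h2.inner ℝ (hasDerivAt_circ x)).congr_deriv ?_
    rw [hν, sub_add_cancel, one_smul, inner_mu_circ, add_zero]
    rfl
  set ρ : ℝ := (∫ x in (0 : ℝ)..(2 * Real.pi), P x) / (2 * Real.pi) with hρ
  set q : ℝ → ℝ := fun x => P x - ρ - inner ℝ S (circ x) with hq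
  have hSd : ∀ x, HasDerivAt (fun x => inner ℝ S (circ x)) (inner ℝ S (Complex.I * circ x)) x := by
    intro x
    simpa using (hasDerivAt_const x S).inner ℝ (hasDerivAt_circ x)
  have hqs : ContDiff ℝ ∞ q := (hPs.sub contDiff_const).sub (contDiff_const.inner ℝ contDiff_circ)
  have hqd : ∀ x, deriv q x = inner ℝ (γ₀ (x - c)) (Complex.I * circ x)
      - inner ℝ S (Complex.I * circ x) := fun x => (((hPd x).sub_const ρ).sub (hSd x)).deriv
  have hcurve : ∀ x, γ₀ (x - c) = supportCurve S ρ q x := by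
    intro x
    have h1 := decomp_unit (norm_circ x) (γ₀ (x - c) - S)
    rw [supportCurve, hqd, ← inner_sub_left,
      show ρ + q x = inner ℝ (γ₀ (x - c) - S) (circ x) by
        simp only [hq, hP, inner_sub_left]; ring, ← h1]
    ring
  have hPc := hPs.continuous
  have cc := contDiff_circ.continuous
  have hst : (∫ x in (0 : ℝ)..(2 * Real.pi), P x • circ x) = (Real.pi : ℝ) • S := by
    have h1 := integral_comp_isAngle (isAngle_add c) (G := fun x => P x • circ x) (by fun_prop)
      (fun x => by simp only [hPp x, circ_periodic x])
    rw [hS, steinerPoint, smul_smul, one_div, mul_inv_cancel₀ Real.pi_ne_zero, one_smul, ← h1]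
    refine intervalIntegral.integral_congr fun u _ => ?_
    simp [support, hℓ, hν, hP]
  have hint : IntervalIntegrable (fun x => P x • circ x) volume 0 (2 * Real.pi) :=
    Continuous.intervalIntegrable (by fun_prop) _ _
  have r1 := Complex.reCLM.intervalIntegral_comp_comm hint
  have r2 := Complex.imCLM.intervalIntegral_comp_comm hint
  rw [hst] at r1 r2
  simp only [Complex.reCLM_apply, Complex.imCLM_apply, Complex.real_smul, Complex.re_ofReal_mul,
    Complex.im_ofReal_mul, circ_re, circ_im] at r1 r2
  have hadm : Admissible q := by
    refine ⟨hqs, fun x => by simp only [hq, hPp x, circ_periodic x], ?_, ?_, ?_⟩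
    · have e := integral_lin4 (f₁ := P) (f₂ := fun _ => 1) (f₃ := Real.cos) (f₄ := Real.sin) hPc
        (by fun_prop) (by fun_prop) (by fun_prop) 1 (-ρ) (-S.re) (-S.im)
      refine Eq.trans (intervalIntegral.integral_congr fun x _ => ?_) (e.trans ?_)
      · simp only [hq, inner_eq, circ_re, circ_im]
        ring
      · simp [hρ]
    · have e := integral_lin4 (f₁ := fun x => P x * Real.cos x) (f₂ := Real.cos)
        (f₃ := fun x => Real.cos x * Real.cos x) (f₄ := fun x => Real.sin x * Real.cos x)
        (by fun_prop) (by fun_prop) (by fun_prop) (by fun_prop) 1 (-ρ) (-S.re) (-S.im)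
      refine Eq.trans (intervalIntegral.integral_congr fun x _ => ?_) (e.trans ?_)
      · simp only [hq, inner_eq, circ_re, circ_im]
        ring
      · rw [r1, integral_cos_sq_period, integral_sin_cos_period, integral_cos_period]
        ring
    · have e := integral_lin4 (f₁ := fun x => P x * Real.sin x) (f₂ := Real.sin)
        (f₃ := fun x => Real.sin x * Real.cos x) (f₄ := fun x => Real.sin x * Real.sin x)
        (by fun_prop) (by fun_prop) (by fun_prop) (by fun_prop) 1 (-ρ) (-S.re) (-S.im)
      refine Eq.trans (intervalIntegral.integral_congr fun x _ => ?_) (e.trans ?_)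
      · simp only [hq, inner_eq, circ_re, circ_im]
        ring
      · rw [r2, integral_sin_sq_period, integral_sin_cos_period, integral_sin_period]
        ring
  refine ⟨c, ρ, q, hadm, fun u => ?_, hν⟩
  rw [← hcurve, add_sub_cancel_right]

/-- Every initial curve of positive algebraic area is the value at `τ = 1` of an explicit
solution. -/
lemma exists_model {γ₀ ν₀ : ℝ → ℂ} (h : IsLegendreCurve γ₀ ν₀) (hℓ : ∀ u, ell ν₀ u = 1)
    (hA : 0 < algArea γ₀ ν₀) :
    ∃ (c : ℝ) (Q : ℝ → ℝ → ℝ), LinearFlow Q ∧ Real.sign (algLength γ₀ ν₀) ^ 2 = 1 ∧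
      (γ₀ = fun u => modelCurve (steinerPoint γ₀ ν₀) (Real.sign (algLength γ₀ ν₀))
        (algArea γ₀ ν₀) Q 1 (u + c)) ∧ ν₀ = fun u => circ (u + c) := by
  obtain ⟨c, ρ, q, hq, hγ, hν⟩ := exists_supportCurve h hℓ
  obtain ⟨Q, hQs, hQp, hQ0, hQc, hQsin, hQz, hQ1, hQe⟩ :=
    exists_linear_flow hq.smooth hq.periodic hq.integral_eq hq.integral_cos hq.integral_sin
  have hadm : ∀ τ, Admissible (Q τ) := fun τ =>
    ⟨contDiff_comp_mk hQs τ, hQp τ, hQ0 τ, hQc τ, hQsin τ⟩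
  have hν' : ν₀ = fun u => circ (u + c) := funext hν
  have hγ' : γ₀ = fun u => supportCurve (steinerPoint γ₀ ν₀) ρ q (u + c) := funext hγ
  have hL : algLength γ₀ ν₀ = 2 * Real.pi * ρ := by
    have := algLength_supportCurve_comp hq (isAngle_add c) (steinerPoint γ₀ ν₀) ρ
    rwa [← hγ', ← hν'] at this
  have hAr : algArea γ₀ ν₀ = Real.pi * ρ ^ 2 - deficit q := by
    have := algArea_supportCurve_comp hq (isAngle_add c) (steinerPoint γ₀ ν₀) ρ
    rwa [← hγ', ← hν'] at this
  have hρ : ρ ≠ 0 := by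
    rintro rfl
    have := hq.deficit_nonneg
    rw [hAr] at hA
    norm_num at hA
    linarith
  have hsign : Real.sign (algLength γ₀ ν₀) = Real.sign ρ := by
    rw [hL]
    rcases lt_or_gt_of_ne hρ with h1 | h1
    · rw [Real.sign_of_neg h1, Real.sign_of_neg (mul_neg_of_pos_of_neg Real.two_pi_pos h1)]
    · rw [Real.sign_of_pos h1, Real.sign_of_pos (mul_pos Real.two_pi_pos h1)]
  refine ⟨c, Q, ⟨hQs, hadm, hQz, hQe⟩, ?_, ?_, hν'⟩
  · rw [hsign]
    rcases lt_or_gt_of_ne hρ with h1 | h1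
    · rw [Real.sign_of_neg h1]; norm_num
    · rw [Real.sign_of_pos h1]; norm_num
  · have hm : meanRadius (Real.sign (algLength γ₀ ν₀)) (algArea γ₀ ν₀) Q 1 = ρ := by
      rw [meanRadius, hsign, hQ1, hAr, sub_add_cancel, mul_div_cancel_left₀ _ Real.pi_ne_zero,
        Real.sqrt_sq_eq_abs]
      rcases lt_or_gt_of_ne hρ with h1 | h1
      · rw [Real.sign_of_neg h1, abs_of_neg h1]; ring
      · rw [Real.sign_of_pos h1, abs_of_pos h1]; ring
    unfold modelCurve
    rw [hm, hQ1]
    exact hγ'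

section Existence

variable {Q : ℝ → ℝ → ℝ} {A ε : ℝ} {S : ℂ}

lemma exp_neg_mem_Icc {t : ℝ} (ht : 0 ≤ t) : Real.exp (-t) ∈ Icc (0 : ℝ) 1 :=
  ⟨(Real.exp_pos _).le, Real.exp_le_one_iff.2 (by linarith)⟩

lemma contDiff_exp_neg_fst : ContDiff ℝ ∞ fun x : ℝ × ℝ => Real.exp (-x.1) :=
  contDiff_fst.neg.exp

lemma LinearFlow.evolvesBy_normalized (hQ : LinearFlow Q) (hA : 0 < A) (hε : ε ^ 2 = 1) (c : ℝ) :
    EvolvesBy normalizedFlowVelocity (fun u => modelCurve S ε A Q 1 (u + c))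
      (fun u => circ (u + c)) (fun t u => modelCurve S ε A Q (Real.exp (-t)) (u + c))
      (fun _ u => circ (u + c)) where
  smooth_curve := by
    have h : ContDiff ℝ ∞ fun x : ℝ × ℝ => modelCurve S ε A Q (Real.exp (-x.1)) (x.2 + c) :=
      (hQ.contDiff_modelCurve hA S).comp
        (f := fun x : ℝ × ℝ => ((Real.exp (-x.1), x.2 + c) : ℝ × ℝ))
        (contDiff_exp_neg_fst.prodMk (contDiff_snd.add contDiff_const))
    exact h.contDiffOn
  smooth_normal :=
    (contDiff_circ.comp (contDiff_snd.add contDiff_const)).contDiffOn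
  periodic_curve t _ u :=
    (isEllConvex_supportCurve_comp (hQ.admissible (Real.exp (-t))) (isAngle_add c) S
      (meanRadius ε A Q (Real.exp (-t)))).1.periodic_curve u
  periodic_normal t _ u := by
    simp only [show u + 2 * Real.pi + c = u + c + 2 * Real.pi by ring, circ_periodic (u + c)]
  initial_curve := by simp
  initial_normal := rfl
  evolution_curve t ht u := by
    have h := hQ.hasDerivAt_modelCurve hA hε S ht (hasDerivAt_const t (u + c))
    unfold modelCurve at h ⊢
    rw [normalizedFlowVelocity_supportCurve_comp (hQ.admissible _) (isAngle_add c) S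
      (hQ.meanRadius_ne_zero hA hε _)]
    simpa using h.hasDerivWithinAt
  evolution_normal t ht u := by
    have h : (normalizedFlowVelocity (fun u => modelCurve S ε A Q (Real.exp (-t)) (u + c))
      (fun u => circ (u + c)) u).2 = 0 := rfl
    rw [h]
    exact hasDerivWithinAt_const _ _ _

lemma LinearFlow.angle_evolution (hQ : LinearFlow Q) {t : ℝ} (ht : 0 ≤ t) (x : ℝ) :
    -(Real.exp (-t) * angleVelocity ε A Q (Real.exp (-t)) x)
      = -(modelRadius ε A Q (Real.exp (-t)) x * deriv (radiusPart (Q (Real.exp (-t)))) x /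
          (1 + modelRadius ε A Q (Real.exp (-t)) x ^ 2)) := by
  have e := hQ.tau_mul_deriv (exp_neg_mem_Icc ht) x
  have h1 : 1 + modelRadius ε A Q (Real.exp (-t)) x ^ 2 ≠ 0 := by positivity
  rw [angleVelocity, neg_inj]
  field_simp
  linear_combination (-modelRadius ε A Q (Real.exp (-t)) x) * e

/-- The flow is obtained from the normalized one by moving the parameter along the characteristics
`Θ` of the normal angle. -/
lemma LinearFlow.evolvesBy_flow (hQ : LinearFlow Q) (hA : 0 < A) (hε : ε ^ 2 = 1) (c : ℝ)
    {Θ : ℝ → ℝ → ℝ} (hΘ : ContDiff ℝ ∞ fun x : ℝ × ℝ => Θ x.1 x.2) (hΘ1 : ∀ u, Θ 1 u = u)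
    (hΘd : ∀ τ u, HasDerivAt (fun s => Θ s u) (angleVelocity ε A Q τ (Θ τ u)) τ)
    (hang : ∀ τ, IsAngle fun u => Θ τ (u + c)) :
    EvolvesBy flowVelocity (fun u => modelCurve S ε A Q 1 (u + c))
      (fun u => circ (u + c))
      (fun t u => modelCurve S ε A Q (Real.exp (-t)) (Θ (Real.exp (-t)) (u + c)))
      (fun t u => circ (Θ (Real.exp (-t)) (u + c))) := by
  have hφ : ContDiff ℝ ∞ fun x : ℝ × ℝ => Θ (Real.exp (-x.1)) (x.2 + c) :=
    hΘ.comp (f := fun x : ℝ × ℝ => ((Real.exp (-x.1), x.2 + c) : ℝ × ℝ))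
      (contDiff_exp_neg_fst.prodMk (contDiff_snd.add contDiff_const))
  have hφd : ∀ t, 0 ≤ t → ∀ u, HasDerivAt (fun t => Θ (Real.exp (-t)) (u + c))
      (-(modelRadius ε A Q (Real.exp (-t)) (Θ (Real.exp (-t)) (u + c))
        * deriv (radiusPart (Q (Real.exp (-t)))) (Θ (Real.exp (-t)) (u + c)) /
          (1 + modelRadius ε A Q (Real.exp (-t)) (Θ (Real.exp (-t)) (u + c)) ^ 2))) t := by
    intro t ht u
    have hσ : HasDerivAt (fun t => Real.exp (-t)) (-Real.exp (-t)) t := by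
      simpa using (hasDerivAt_neg t).exp
    refine ((hΘd (Real.exp (-t)) (u + c)).comp t hσ).congr_deriv ?_
    rw [← hQ.angle_evolution ht]
    ring
  refine
    { smooth_curve := ?_
      smooth_normal := (contDiff_circ.comp hφ).contDiffOn
      periodic_curve := fun t _ => (isEllConvex_supportCurve_comp (hQ.admissible (Real.exp (-t)))
        (hang _) S (meanRadius ε A Q (Real.exp (-t)))).1.periodic_curve
      periodic_normal := fun t _ =>
        (isEllConvex_supportCurve_comp (hQ.admissible (Real.exp (-t)))
        (hang _) S (meanRadius ε A Q (Real.exp (-t)))).1.periodic_normal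
      initial_curve := by simp [hΘ1]
      initial_normal := by simp [hΘ1]
      evolution_curve := fun t ht u => ?_
      evolution_normal := fun t ht u => ?_ }
  · have h : ContDiff ℝ ∞ fun x : ℝ × ℝ =>
        modelCurve S ε A Q (Real.exp (-x.1)) (Θ (Real.exp (-x.1)) (x.2 + c)) :=
      (hQ.contDiff_modelCurve hA S).comp
        (f := fun x : ℝ × ℝ => ((Real.exp (-x.1), Θ (Real.exp (-x.1)) (x.2 + c)) : ℝ × ℝ))
        (contDiff_exp_neg_fst.prodMk hφ)
    exact h.contDiffOn
  · have h := hQ.hasDerivAt_modelCurve hA hε S ht (hφd t ht u)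
    refine (h.congr_deriv ?_).hasDerivWithinAt
    have hv := flowVelocity_supportCurve_comp (hQ.admissible (Real.exp (-t)))
      (hang (Real.exp (-t))) S (hQ.meanRadius_ne_zero hA hε (Real.exp (-t))) u
    refine Eq.trans ?_ (congrArg Prod.fst hv).symm
    simp only
    congr 2
    have hm : ∀ x, meanRadius ε A Q (Real.exp (-t)) + radiusPart (Q (Real.exp (-t))) x
      = modelRadius ε A Q (Real.exp (-t)) x := fun x => rfl
    rw [hm]
    generalize modelRadius ε A Q (Real.exp (-t)) (Θ (Real.exp (-t)) (u + c)) = B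
    have h1 : 1 + B ^ 2 ≠ 0 := by positivity
    field_simp
    ring
  · have h := (hasDerivAt_circ (Θ (Real.exp (-t)) (u + c))).scomp t (hφd t ht u)
    refine (h.congr_deriv ?_).hasDerivWithinAt
    have hv := flowVelocity_supportCurve_comp (hQ.admissible (Real.exp (-t)))
      (hang (Real.exp (-t))) S (hQ.meanRadius_ne_zero hA hε (Real.exp (-t))) u
    exact (congrArg Prod.snd hv).symm

end Existence

/-! ### Convergence and the limit circle -/

lemma contDiff_iteratedDeriv_snd {F : ℝ → ℝ → ℂ} (hF : ContDiff ℝ ∞ fun x : ℝ × ℝ => F x.1 x.2)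
    (hp : ∀ τ, Function.Periodic (F τ) (2 * Real.pi)) (k : ℕ) :
    ContDiff ℝ ∞ (fun x : ℝ × ℝ => iteratedDeriv k (F x.1) x.2) ∧
      ∀ τ, Function.Periodic (iteratedDeriv k (F τ)) (2 * Real.pi) := by
  induction k with
  | zero => simpa using ⟨hF, hp⟩
  | succ k ih =>
    simp only [iteratedDeriv_succ]
    exact ⟨contDiff_deriv_snd (F := fun τ => iteratedDeriv k (F τ)) ih.1,
      fun τ => periodic_deriv (ih.2 τ)⟩

/-- A family which is smooth in `τ = e^{-t}` up to `τ = 0` converges in `C^∞` as `t → ∞`. -/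
lemma convergesSmoothly_of_smooth {F : ℝ → ℝ → ℂ} {γ : ℝ → ℝ → ℂ}
    (hF : ContDiff ℝ ∞ fun x : ℝ × ℝ => F x.1 x.2)
    (hp : ∀ τ, Function.Periodic (F τ) (2 * Real.pi))
    (hγ : ∀ t, 0 ≤ t → γ t = F (Real.exp (-t))) : ConvergesSmoothly γ (F 0) := by
  intro k
  obtain ⟨hG, hGp⟩ := contDiff_iteratedDeriv_snd hF hp k
  rw [Metric.tendstoUniformly_iff]
  intro e he
  have hev : ∀ᶠ τ in 𝓝 (0 : ℝ), ∀ u ∈ Icc 0 (2 * Real.pi),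
      dist (iteratedDeriv k (F 0) u) (iteratedDeriv k (F τ) u) < e := by
    refine isCompact_Icc.eventually_forall_of_forall_eventually fun u _ => ?_
    have hc : Continuous fun z : ℝ × ℝ =>
        dist (iteratedDeriv k (F 0) z.2) (iteratedDeriv k (F z.1) z.2) :=
      Continuous.dist (hG.continuous.comp (f := fun z : ℝ × ℝ => ((0, z.2) : ℝ × ℝ))
        (by fun_prop)) hG.continuous
    exact (hc.tendsto (0, u)).eventually_lt_const (by simpa using he)
  have hlim : Tendsto (fun t : ℝ => Real.exp (-t)) atTop (𝓝 0) := Real.tendsto_exp_neg_atTop_nhds_zero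
  filter_upwards [hlim.eventually hev, eventually_ge_atTop 0] with t ht ht0 u
  rw [hγ t ht0]
  have hq : Function.Periodic (fun u =>
      dist (iteratedDeriv k (F 0) u) (iteratedDeriv k (F (Real.exp (-t))) u)) (2 * Real.pi) := by
    intro u
    simp only [hGp _ u]
  obtain ⟨v, hv, huv⟩ := hq.exists_mem_Ico₀ Real.two_pi_pos u
  rw [huv]
  exact ht v (Ico_subset_Icc_self hv)

lemma circ_eq_circ_iff {x y : ℝ} : circ x = circ y ↔ ∃ k : ℤ, x = y + k * (2 * Real.pi) := by
  rw [circ, circ, Complex.exp_eq_exp_iff_exists_int]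
  refine exists_congr fun k => ⟨fun h => ?_, fun h => ?_⟩
  · have h1 := congrArg Complex.im h
    simp at h1
    linarith
  · rw [h]
    push_cast
    ring

lemma eq_of_circ_eq {E : Type*} {F : ℝ → E} (hF : Function.Periodic F (2 * Real.pi)) {x y : ℝ}
    (h : circ x = circ y) : F x = F y := by
  obtain ⟨k, rfl⟩ := circ_eq_circ_iff.1 h
  exact hF.int_mul k y

lemma bijOn_circ_comp {θ : ℝ → ℝ} (hθ : IsAngle θ) :
    BijOn (fun u => circ (θ u)) (Ico 0 (2 * Real.pi)) (Metric.sphere 0 1) := by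
  have hmono : StrictMono θ := strictMono_of_deriv_pos hθ.deriv_pos
  have h2 : θ (2 * Real.pi) = θ 0 + 2 * Real.pi := by
    have := hθ.add_period 0
    rwa [zero_add] at this
  have hpi := Real.two_pi_pos
  refine ⟨fun u _ => by simp [norm_circ], ?_, ?_⟩
  · intro u hu v hv huv
    obtain ⟨k, hk⟩ := circ_eq_circ_iff.1 huv
    have b1 := hmono.monotone hu.1
    have b2 := hmono hu.2
    have b3 := hmono.monotone hv.1
    have b4 := hmono hv.2
    have k1 : (k : ℝ) < 1 := by
      by_contra hcon
      have : 2 * Real.pi ≤ k * (2 * Real.pi) := le_mul_of_one_le_left hpi.le (not_lt.1 hcon)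
      linarith
    have k2 : (-1 : ℝ) < k := by
      by_contra hcon
      have : k * (2 * Real.pi) ≤ -1 * (2 * Real.pi) :=
        mul_le_mul_of_nonneg_right (not_lt.1 hcon) hpi.le
      linarith
    have k0 : k = 0 := by
      have k1' : k < 1 := by exact_mod_cast k1
      have k2' : -1 < k := by exact_mod_cast k2
      omega
    rw [k0] at hk
    simp at hk
    exact hmono.injective hk
  · intro w hw
    obtain ⟨x, rfl⟩ := exists_circ_eq (by simpa using hw)
    obtain ⟨y, hy, hxy⟩ := circ_periodic.exists_mem_Ico hpi x (θ 0)
    obtain ⟨u, hu, huy⟩ := intermediate_value_Ico hpi.le hθ.smooth.continuous.continuousOn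
      (show y ∈ Ico (θ 0) (θ (2 * Real.pi)) by rwa [h2])
    exact ⟨u, hu, by simp only [huy, hxy]⟩

lemma bijOn_circle {θ : ℝ → ℝ} (hθ : IsAngle θ) (S : ℂ) {ε r : ℝ} (hε : ε ^ 2 = 1) (hr : 0 < r) :
    BijOn (fun u => S + (ε * r) • circ (θ u)) (Ico 0 (2 * Real.pi)) (Metric.sphere S r) := by
  have hεa : |ε| = 1 := by rw [← sq_abs] at hε; nlinarith [abs_nonneg ε]
  have hne : ε * r ≠ 0 := by
    have : ε ≠ 0 := by rintro rfl; norm_num at hε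
    positivity
  have h1 : BijOn (fun z : ℂ => S + (ε * r) • z) (Metric.sphere 0 1) (Metric.sphere S r) := by
    refine ⟨fun z hz => ?_, fun z _ w _ h => ?_, fun w hw => ⟨(ε * r)⁻¹ • (w - S), ?_, ?_⟩⟩
    · have hz' : ‖z‖ = 1 := by simpa using hz
      simp [hz', hεa, abs_of_pos hr]
    · exact smul_right_injective ℂ hne (add_left_cancel h)
    · have hw' : ‖w - S‖ = r := by simpa [dist_eq_norm] using hw
      simp [hw', hεa, abs_of_pos hr, hr.ne']
    · simp only
      rw [smul_inv_smul₀ hne]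
      ring
  exact h1.comp (bijOn_circ_comp hθ)

lemma LinearFlow.modelCurve_zero {Q : ℝ → ℝ → ℝ} (hQ : LinearFlow Q) (S : ℂ) (ε A x : ℝ) :
    modelCurve S ε A Q 0 x = S + (ε * Real.sqrt (A / Real.pi)) • circ x := by
  have h : Q 0 = fun _ => 0 := funext hQ.at_zero
  rw [modelCurve, supportCurve, meanRadius, h]
  simp [deficit]

end LegendreFlow

/-! ### Evolution of a solution: Legendre condition and Fourier moments -/

namespace LegendreFlow

open Set Filter Topology MeasureTheory

lemma inner_mul_unit {n : ℂ} (hn : ‖n‖ = 1) (w : ℂ) : inner ℝ (w * n) n = w.re := by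
  have h : n.re * n.re + n.im * n.im = 1 := by
    rw [← inner_eq, real_inner_self_eq_norm_sq, hn, one_pow]
  rw [inner_eq, Complex.mul_re, Complex.mul_im]
  linear_combination w.re * h

lemma inner_mul_unit_I {n : ℂ} (hn : ‖n‖ = 1) (w : ℂ) :
    inner ℝ (w * n) (Complex.I * n) = w.im := by
  have h : n.re * n.re + n.im * n.im = 1 := by
    rw [← inner_eq, real_inner_self_eq_norm_sq, hn, one_pow]
  simp only [inner_eq, Complex.mul_re, Complex.mul_im, Complex.I_re, Complex.I_im]
  linear_combination w.im * h

lemma eq_of_hasDerivAt_zero {E : Type*} [NormedAddCommGroup E] [InnerProductSpace ℝ E] {f : ℝ → E}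
    {T : ℝ} (hc : ContinuousOn f (Ico 0 T)) (hd : ∀ t ∈ Ioo 0 T, HasDerivAt f 0 t) {t : ℝ}
    (ht : t ∈ Ico 0 T) : f t = f 0 := by
  rcases ht.1.eq_or_lt with h0 | h0
  · rw [h0]
  obtain ⟨s, -, hs⟩ := exists_hasDerivAt_eq_slope (fun s => inner ℝ (f t - f 0) (f s))
    (fun _ => 0) h0
    (continuousOn_const.inner (hc.mono fun s hs => ⟨hs.1, hs.2.trans_lt ht.2⟩))
    (fun s hs => by
      simpa using (hasDerivAt_const s (f t - f 0)).inner ℝ (hd s ⟨hs.1, hs.2.trans ht.2⟩))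
  rw [eq_comm, div_eq_zero_iff, ← inner_sub_right, inner_self_eq_zero, sub_eq_zero] at hs
  rcases hs with hs | hs
  · exact hs
  · linarith

lemma contDiffOn_zpow {E : Type*} [NormedAddCommGroup E] [NormedSpace ℝ E] {f : E → ℂ} {s : Set E}
    {n : WithTop ℕ∞} (hf : ContDiffOn ℝ n f s) (h0 : ∀ x ∈ s, f x ≠ 0) (m : ℤ) :
    ContDiffOn ℝ n (fun x => f x ^ m) s := by
  cases m with
  | ofNat k => simpa using hf.pow k
  | negSucc k =>
    simp only [zpow_negSucc]
    exact (hf.pow (k + 1)).inv fun x hx => pow_ne_zero _ (h0 x hx)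

lemma hasDerivAt_zpow_comp {f : ℝ → ℂ} {f' : ℂ} {x : ℝ} (hf : HasDerivAt f f' x) (h0 : f x ≠ 0)
    (m : ℤ) : HasDerivAt (fun x => f x ^ m) (m * f x ^ (m - 1) * f') x :=
  (hasDerivAt_zpow m (f x) (Or.inl h0)).comp x hf

/-- A smooth family of closed curves with unit normal fields with `ℓ > 0`, for times `0 ≤ t < T`,
which moves by `γ_t = f ν + h μ`, `ν_t = -g μ`, where `f` is the speed of the flow and
`f' = ℓ h + β g`. This relation is what preserves the Legendre condition, and both flows are of this
form. -/
structure FlowSegment (T : ℝ) (γ ν : ℝ → ℝ → ℂ) (h g : ℝ → ℝ → ℝ) : Prop where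
  smooth_curve : ContDiffOn ℝ ∞ (fun x : ℝ × ℝ => γ x.1 x.2) (Ico 0 T ×ˢ univ)
  smooth_normal : ContDiffOn ℝ ∞ (fun x : ℝ × ℝ => ν x.1 x.2) (Ico 0 T ×ˢ univ)
  periodic_curve : ∀ t ∈ Ico 0 T, Function.Periodic (γ t) (2 * Real.pi)
  periodic_normal : ∀ t ∈ Ico 0 T, Function.Periodic (ν t) (2 * Real.pi)
  norm_normal : ∀ t ∈ Ico 0 T, ∀ u, ‖ν t u‖ = 1
  ell_pos : ∀ t ∈ Ico 0 T, ∀ u, 0 < ell (ν t) u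
  orthogonal_zero : ∀ u, inner ℝ (deriv (γ 0) u) (ν 0 u) = 0
  integral_ell_zero : ∫ u in (0 : ℝ)..(2 * Real.pi), ell (ν 0) u = 2 * Real.pi
  evolution_curve : ∀ t ∈ Ioo 0 T, ∀ u, HasDerivAt (fun s => γ s u)
    (((speed (γ t) (ν t) u : ℂ) + (h t u : ℂ) * Complex.I) * ν t u) t
  evolution_normal : ∀ t ∈ Ioo 0 T, ∀ u, HasDerivAt (fun s => ν s u)
    (-(g t u : ℂ) * (Complex.I * ν t u)) t
  deriv_speed : ∀ t ∈ Ioo 0 T, ∀ u, deriv (speed (γ t) (ν t)) u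
    = ell (ν t) u * h t u + beta (γ t) (ν t) u * g t u

/-- The Fourier coefficient `∫ γ ν^m dθ` of the curve, as a function of the normal angle. -/
noncomputable def moment (γ ν : ℝ → ℂ) (m : ℤ) : ℂ :=
  ∫ u in (0 : ℝ)..(2 * Real.pi), γ u * ν u ^ m * ell ν u

lemma contDiff_ell {ν : ℝ → ℂ} (hν : ContDiff ℝ ∞ ν) : ContDiff ℝ ∞ (ell ν) :=
  ((contDiff_infty_iff_deriv.1 hν).2).inner ℝ (contDiff_const.mul hν)

lemma contDiff_beta {γ ν : ℝ → ℂ} (hγ : ContDiff ℝ ∞ γ) (hν : ContDiff ℝ ∞ ν) :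
    ContDiff ℝ ∞ (beta γ ν) :=
  ((contDiff_infty_iff_deriv.1 hγ).2).inner ℝ (contDiff_const.mul hν)

lemma ell_periodic {ν : ℝ → ℂ} (hν : Function.Periodic ν (2 * Real.pi)) :
    Function.Periodic (ell ν) (2 * Real.pi) := fun u => by
  simp only [ell, mu, periodic_deriv hν u, hν u]

lemma contDiff_speed {γ ν : ℝ → ℂ} (hγ : ContDiff ℝ ∞ γ) (hν : ContDiff ℝ ∞ ν)
    (hℓ : ∀ u, 0 < ell ν u) : ContDiff ℝ ∞ (speed γ ν) :=
  ((contDiff_beta hγ hν).div (contDiff_ell hν) fun u => (hℓ u).ne').sub contDiff_const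

lemma speed_periodic {γ ν : ℝ → ℂ} (hγ : Function.Periodic γ (2 * Real.pi))
    (hν : Function.Periodic ν (2 * Real.pi)) : Function.Periodic (speed γ ν) (2 * Real.pi) :=
  fun u => by
    simp only [speed, betaNormalized, beta, mu, ell_periodic hν u, periodic_deriv hγ u, hν u]

namespace FlowSegment

variable {T t : ℝ} {γ ν : ℝ → ℝ → ℂ} {h g : ℝ → ℝ → ℝ}

lemma mem_interior_Ico (ht : t ∈ Ioo 0 T) : t ∈ interior (Ico 0 T) := by
  rwa [interior_Ico]

section Fixed

variable (H : FlowSegment T γ ν h g)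

include H

lemma contDiff_curve (ht : t ∈ Ico 0 T) : ContDiff ℝ ∞ (γ t) := contDiff_slice H.smooth_curve ht

lemma contDiff_normal (ht : t ∈ Ico 0 T) : ContDiff ℝ ∞ (ν t) := contDiff_slice H.smooth_normal ht

lemma ne_zero (ht : t ∈ Ico 0 T) (u : ℝ) : ν t u ≠ 0 := by
  rw [← norm_ne_zero_iff, H.norm_normal t ht]
  exact one_ne_zero

lemma hasDerivAt_normal (ht : t ∈ Ico 0 T) (u : ℝ) :
    HasDerivAt (ν t) ((ell (ν t) u : ℂ) * (Complex.I * ν t u)) u := by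
  have hd := (H.contDiff_normal ht).differentiable (by simp)
  rw [← deriv_normal hd (H.norm_normal t ht)]
  exact (hd u).hasDerivAt

lemma contDiff_tangentialVelocity (ht : t ∈ Ioo 0 T) : ContDiff ℝ ∞ (h t) := by
  have ht' := Ioo_subset_Ico_self ht
  have e : h t = fun u => inner ℝ (deriv (fun s => γ s u) t) (Complex.I * ν t u) := by
    funext u
    rw [(H.evolution_curve t ht u).deriv, inner_mul_unit_I (H.norm_normal t ht' u)]
    simp
  rw [e]
  exact (contDiff_slice (F := fun t u => deriv (fun s => γ s u) t)
    (contDiffOn_deriv_fst H.smooth_curve) (mem_interior_Ico ht)).inner ℝ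
    (contDiff_const.mul (H.contDiff_normal ht'))

lemma contDiff_normalVelocity (ht : t ∈ Ioo 0 T) : ContDiff ℝ ∞ (g t) := by
  have ht' := Ioo_subset_Ico_self ht
  have e : g t = fun u => -inner ℝ (deriv (fun s => ν s u) t) (Complex.I * ν t u) := by
    funext u
    rw [(H.evolution_normal t ht u).deriv, ← mul_assoc, inner_mul_unit_I (H.norm_normal t ht' u)]
    simp
  rw [e]
  exact ((contDiff_slice (F := fun t u => deriv (fun s => ν s u) t)
    (contDiffOn_deriv_fst H.smooth_normal) (mem_interior_Ico ht)).inner ℝ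
    (contDiff_const.mul (H.contDiff_normal ht'))).neg

lemma normalVelocity_periodic (ht : t ∈ Ioo 0 T) : Function.Periodic (g t) (2 * Real.pi) := by
  have ht' := Ioo_subset_Ico_self ht
  have e : g t = fun u => -inner ℝ (deriv (fun s => ν s u) t) (Complex.I * ν t u) := by
    funext u
    rw [(H.evolution_normal t ht u).deriv, ← mul_assoc, inner_mul_unit_I (H.norm_normal t ht' u)]
    simp
  intro u
  have hev : (fun s => ν s (u + 2 * Real.pi)) =ᶠ[𝓝 t] fun s => ν s u := by
    filter_upwards [Ioo_mem_nhds ht.1 ht.2] with s hs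
    exact H.periodic_normal s (Ioo_subset_Ico_self hs) u
  rw [e]
  simp only [hev.deriv_eq, H.periodic_normal t ht' u]

lemma hasDerivAt_speed (ht : t ∈ Ioo 0 T) (u : ℝ) : HasDerivAt (speed (γ t) (ν t))
    (ell (ν t) u * h t u + beta (γ t) (ν t) u * g t u) u := by
  have ht' := Ioo_subset_Ico_self ht
  rw [← H.deriv_speed t ht]
  exact hasDerivAt_real (contDiff_speed (H.contDiff_curve ht') (H.contDiff_normal ht')
    (H.ell_pos t ht')) u

lemma contDiffOn_ell : ContDiffOn ℝ ∞ (fun x : ℝ × ℝ => ell (ν x.1) x.2) (Ico 0 T ×ˢ univ) :=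
  (contDiffOn_deriv_snd (uniqueDiffOn_Ico 0 T) H.smooth_normal).inner ℝ
    (contDiffOn_const.mul H.smooth_normal)

lemma hasDerivAt_velocity_normal (ht : t ∈ Ioo 0 T) (u : ℝ) :
    HasDerivAt (fun v => deriv (fun s => ν s v) t)
      ((-((deriv (g t) u : ℝ) : ℂ) * Complex.I + (g t u : ℂ) * ell (ν t) u) * ν t u) u := by
  have ht' := Ioo_subset_Ico_self ht
  have e : (fun v => deriv (fun s => ν s v) t) = fun v => -(g t v : ℂ) * (Complex.I * ν t v) :=
    funext fun v => (H.evolution_normal t ht v).deriv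
  rw [e]
  refine (((hasDerivAt_real (H.contDiff_normalVelocity ht) u).ofReal_comp.neg).mul
    ((H.hasDerivAt_normal ht' u).const_mul Complex.I)).congr_deriv ?_
  simp only [Pi.neg_apply]
  linear_combination (-(g t u : ℂ) * ell (ν t) u * ν t u) * Complex.I_mul_I

/-- `ℓ_t = -g'`. -/
lemma hasDerivAt_ell (ht : t ∈ Ioo 0 T) (u : ℝ) :
    HasDerivAt (fun s => ell (ν s) u) (-deriv (g t) u) t := by
  have ht' := Ioo_subset_Ico_self ht
  have n1 := H.norm_normal t ht' u
  have h1 := hasDerivAt_deriv_snd H.smooth_normal (mem_interior_Ico ht) u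
  rw [(H.hasDerivAt_velocity_normal ht u).deriv] at h1
  refine (h1.inner ℝ ((H.evolution_normal t ht u).const_mul Complex.I)).congr_deriv ?_
  rw [inner_mul_unit_I n1, (H.hasDerivAt_normal ht' u).deriv,
    show Complex.I * (-(g t u : ℂ) * (Complex.I * ν t u)) = ((g t u : ℝ) : ℂ) * ν t u by
      linear_combination (-(g t u : ℂ) * ν t u) * Complex.I_mul_I,
    ← Complex.real_smul (x := g t u), real_inner_smul_right, ← mul_assoc, inner_mul_unit n1]
  simp

/-- The Legendre condition is preserved. -/
lemma orthogonal (ht : t ∈ Ico 0 T) (u : ℝ) : inner ℝ (deriv (γ t) u) (ν t u) = 0 := by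
  have hc : ContinuousOn (fun t => inner ℝ (deriv (γ t) u) (ν t u)) (Ico 0 T) := by
    have h1 := ((contDiffOn_deriv_snd (uniqueDiffOn_Ico 0 T) H.smooth_curve).inner ℝ
      H.smooth_normal).continuousOn
    exact h1.comp (f := fun t : ℝ => ((t, u) : ℝ × ℝ)) (by fun_prop) fun t ht => ⟨ht, mem_univ _⟩
  rw [eq_of_hasDerivAt_zero hc (fun t ht => ?_) ht, H.orthogonal_zero]
  have ht' := Ioo_subset_Ico_self ht
  have n1 := H.norm_normal t ht' u
  have h1 := hasDerivAt_deriv_snd H.smooth_curve (mem_interior_Ico ht) u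
  have e : (fun v => deriv (fun s => γ s v) t)
      = fun v => ((speed (γ t) (ν t) v : ℂ) + (h t v : ℂ) * Complex.I) * ν t v :=
    funext fun v => (H.evolution_curve t ht v).deriv
  have h2 := (((H.hasDerivAt_speed ht u).ofReal_comp.add ((hasDerivAt_real
    (H.contDiff_tangentialVelocity ht) u).ofReal_comp.mul_const Complex.I)).mul
      (H.hasDerivAt_normal ht' u)).deriv
  have h2' : deriv (fun v => ((speed (γ t) (ν t) v : ℂ) + (h t v : ℂ) * Complex.I) * ν t v) u
    = _ := h2
  rw [e, h2'] at h1
  refine (h1.inner ℝ (H.evolution_normal t ht u)).congr_deriv ?_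
  have e3 : inner ℝ (deriv (γ t) u) (Complex.I * ν t u) = beta (γ t) (ν t) u := rfl
  rw [show -(g t u : ℂ) * (Complex.I * ν t u) = (-g t u) • (Complex.I * ν t u) by
      rw [Complex.real_smul, Complex.ofReal_neg], real_inner_smul_right, e3]
  simp only [Pi.add_apply]
  rw [mul_left_comm _ Complex.I, ← mul_assoc, ← mul_assoc, ← add_mul,
    inner_mul_unit n1]
  simp
  ring

lemma isLegendreCurve (ht : t ∈ Ico 0 T) : IsLegendreCurve (γ t) (ν t) where
  smooth_curve := H.contDiff_curve ht
  smooth_normal := H.contDiff_normal ht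
  periodic_curve := H.periodic_curve t ht
  periodic_normal := H.periodic_normal t ht
  norm_normal := H.norm_normal t ht
  orthogonal := H.orthogonal ht

lemma hasDerivAt_curve (ht : t ∈ Ico 0 T) (u : ℝ) :
    HasDerivAt (γ t) ((beta (γ t) (ν t) u : ℂ) * (Complex.I * ν t u)) u := by
  rw [← (H.isLegendreCurve ht).deriv_curve u]
  exact ((H.contDiff_curve ht).differentiable (by simp) u).hasDerivAt

lemma integral_ell (hT : t ∈ Ico 0 T) :
    ∫ u in (0 : ℝ)..(2 * Real.pi), ell (ν t) u = 2 * Real.pi := by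
  rw [eq_of_hasDerivAt_zero (continuousOn_integral (F := fun t u => ell (ν t) u)
    H.contDiffOn_ell.continuousOn 0 (2 * Real.pi)) (fun t ht => ?_) hT, H.integral_ell_zero]
  have h1 := hasDerivAt_integral (F := fun t u => ell (ν t) u) Real.two_pi_pos.le
    (H.contDiffOn_ell.of_le (by norm_cast)) (mem_interior_Ico ht) (H.hasDerivAt_ell ht)
  refine h1.congr_deriv ?_
  have hg := H.contDiff_normalVelocity ht
  rw [intervalIntegral.integral_neg, integral_deriv_eq_zero_of_periodic (hasDerivAt_real hg)
    (contDiff_deriv_real hg).continuous (H.normalVelocity_periodic ht), neg_zero]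

lemma integral_zpow (ht : t ∈ Ico 0 T) {m : ℤ} (hm : m ≠ 0) :
    ∫ u in (0 : ℝ)..(2 * Real.pi), ν t u ^ m * ell (ν t) u = 0 := by
  have c1 := (H.contDiff_normal ht).continuous
  have c2 := (contDiff_ell (H.contDiff_normal ht)).continuous
  have c3 : Continuous fun u => ν t u ^ m := c1.zpow₀ m fun u => Or.inl (H.ne_zero ht u)
  have hm' : (m : ℂ) ≠ 0 := by exact_mod_cast hm
  refine integral_deriv_eq_zero_of_periodic (f := fun u => (m * Complex.I)⁻¹ * ν t u ^ m)
    (fun u => ?_) (by fun_prop) (fun u => by simp only [H.periodic_normal t ht u])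
  refine ((hasDerivAt_zpow_comp (H.hasDerivAt_normal ht u) (H.ne_zero ht u) m).const_mul
    _).congr_deriv ?_
  rw [zpow_sub_one₀ (H.ne_zero ht u)]
  have := H.ne_zero ht u
  field_simp

lemma mul_ell_speed (ht : t ∈ Ico 0 T) (u : ℝ) :
    ell (ν t) u * speed (γ t) (ν t) u
      = beta (γ t) (ν t) u - nonlocalTerm (γ t) (ν t) * ell (ν t) u := by
  have := (H.ell_pos t ht u).ne'
  rw [speed, betaNormalized]
  field_simp

lemma contDiffOn_moment (m : ℤ) :
    ContDiffOn ℝ ∞ (fun x : ℝ × ℝ => γ x.1 x.2 * ν x.1 x.2 ^ m * (ell (ν x.1) x.2 : ℂ))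
      (Ico 0 T ×ˢ univ) :=
  (H.smooth_curve.mul (contDiffOn_zpow H.smooth_normal (fun x hx => H.ne_zero hx.1 x.2) m)).mul
    (Complex.ofRealCLM.contDiff.comp_contDiffOn H.contDiffOn_ell)

lemma continuousOn_moment (m : ℤ) : ContinuousOn (fun t => moment (γ t) (ν t) m) (Ico 0 T) :=
  continuousOn_integral (F := fun t u => γ t u * ν t u ^ m * (ell (ν t) u : ℂ))
    (H.contDiffOn_moment m).continuousOn 0 (2 * Real.pi)

/-- The Fourier coefficients of the curve satisfy uncoupled linear equations, except for the mean
radius `m = -1`, where the nonlocal term enters: the time derivative of `γ ν^m ℓ` is a total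
derivative up to the terms on the right. -/
lemma hasDerivAt_moment (ht : t ∈ Ioo 0 T) (m : ℤ) :
    HasDerivAt (fun s => moment (γ s) (ν s) m)
      (-(m * (m + 2)) * moment (γ t) (ν t) m - (m + 2) * nonlocalTerm (γ t) (ν t) *
        ∫ u in (0 : ℝ)..(2 * Real.pi), ν t u ^ (m + 1) * ell (ν t) u) t := by
  have ht' := Ioo_subset_Ico_self ht
  have hγ := H.contDiff_curve ht'
  have hν := H.contDiff_normal ht'
  have h0 := H.ne_zero ht'
  have hg := H.contDiff_normalVelocity ht
  have c1 := hγ.continuous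
  have c2 := hν.continuous
  have c3 := (contDiff_ell hν).continuous
  have c4 := hg.continuous
  have c5 := (contDiff_deriv_real hg).continuous
  have c6 := (H.contDiff_tangentialVelocity ht).continuous
  have c7 := (contDiff_speed hγ hν (H.ell_pos t ht')).continuous
  have c8 := (contDiff_beta hγ hν).continuous
  have cz : ∀ k : ℤ, Continuous fun u => ν t u ^ k := fun k => c2.zpow₀ k fun u => Or.inl (h0 u)
  have cz0 := cz m
  have cz1 := cz (m - 1)
  have cz2 := cz (m + 1)
  have cz3 := cz (m + 1 - 1)
  have hX := hasDerivAt_integral (F := fun t u => γ t u * ν t u ^ m * (ell (ν t) u : ℂ))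
    Real.two_pi_pos.le ((H.contDiffOn_moment m).of_le (by norm_cast)) (mem_interior_Ico ht)
    (fun u => ((H.evolution_curve t ht u).mul (hasDerivAt_zpow_comp (H.evolution_normal t ht u)
      (h0 u) m)).mul (H.hasDerivAt_ell ht u).ofReal_comp)
  refine hX.congr_deriv ?_
  set lam := nonlocalTerm (γ t) (ν t) with hlam
  -- The function whose derivative is the difference of the two integrands.
  have hΦ : ∀ u, HasDerivAt (fun u => -(γ t u * ν t u ^ m * (g t u : ℂ))
      + Complex.I * (ν t u ^ (m + 1) * (speed (γ t) (ν t) u : ℂ))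
      - (m + 2) * Complex.I * (γ t u * ν t u ^ m)) _ u := fun u =>
    (((((H.hasDerivAt_curve ht' u).mul (hasDerivAt_zpow_comp (H.hasDerivAt_normal ht' u) (h0 u)
      m)).mul (hasDerivAt_real hg u).ofReal_comp).neg).add
      (((hasDerivAt_zpow_comp (H.hasDerivAt_normal ht' u) (h0 u) (m + 1)).mul
        (H.hasDerivAt_speed ht u).ofReal_comp).const_mul Complex.I)).sub
      (((H.hasDerivAt_curve ht' u).mul (hasDerivAt_zpow_comp (H.hasDerivAt_normal ht' u) (h0 u)
      m)).const_mul ((m + 2) * Complex.I))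
  have hI := integral_deriv_eq_zero_of_periodic hΦ (by simp only [Pi.mul_apply]; fun_prop)
    (fun u => by
      simp only [H.periodic_curve t ht' u, H.periodic_normal t ht' u,
        H.normalVelocity_periodic ht u,
        speed_periodic (H.periodic_curve t ht') (H.periodic_normal t ht') u])
  rw [moment, ← intervalIntegral.integral_const_mul, ← intervalIntegral.integral_const_mul,
    ← intervalIntegral.integral_sub (Continuous.intervalIntegrable (by fun_prop) _ _)
      (Continuous.intervalIntegrable (by fun_prop) _ _), ← sub_eq_zero,
    ← intervalIntegral.integral_sub
      (Continuous.intervalIntegrable (by simp only [Pi.mul_apply]; fun_prop) _ _)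
      (Continuous.intervalIntegrable (by fun_prop) _ _), ← hI]
  refine intervalIntegral.integral_congr fun u _ => ?_
  have hz := h0 u
  have e : ((ell (ν t) u : ℝ) : ℂ) * (speed (γ t) (ν t) u : ℝ)
      = (beta (γ t) (ν t) u : ℝ) - lam * (ell (ν t) u : ℝ) := by
    rw [← Complex.ofReal_mul, H.mul_ell_speed ht' u]
    push_cast
    rfl
  simp only [Pi.mul_apply, add_sub_cancel_right, zpow_sub_one₀ hz, zpow_add_one₀ hz]
  push_cast
  generalize (speed (γ t) (ν t) u : ℂ) = f at *
  generalize (ell (ν t) u : ℂ) = l at *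
  generalize (beta (γ t) (ν t) u : ℂ) = b at *
  generalize ν t u ^ m = z at *
  field_simp
  linear_combination z * ν t u * (m + 2) * e
    - (z * ν t u * f * l * (m + 1) - z * (m + 2) * (ν t u * b + γ t u * m * l)) * Complex.I_sq

end Fixed

end FlowSegment

end LegendreFlow

/-! ### Comparison with the explicit solution -/

namespace LegendreFlow

open Set Filter Topology MeasureTheory

lemma eq_zero_of_hasDerivAt_mul {D : ℝ → ℂ} {k : ℂ} {T t : ℝ} (hc : ContinuousOn D (Ico 0 T))
    (hd : ∀ t ∈ Ioo 0 T, HasDerivAt D (k * D t) t) (h0 : D 0 = 0) (ht : t ∈ Ico 0 T) : D t = 0 := by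
  have he : ∀ t : ℝ, HasDerivAt (fun t : ℝ => Complex.exp (-k * t))
      (Complex.exp (-k * t) * (-k * 1)) t := fun t =>
    ((Complex.ofRealCLM.hasDerivAt (x := t)).const_mul (-k)).cexp
  have h := eq_of_hasDerivAt_zero (f := fun t => Complex.exp (-k * t) * D t)
    (ContinuousOn.mul (Continuous.continuousOn (by fun_prop)) hc)
    (fun t ht => ((he t).mul (hd t ht)).congr_deriv (by ring)) ht
  simpa [h0] using h

lemma circ_zpow (x : ℝ) (m : ℤ) : circ x ^ m = Complex.exp (m * x * Complex.I) := by
  rw [circ, ← Complex.exp_int_mul]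
  congr 1
  ring

lemma integral_circ_zpow {m : ℤ} (hm : m ≠ 0) :
    ∫ x in (0 : ℝ)..(2 * Real.pi), circ x ^ m = 0 := by
  have hm' : (m : ℂ) ≠ 0 := by exact_mod_cast hm
  simp only [circ_zpow]
  refine integral_deriv_eq_zero_of_periodic
    (f := fun x : ℝ => (m * Complex.I)⁻¹ * Complex.exp (m * x * Complex.I)) (fun x => ?_)
    (by fun_prop) (fun x => congrArg _ (exp_periodic m x))
  refine ((hasDerivAt_exp_mul m x).const_mul _).congr_deriv ?_
  field_simp

lemma moment_comp {θ : ℝ → ℝ} (hθ : IsAngle θ) {G : ℝ → ℂ} (hG : Continuous G)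
    (hGp : Function.Periodic G (2 * Real.pi)) (m : ℤ) :
    moment (fun u => G (θ u)) (fun u => circ (θ u)) m
      = ∫ x in (0 : ℝ)..(2 * Real.pi), G x * circ x ^ m := by
  have cc := contDiff_circ.continuous
  have hz : Continuous fun x => circ x ^ m :=
    cc.zpow₀ m fun x => Or.inl (Complex.exp_ne_zero _)
  rw [← integral_comp_isAngle hθ (G := fun x => G x * circ x ^ m) (by fun_prop)
    (fun x => by simp only [hGp x, circ_periodic x]), moment]
  refine intervalIntegral.integral_congr fun u _ => ?_
  simp only [ell_circ_comp hθ, Complex.real_smul]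
  ring

/-- The moment of order `-1` is the mean radius of curvature. -/
lemma moment_supportCurve_comp {q θ : ℝ → ℝ} (hq : Admissible q) (hθ : IsAngle θ) (S : ℂ) (ρ : ℝ) :
    moment (fun u => supportCurve S ρ q (θ u)) (fun u => circ (θ u)) (-1)
      = ((2 * Real.pi * ρ : ℝ) : ℂ) := by
  have c1 := hq.smooth.continuous
  have c2 := (contDiff_deriv_real hq.smooth).continuous
  have cc := contDiff_circ.continuous
  have h0 : ∀ x, circ x ≠ 0 := fun x => Complex.exp_ne_zero _
  have ci : Continuous fun x => (circ x)⁻¹ := cc.inv₀ h0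
  rw [moment_comp hθ (contDiff_supportCurve hq.smooth S ρ).continuous
    (supportCurve_periodic hq.periodic S ρ)]
  have e : ∀ x, supportCurve S ρ q x * circ x ^ (-1 : ℤ)
      = (S * (circ x)⁻¹ + (deriv q x : ℝ) * Complex.I) + ((ρ + q x : ℝ) : ℂ) := by
    intro x
    have := h0 x
    rw [zpow_neg_one, supportCurve]
    field_simp
    ring
  have hd : ∀ x, HasDerivAt (fun x => S * Complex.I * (circ x)⁻¹ + (q x : ℂ) * Complex.I)
      (S * (circ x)⁻¹ + (deriv q x : ℝ) * Complex.I) x := by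
    intro x
    refine ((((hasDerivAt_circ x).inv (h0 x)).const_mul (S * Complex.I)).add
      ((hasDerivAt_real hq.smooth x).ofReal_comp.mul_const Complex.I)).congr_deriv ?_
    have := h0 x
    field_simp
    linear_combination (-S) * Complex.I_sq
  simp only [e]
  rw [intervalIntegral.integral_add (Continuous.intervalIntegrable (by fun_prop) _ _)
    (Continuous.intervalIntegrable (by fun_prop) _ _),
    integral_deriv_eq_zero_of_periodic hd (by fun_prop)
      (fun x => by simp only [circ_periodic x, hq.periodic x]),
    intervalIntegral.integral_ofReal, zero_add,
    intervalIntegral.integral_add (Continuous.intervalIntegrable (by fun_prop) _ _)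
    (Continuous.intervalIntegrable (by fun_prop) _ _), hq.integral_eq]
  simp

namespace FlowSegment

variable {T t : ℝ} {γ ν : ℝ → ℝ → ℂ} {h g : ℝ → ℝ → ℝ}

lemma exists_angle (H : FlowSegment T γ ν h g) (ht : t ∈ Ico 0 T) :
    ∃ θ, IsAngle θ ∧ ν t = fun u => circ (θ u) := by
  have hν := H.contDiff_normal ht
  have hℓ := contDiff_ell hν
  have hc := hℓ.continuous
  obtain ⟨a, ha⟩ := exists_circ_eq (H.norm_normal t ht 0)
  have hd : ∀ u, HasDerivAt (fun u => a + ∫ v in (0 : ℝ)..u, ell (ν t) v) (ell (ν t) u) u :=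
    fun u => (intervalIntegral.integral_hasDerivAt_right (hc.intervalIntegrable _ _)
      (hc.stronglyMeasurableAtFilter _ _) hc.continuousAt).const_add a
  have hderiv : deriv (fun u => a + ∫ v in (0 : ℝ)..u, ell (ν t) v) = ell (ν t) :=
    funext fun u => (hd u).deriv
  refine ⟨fun u => a + ∫ v in (0 : ℝ)..u, ell (ν t) v, ⟨?_, fun u => ?_, fun u => ?_⟩, ?_⟩
  · rw [contDiff_infty_iff_deriv, hderiv]
    exact ⟨fun u => (hd u).differentiableAt, hℓ⟩
  · rw [hderiv]
    exact H.ell_pos t ht u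
  · have e1 := (ell_periodic (H.periodic_normal t ht)).intervalIntegral_add_eq u 0
    rw [zero_add, H.integral_ell ht] at e1
    rw [← intervalIntegral.integral_add_adjacent_intervals (hc.intervalIntegrable 0 u)
      (hc.intervalIntegrable u _), e1, add_assoc]
  · exact funext fun u => eq_circ_of_deriv (hν.differentiable (by simp)) (H.norm_normal t ht) hd
      (by simp [ha]) u

/-- Two solutions with the same initial moments have the same moments of all orders `m ≠ -1`. -/
lemma moment_eq {γ' ν' : ℝ → ℝ → ℂ} {h' g' : ℝ → ℝ → ℝ} (H : FlowSegment T γ ν h g)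
    (H' : FlowSegment T γ' ν' h' g') {m : ℤ} (hm : m ≠ -1)
    (h0 : moment (γ 0) (ν 0) m = moment (γ' 0) (ν' 0) m) (ht : t ∈ Ico 0 T) :
    moment (γ t) (ν t) m = moment (γ' t) (ν' t) m := by
  have hm' : m + 1 ≠ 0 := fun h => hm (by omega)
  rw [← sub_eq_zero]
  refine eq_zero_of_hasDerivAt_mul (D := fun t => moment (γ t) (ν t) m - moment (γ' t) (ν' t) m)
    (k := -(m * (m + 2))) ((H.continuousOn_moment m).sub (H'.continuousOn_moment m))
    (fun s hs => ?_) (sub_eq_zero.2 h0) ht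
  refine ((H.hasDerivAt_moment hs m).sub (H'.hasDerivAt_moment hs m)).congr_deriv ?_
  rw [H.integral_zpow (Ioo_subset_Ico_self hs) hm', H'.integral_zpow (Ioo_subset_Ico_self hs) hm']
  ring

end FlowSegment

/-- A curve with normal angle `θ` which has the same moments of orders `m ≠ -1` as a support curve
differs from it only by the mean radius. -/
lemma exists_eq_supportCurve {γ : ℝ → ℂ} {q θ : ℝ → ℝ} (hq : Admissible q) (hθ : IsAngle θ)
    (hγ : IsLegendreCurve γ fun u => circ (θ u)) (S : ℂ) (ρ : ℝ)
    (hm : ∀ m : ℤ, m ≠ -1 → moment γ (fun u => circ (θ u)) m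
      = ∫ x in (0 : ℝ)..(2 * Real.pi), supportCurve S ρ q x * circ x ^ m) :
    ∃ ρ', γ = fun u => supportCurve S ρ' q (θ u) := by
  have c1 := hγ.smooth_curve.continuous
  have cθ := hθ.smooth.continuous
  have cθ' := (contDiff_deriv_real hθ.smooth).continuous
  have cs := (contDiff_supportCurve hq.smooth S ρ).continuous
  have cc := contDiff_circ.continuous
  have h0 : ∀ x, circ x ≠ 0 := fun x => Complex.exp_ne_zero _
  have cz : ∀ m : ℤ, Continuous fun x => circ (θ x) ^ m := fun m =>
    (cc.comp cθ).zpow₀ m fun x => Or.inl (h0 _)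
  have hcirc : ∀ m : ℤ, m ≠ 0 → ∫ u in (0 : ℝ)..(2 * Real.pi),
      circ (θ u) ^ m * ((deriv θ u : ℝ) : ℂ) = 0 := by
    intro m hm
    have h1 := integral_comp_isAngle hθ (G := fun x => circ x ^ m)
      (cc.zpow₀ m fun x => Or.inl (h0 x)) (fun x => by simp only [circ_periodic x])
    rw [integral_circ_zpow hm] at h1
    simpa only [Complex.real_smul, mul_comm] using h1
  have hone : ∫ u in (0 : ℝ)..(2 * Real.pi), ((deriv θ u : ℝ) : ℂ) = 2 * Real.pi := by
    have h1 := integral_comp_isAngle hθ (G := fun _ => (1 : ℂ)) continuous_const fun _ => rfl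
    simpa using h1
  set d : ℝ → ℂ := fun u => γ u - supportCurve S ρ q (θ u) with hd
  have cd : Continuous d := c1.sub (cs.comp cθ)
  set κ : ℂ := (∫ u in (0 : ℝ)..(2 * Real.pi), d u * circ (θ u) ^ (-1 : ℤ) * ((deriv θ u : ℝ) : ℂ))
    / (2 * Real.pi) with hκ
  have hpi : (2 * Real.pi : ℂ) ≠ 0 := by exact_mod_cast Real.two_pi_pos.ne'
  have hdm : ∀ m : ℤ, m ≠ -1 →
      ∫ u in (0 : ℝ)..(2 * Real.pi), d u * circ (θ u) ^ m * ((deriv θ u : ℝ) : ℂ) = 0 := by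
    intro m hne
    have cm := cz m
    have h1 := hm m hne
    rw [← moment_comp hθ cs (supportCurve_periodic hq.periodic S ρ), moment, moment,
      ← sub_eq_zero] at h1
    simp only [ell_circ_comp hθ] at h1
    rw [← intervalIntegral.integral_sub (Continuous.intervalIntegrable (by fun_prop) _ _)
      (Continuous.intervalIntegrable (by fun_prop) _ _)] at h1
    refine Eq.trans (intervalIntegral.integral_congr fun u _ => ?_) h1
    simp only [hd]
    ring
  have key : ∀ u, d u - κ * circ (θ u) = 0 := by
    refine eq_zero_of_integral_angle (hasDerivAt_real hθ.smooth) cθ' hθ.deriv_pos hθ.add_period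
      (by fun_prop) (fun u => ?_) fun m => ?_
    · have e := hγ.periodic_curve u
      simp only [hd, hθ.add_period, circ_periodic (θ u), e,
        supportCurve_periodic hq.periodic S ρ (θ u)]
    · have cm := cz m
      have cm1 := cz (m + 1)
      have e : ∀ u, (d u - κ * circ (θ u)) * Complex.exp (m * θ u * Complex.I) *
          ((deriv θ u : ℝ) : ℂ) = d u * circ (θ u) ^ m * ((deriv θ u : ℝ) : ℂ)
            - κ * (circ (θ u) ^ (m + 1) * ((deriv θ u : ℝ) : ℂ)) := by
        intro u
        rw [← circ_zpow, zpow_add_one₀ (h0 _)]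
        ring
      simp only [e]
      rw [intervalIntegral.integral_sub (Continuous.intervalIntegrable (by fun_prop) _ _)
        (Continuous.intervalIntegrable (by fun_prop) _ _), intervalIntegral.integral_const_mul]
      by_cases hne : m = -1
      · subst hne
        simp only [neg_add_cancel, zpow_zero, one_mul]
        rw [hone, hκ, div_mul_cancel₀ _ hpi, sub_self]
      · rw [hdm m hne, hcirc (m + 1) (fun h => hne (by omega)), mul_zero, sub_zero]
  have hγκ : ∀ u, γ u = supportCurve S ρ q (θ u) + κ * circ (θ u) := fun u => by
    linear_combination key u
  -- Both curves have tangent `μ`, so that the difference of their radii of curvature is real.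
  have hκr : (κ.re : ℂ) = κ := by
    have h1 := ((hasDerivAt_supportCurve_comp hq hθ S ρ 0).add
      ((hasDerivAt_circ_comp hθ.smooth 0).const_mul κ)).deriv
    have h2 := hγ.deriv_curve 0
    rw [show γ = _ from funext hγκ] at h2
    have h3 := h1.symm.trans h2
    have h4 : κ * ((deriv θ 0 : ℝ) : ℂ)
        = ((beta γ (fun u => circ (θ u)) 0 - (ρ + radiusPart q (θ 0)) * deriv θ 0 : ℝ) : ℂ) := by
      rw [← show γ = _ from funext hγκ] at h3
      refine mul_right_cancel₀ (mul_ne_zero Complex.I_ne_zero (h0 (θ 0))) ?_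
      push_cast at h3 ⊢
      linear_combination h3
    have h5 : ((deriv θ 0 : ℝ) : ℂ) ≠ 0 := by exact_mod_cast (hθ.deriv_pos 0).ne'
    rw [← eq_div_iff h5, ← Complex.ofReal_div] at h4
    rw [h4, Complex.ofReal_re]
  refine ⟨ρ + κ.re, funext fun u => ?_⟩
  rw [hγκ, supportCurve, supportCurve, ← hκr]
  push_cast
  simp
  ring

end LegendreFlow

/-! ### Uniqueness on the interval of `ℓ`-convexity -/

namespace LegendreFlow

open Set Filter Topology MeasureTheory

section Evolves

variable {V : (ℝ → ℂ) → (ℝ → ℂ) → ℝ → ℂ × ℂ} {γ₀ ν₀ : ℝ → ℂ} {γ ν : ℝ → ℝ → ℂ}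

lemma EvolvesBy.continuousOn_normal (E : EvolvesBy V γ₀ ν₀ γ ν) (T u : ℝ) :
    ContinuousOn (fun t => ν t u) (Ico 0 T) :=
  E.smooth_normal.continuousOn.comp (f := fun t : ℝ => ((t, u) : ℝ × ℝ)) (by fun_prop)
    fun _ ht => ⟨ht.1, mem_univ _⟩

/-- The length of the normal is preserved if its velocity is tangential. -/
lemma EvolvesBy.norm_normal (E : EvolvesBy V γ₀ ν₀ γ ν) (h1 : ∀ u, ‖ν₀ u‖ = 1)
    {r : ℝ → ℝ → ℝ} (hr : ∀ t, 0 ≤ t → ∀ u, (V (γ t) (ν t) u).2 = r t u • mu (ν t) u) {t : ℝ}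
    (ht : 0 ≤ t) (u : ℝ) : ‖ν t u‖ = 1 := by
  have h2 : inner ℝ (ν t u) (ν t u) = inner ℝ (ν 0 u) (ν 0 u) := by
    refine eq_of_hasDerivAt_zero (f := fun t => inner ℝ (ν t u) (ν t u)) (T := t + 1)
      ((E.continuousOn_normal _ u).inner (E.continuousOn_normal _ u)) (fun s hs => ?_)
      ⟨ht, by linarith⟩
    have h3 := (E.evolution_normal s hs.1.le u).hasDerivAt (Ici_mem_nhds hs.1)
    rw [hr s hs.1.le] at h3
    refine (h3.inner ℝ h3).congr_deriv ?_
    have h4 : inner ℝ (mu (ν s) u) (ν s u) = 0 := by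
      rw [mu, inner_eq]
      simp
      ring
    rw [real_inner_smul_right, real_inner_smul_left, real_inner_comm, h4]
    simp
  rw [real_inner_self_eq_norm_sq, real_inner_self_eq_norm_sq, E.initial_normal, h1] at h2
  have := norm_nonneg (ν t u)
  nlinarith

variable (h₀ : IsLegendreCurve γ₀ ν₀) (hℓ : ∀ u, ell ν₀ u = 1)

lemma EvolvesBy.normal_eq (E : EvolvesBy normalizedFlowVelocity γ₀ ν₀ γ ν) {t : ℝ} (ht : 0 ≤ t) :
    ν t = ν₀ := by
  funext u
  rw [← E.initial_normal]
  exact eq_of_hasDerivAt_zero (f := fun t => ν t u) (T := t + 1) (E.continuousOn_normal _ u)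
    (fun s hs => (E.evolution_normal s hs.1.le u).hasDerivAt (Ici_mem_nhds hs.1))
    ⟨ht, by linarith⟩

include h₀ hℓ

lemma EvolvesBy.flowSegment_normalized (E : EvolvesBy normalizedFlowVelocity γ₀ ν₀ γ ν) (T : ℝ) :
    FlowSegment T γ ν (fun t u => deriv (speed (γ t) (ν t)) u / ell (ν t) u) (fun _ _ => 0) where
  smooth_curve := E.smooth_curve.mono (prod_mono_left Ico_subset_Ici_self)
  smooth_normal := E.smooth_normal.mono (prod_mono_left Ico_subset_Ici_self)
  periodic_curve t ht := E.periodic_curve t ht.1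
  periodic_normal t ht := E.periodic_normal t ht.1
  norm_normal t ht := by rw [E.normal_eq ht.1]; exact h₀.norm_normal
  ell_pos t ht u := by rw [E.normal_eq ht.1, hℓ]; exact one_pos
  orthogonal_zero := by rw [E.initial_curve, E.initial_normal]; exact h₀.orthogonal
  integral_ell_zero := by simp [E.initial_normal, hℓ]
  evolution_curve t ht u := by
    refine ((E.evolution_curve t ht.1.le u).hasDerivAt (Ici_mem_nhds ht.1)).congr_deriv ?_
    simp only [normalizedFlowVelocity, mu, Complex.real_smul]
    ring
  evolution_normal t ht u := by
    refine ((E.evolution_normal t ht.1.le u).hasDerivAt (Ici_mem_nhds ht.1)).congr_deriv ?_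
    simp [normalizedFlowVelocity]
  deriv_speed t ht u := by
    rw [E.normal_eq ht.1.le, hℓ]
    simp

lemma EvolvesBy.flowSegment (E : EvolvesBy flowVelocity γ₀ ν₀ γ ν) {T : ℝ}
    (hpos : ∀ t ∈ Ico 0 T, ∀ u, 0 < ell (ν t) u) :
    FlowSegment T γ ν
      (fun t u => ell (ν t) u * deriv (speed (γ t) (ν t)) u
        / (ell (ν t) u ^ 2 + beta (γ t) (ν t) u ^ 2))
      (fun t u => beta (γ t) (ν t) u * deriv (speed (γ t) (ν t)) u
        / (ell (ν t) u ^ 2 + beta (γ t) (ν t) u ^ 2)) where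
  smooth_curve := E.smooth_curve.mono (prod_mono_left Ico_subset_Ici_self)
  smooth_normal := E.smooth_normal.mono (prod_mono_left Ico_subset_Ici_self)
  periodic_curve t ht := E.periodic_curve t ht.1
  periodic_normal t ht := E.periodic_normal t ht.1
  norm_normal t ht u := E.norm_normal h₀.norm_normal (fun _ _ _ => rfl) ht.1 u
  ell_pos := hpos
  orthogonal_zero := by rw [E.initial_curve, E.initial_normal]; exact h₀.orthogonal
  integral_ell_zero := by simp [E.initial_normal, hℓ]
  evolution_curve t ht u := by
    refine ((E.evolution_curve t ht.1.le u).hasDerivAt (Ici_mem_nhds ht.1)).congr_deriv ?_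
    simp only [flowVelocity, mu, Complex.real_smul]
    ring
  evolution_normal t ht u := by
    refine ((E.evolution_normal t ht.1.le u).hasDerivAt (Ici_mem_nhds ht.1)).congr_deriv ?_
    simp [flowVelocity, mu]
  deriv_speed t ht u := by
    have h1 := hpos t (Ioo_subset_Ico_self ht) u
    have h2 : ell (ν t) u ^ 2 + beta (γ t) (ν t) u ^ 2 ≠ 0 := by positivity
    field_simp

end Evolves

section Comparison

variable {T t : ℝ} {γ ν : ℝ → ℝ → ℂ} {h g : ℝ → ℝ → ℝ} {Q : ℝ → ℝ → ℝ} {A ε c : ℝ} {S : ℂ}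

/-- This holds for `ρ = 0` too, with both quotients equal to `0` by convention; a solution of the flow
is not known in advance to have nonzero algebraic length. -/
lemma nonlocalTerm_eq {q θ : ℝ → ℝ} (hq : Admissible q) (hθ : IsAngle θ) (S : ℂ) (ρ : ℝ) :
    nonlocalTerm (fun u => supportCurve S ρ q (θ u)) (fun u => circ (θ u))
      = ρ + radiusVariance q / (2 * Real.pi * ρ) := by
  rcases eq_or_ne ρ 0 with rfl | hρ
  · rw [nonlocalTerm, algLength_supportCurve_comp hq hθ]
    simp
  · exact nonlocalTerm_supportCurve_comp hq hθ S ρ hρ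

/-- Up to the mean radius, every solution is given by the linear flow of the support function. -/
lemma FlowSegment.exists_eq_supportCurve (H : FlowSegment T γ ν h g) (hQ : LinearFlow Q)
    (hA : 0 < A) (hε : ε ^ 2 = 1) (hγ : γ 0 = fun u => modelCurve S ε A Q 1 (u + c))
    (hν : ν 0 = fun u => circ (u + c)) (ht : t ∈ Ico 0 T) :
    ∃ θ ρ', IsAngle θ ∧ (γ t = fun u => supportCurve S ρ' (Q (Real.exp (-t))) (θ u)) ∧
      ν t = fun u => circ (θ u) := by
  obtain ⟨θ, hθ, hνt⟩ := H.exists_angle ht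
  have hL := (isEllConvex_supportCurve_comp (hQ.admissible 1) (isAngle_add c) S
    (meanRadius ε A Q 1)).1
  have hℓ : ∀ u, ell (fun u => circ (u + c)) u = 1 := fun u => by
    rw [ell_circ_comp (isAngle_add c)]
    simp
  have H' := (hQ.evolvesBy_normalized (S := S) hA hε c).flowSegment_normalized hL hℓ T
  have hLt := H.isLegendreCurve ht
  rw [hνt] at hLt
  obtain ⟨ρ', hρ'⟩ := LegendreFlow.exists_eq_supportCurve (hQ.admissible (Real.exp (-t))) hθ hLt S
    (meanRadius ε A Q (Real.exp (-t))) fun m hm => by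
      have h1 := H.moment_eq H' hm (by rw [hγ, hν]; simp) ht
      have h2 := moment_comp (isAngle_add c)
        (contDiff_supportCurve (hQ.admissible (Real.exp (-t))).smooth S
          (meanRadius ε A Q (Real.exp (-t)))).continuous
        (supportCurve_periodic (hQ.admissible (Real.exp (-t))).periodic S _) m
      rw [← h2, ← hνt]
      exact h1
  exact ⟨θ, ρ', hθ, hρ', hνt⟩

/-- An `ℓ`-convex solution is the explicit one up to the parametrization. It remains to see that the
mean radii `R` and `ρ` of the two agree. The squares of both have the derivative
`-(1/π) ∫ (B - ρ)² dθ`, except that the derivative of `R²` is `0` where `R = 0`. Hence `R² - ρ²` is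
nondecreasing, so that `R` never vanishes; but then `R² - ρ²` is constant. -/
lemma FlowSegment.eq_modelCurve (H : FlowSegment T γ ν h g) (hQ : LinearFlow Q)
    (hA : 0 < A) (hε : ε ^ 2 = 1) (hγ : γ 0 = fun u => modelCurve S ε A Q 1 (u + c))
    (hν : ν 0 = fun u => circ (u + c)) (ht : t ∈ Ico 0 T) :
    ∃ θ, IsAngle θ ∧ (γ t = fun u => modelCurve S ε A Q (Real.exp (-t)) (θ u)) ∧
      ν t = fun u => circ (θ u) := by
  set R : ℝ → ℝ := fun t => (moment (γ t) (ν t) (-1)).re / (2 * Real.pi) with hR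
  set ρ : ℝ → ℝ := fun t => meanRadius ε A Q (Real.exp (-t)) with hρ
  set M : ℝ → ℝ := fun t => radiusVariance (Q (Real.exp (-t))) with hM
  have hpi := Real.pi_pos
  have hRρ : ∀ {s θ ρ'}, IsAngle θ → (γ s = fun u => supportCurve S ρ' (Q (Real.exp (-s))) (θ u)) →
      (ν s = fun u => circ (θ u)) → moment (γ s) (ν s) (-1) = ((2 * Real.pi * ρ' : ℝ) : ℂ) ∧
        R s = ρ' := by
    intro s θ ρ' hθ h1 h2
    have h3 := moment_supportCurve_comp (hQ.admissible (Real.exp (-s))) hθ S ρ'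
    rw [← h1, ← h2] at h3
    refine ⟨h3, ?_⟩
    simp only [hR, h3, Complex.ofReal_re]
    field_simp
  have hR0 : R 0 = ρ 0 := by
    refine (hRρ (s := 0) (isAngle_add c) ?_ hν).2
    rw [hγ]
    simp only [hρ]
    simp [modelCurve]
  have hRc : ContinuousOn R (Ico 0 T) :=
    (Complex.continuous_re.comp_continuousOn (H.continuousOn_moment (-1))).div_const _
  have hρd : ∀ s, 0 ≤ s → HasDerivAt ρ (-(M s / (2 * Real.pi * ρ s))) s := by
    intro s hs
    have h1 := ((hQ.contDiff_meanRadius (ε := ε) hA).differentiable (by simp)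
      (Real.exp (-s))).hasDerivAt
    have hσ : HasDerivAt (fun t => Real.exp (-t)) (-Real.exp (-s)) s := by
      simpa using (hasDerivAt_neg s).exp
    refine (h1.comp s hσ).congr_deriv ?_
    rw [← hQ.tau_mul_deriv_meanRadius hA hε (exp_neg_mem_Icc hs)]
    ring
  have hρc : ContinuousOn ρ (Ico 0 T) := fun s hs => (hρd s hs.1).continuousAt.continuousWithinAt
  have hρ0 : ∀ s, ρ s ≠ 0 := fun s => hQ.meanRadius_ne_zero hA hε _
  have hM0 : ∀ s, 0 ≤ M s := fun s =>
    intervalIntegral.integral_nonneg Real.two_pi_pos.le fun x _ => sq_nonneg _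
  have hRd : ∀ s ∈ Ioo 0 T, HasDerivAt R (-(M s / (2 * Real.pi * R s))) s := by
    intro s hs
    have hs' := Ioo_subset_Ico_self hs
    obtain ⟨θ, ρ', hθ, e1, e2⟩ := H.exists_eq_supportCurve hQ hA hε hγ hν hs'
    obtain ⟨e3, e4⟩ := hRρ hθ e1 e2
    have h1 := H.hasDerivAt_moment hs (-1)
    have h2 := (Complex.reCLM.hasFDerivAt.comp_hasDerivAt s h1).div_const (2 * Real.pi)
    refine h2.congr_deriv ?_
    have e5 : nonlocalTerm (γ s) (ν s) = ρ' + M s / (2 * Real.pi * ρ') := by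
      rw [e1, e2]
      exact nonlocalTerm_eq (hQ.admissible _) hθ S ρ'
    have e6 : ∫ u in (0 : ℝ)..(2 * Real.pi), ν s u ^ ((-1 : ℤ) + 1) * (ell (ν s) u : ℂ)
        = ((2 * Real.pi : ℝ) : ℂ) := by
      simp only [neg_add_cancel, zpow_zero, one_mul]
      rw [intervalIntegral.integral_ofReal, H.integral_ell hs']
    rw [e3, e4, e5, e6]
    simp only [Complex.reCLM_apply]
    generalize M s / (2 * Real.pi * ρ') = y
    have e7 : -(((-1 : ℤ) : ℂ) * (((-1 : ℤ) : ℂ) + 2)) * ((2 * Real.pi * ρ' : ℝ) : ℂ)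
        - (((-1 : ℤ) : ℂ) + 2) * ((ρ' + y : ℝ) : ℂ) * ((2 * Real.pi : ℝ) : ℂ)
        = ((-(2 * Real.pi * y) : ℝ) : ℂ) := by
      push_cast
      ring
    rw [e7, Complex.ofReal_re]
    field_simp
  have hWd : ∀ s ∈ Ioo 0 T, HasDerivAt (fun s => R s ^ 2 - ρ s ^ 2)
      (if R s = 0 then M s / Real.pi else 0) s := by
    intro s hs
    refine (((hRd s hs).pow 2).sub ((hρd s hs.1.le).pow 2)).congr_deriv ?_
    have := hρ0 s
    split_ifs with h0
    · rw [h0]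
      field_simp
      norm_num
      exact Or.inl (mul_comm _ _)
    · field_simp
      norm_num
  have hWc : ContinuousOn (fun s => R s ^ 2 - ρ s ^ 2) (Ico 0 T) := (hRc.pow 2).sub (hρc.pow 2)
  have hmono : MonotoneOn (fun s => R s ^ 2 - ρ s ^ 2) (Ico 0 T) := by
    refine monotoneOn_of_deriv_nonneg (convex_Ico 0 T) hWc ?_ ?_
    · rw [interior_Ico]
      exact fun s hs => (hWd s hs).differentiableAt.differentiableWithinAt
    · rw [interior_Ico]
      intro s hs
      rw [(hWd s hs).deriv]
      split_ifs
      · exact div_nonneg (hM0 s) hpi.le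
      · exact le_rfl
  have hRne : ∀ s ∈ Ico 0 T, R s ≠ 0 := by
    intro s hs h0
    have h1 := hmono ⟨le_rfl, hs.1.trans_lt hs.2⟩ hs hs.1
    simp only [hR0, h0] at h1
    have := hρ0 s
    have : 0 < ρ s ^ 2 := by positivity
    linarith
  have hsq : EqOn (R ^ 2) (ρ ^ 2) (Ico 0 T) := by
    intro s hs
    have h1 := eq_of_hasDerivAt_zero hWc (fun s hs => by
      have := hWd s hs
      rwa [if_neg (hRne s (Ioo_subset_Ico_self hs))] at this) hs
    simp only [hR0, sub_self] at h1
    exact sub_eq_zero.1 h1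
  obtain ⟨θ, ρ', hθ, e1, e2⟩ := H.exists_eq_supportCurve hQ hA hε hγ hν ht
  have e3 : ρ' = ρ t := (hRρ hθ e1 e2).2.symm.trans
    (isPreconnected_Ico.eq_of_sq_eq hRc hρc hsq (fun _ => hρ0 _) ⟨le_rfl, ht.1.trans_lt ht.2⟩ hR0
      ht)
  exact ⟨θ, hθ, by rw [e1, e3]; rfl, e2⟩

end Comparison

end LegendreFlow

/-! ### Uniqueness for all times -/

namespace LegendreFlow

open Set Filter Topology MeasureTheory

/-- A moving unit vector has a continuous angle, which is differentiable up to the initial time. -/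
lemma exists_lift {N : ℝ → ℂ} {r : ℝ → ℝ} {a : ℝ} (hN : ContDiffOn ℝ ∞ N (Ici 0))
    (h1 : ∀ t, 0 ≤ t → ‖N t‖ = 1)
    (hd : ∀ t, 0 ≤ t → HasDerivWithinAt N (r t • (Complex.I * N t)) (Ici 0) t)
    (h0 : N 0 = circ a) :
    ∃ φ : ℝ → ℝ, φ 0 = a ∧ (∀ t, 0 ≤ t → HasDerivAt φ (r t) t) ∧ ∀ t, 0 ≤ t → N t = circ (φ t) := by
  have hr : ContinuousOn r (Ici 0) := by
    have h2 : ContinuousOn (fun t => inner ℝ (derivWithin N (Ici 0) t) (Complex.I * N t)) (Ici 0) :=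
      (hN.continuousOn_derivWithin (uniqueDiffOn_Ici 0) (by simp)).inner
        (continuousOn_const.mul hN.continuousOn)
    refine h2.congr fun t ht => ?_
    show r t = inner ℝ (derivWithin N (Ici 0) t) (Complex.I * N t)
    rw [(hd t ht).derivWithin (uniqueDiffOn_Ici 0 t ht), real_inner_smul_left,
      real_inner_self_eq_norm_sq, norm_mul, h1 t ht]
    simp
  -- Extending the velocity by a constant to `t < 0` gives an angle which is differentiable at `0`.
  have hc : Continuous fun t => r (max t 0) :=
    hr.comp_continuous (by fun_prop) fun t => le_max_right t 0
  have hφ : ∀ t, HasDerivAt (fun t => a + ∫ s in (0 : ℝ)..t, r (max s 0)) (r (max t 0)) t :=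
    fun t => (intervalIntegral.integral_hasDerivAt_right (hc.intervalIntegrable _ _)
      (hc.stronglyMeasurableAtFilter _ _) hc.continuousAt).const_add a
  refine ⟨fun t => a + ∫ s in (0 : ℝ)..t, r (max s 0), by simp, fun t ht => ?_, fun t ht => ?_⟩
  · simpa [max_eq_left ht] using hφ t
  · set φ : ℝ → ℝ := fun t => a + ∫ s in (0 : ℝ)..t, r (max s 0) with hφdef
    have hinv : ∀ x, circ x * circ (-x) = 1 := fun x => by
      rw [← circ_add, add_neg_cancel]
      simp [circ]
    have cφ : Continuous φ := continuous_iff_continuousAt.2 fun t => (hφ t).continuousAt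
    have h2 := eq_of_hasDerivAt_zero (f := fun t => N t * circ (-φ t)) (T := t + 1)
      ((hN.continuousOn.mono Ico_subset_Ici_self).mul
        (contDiff_circ.continuous.comp cφ.neg).continuousOn) (fun s hs => by
          have e1 := (hd s hs.1.le).hasDerivAt (Ici_mem_nhds hs.1)
          have e2 := (hasDerivAt_circ (-φ s)).scomp s (hφ s).neg
          refine (e1.mul e2).congr_deriv ?_
          simp only [Function.comp_apply, Pi.neg_apply, Complex.real_smul, max_eq_left hs.1.le]
          push_cast
          ring) (t := t) ⟨ht, by linarith⟩
    have h3 : φ 0 = a := by simp [hφdef]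
    simp only [h3, h0, hinv] at h2
    calc N t = N t * circ (-φ t) * circ (φ t) := by
          rw [mul_assoc, mul_comm (circ (-φ t)), hinv, mul_one]
      _ = circ (φ t) := by rw [h2, one_mul]

section Uniqueness

variable {γ₀ ν₀ : ℝ → ℂ} {γ ν : ℝ → ℝ → ℂ} {Q : ℝ → ℝ → ℝ} {A ε c : ℝ} {S : ℂ}

lemma LinearFlow.modelCurve_periodic (hQ : LinearFlow Q) (τ : ℝ) :
    Function.Periodic (modelCurve S ε A Q τ) (2 * Real.pi) :=
  supportCurve_periodic (hQ.admissible τ).periodic S _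

lemma EvolvesBy.eq_normalized (E : EvolvesBy normalizedFlowVelocity γ₀ ν₀ γ ν)
    (h₀ : IsLegendreCurve γ₀ ν₀) (hℓ : ∀ u, ell ν₀ u = 1) (hQ : LinearFlow Q) (hA : 0 < A)
    (hε : ε ^ 2 = 1) (hγ : γ₀ = fun u => modelCurve S ε A Q 1 (u + c))
    (hν : ν₀ = fun u => circ (u + c)) {t : ℝ} (ht : 0 ≤ t) :
    γ t = fun u => modelCurve S ε A Q (Real.exp (-t)) (u + c) := by
  obtain ⟨θ, -, h1, h2⟩ := (E.flowSegment_normalized h₀ hℓ (t + 1)).eq_modelCurve hQ hA hε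
    (by rw [E.initial_curve, hγ]) (by rw [E.initial_normal, hν]) ⟨ht, by linarith⟩
  rw [E.normal_eq ht, hν] at h2
  rw [h1]
  exact funext fun u => eq_of_circ_eq (hQ.modelCurve_periodic _) (congrFun h2 u).symm

section Characteristics

variable {Θ : ℝ → ℝ → ℝ} (E : EvolvesBy flowVelocity γ₀ ν₀ γ ν)
  (h₀ : IsLegendreCurve γ₀ ν₀) (hℓ : ∀ u, ell ν₀ u = 1) (hQ : LinearFlow Q) (hA : 0 < A)
  (hε : ε ^ 2 = 1) (hγ : γ₀ = fun u => modelCurve S ε A Q 1 (u + c))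
  (hν : ν₀ = fun u => circ (u + c))
  (hΘ1 : ∀ u, Θ 1 u = u)
  (hΘd : ∀ τ u, HasDerivAt (fun s => Θ s u) (angleVelocity ε A Q τ (Θ τ u)) τ)

include E h₀ hℓ hQ hA hε hγ hν hΘ1 hΘd

/-- As long as a solution is `ℓ`-convex, its normal angle moves along the characteristics. -/
lemma EvolvesBy.normal_eq_circ {T : ℝ} (hpos : ∀ t ∈ Ico 0 T, ∀ u, 0 < ell (ν t) u) {t : ℝ}
    (ht : t ∈ Ico 0 T) (u : ℝ) : ν t u = circ (Θ (Real.exp (-t)) (u + c)) := by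
  set r : ℝ → ℝ := fun t => -(beta (γ t) (ν t) u * deriv (speed (γ t) (ν t)) u /
    (ell (ν t) u ^ 2 + beta (γ t) (ν t) u ^ 2)) with hr
  obtain ⟨φ, hφ0, hφd, hφ⟩ := exists_lift (N := fun t => ν t u) (r := r) (a := u + c)
    (E.smooth_normal.comp (f := fun t : ℝ => ((t, u) : ℝ × ℝ)) (by fun_prop)
      fun _ ht => ⟨ht, mem_univ _⟩)
    (fun t ht => E.norm_normal h₀.norm_normal (fun _ _ _ => rfl) ht u)
    (fun t ht => E.evolution_normal t ht u) (by rw [E.initial_normal, hν])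
  have hrW : ∀ s ∈ Ico 0 T, r s = -(Real.exp (-s) * angleVelocity ε A Q (Real.exp (-s)) (φ s)) := by
    intro s hs
    obtain ⟨θ, hθ, h1, h2⟩ := (E.flowSegment h₀ hℓ hpos).eq_modelCurve hQ hA hε
      (by rw [E.initial_curve, hγ]) (by rw [E.initial_normal, hν]) hs
    -- `θ u` and `φ s` may differ by a multiple of `2π`.
    have e0 : circ (θ u) = circ (φ s) := by rw [← hφ s hs.1, h2]
    have e1 := eq_of_circ_eq (hQ.angleVelocity_periodic (ε := ε) (A := A) (Real.exp (-s))) e0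
    rw [← e1, hQ.angle_evolution hs.1]
    unfold modelCurve at h1
    simp only [hr]
    rw [h1, h2, ell_circ_comp hθ, beta_supportCurve_comp (hQ.admissible _) hθ,
      deriv_speed_supportCurve_comp (hQ.admissible _) hθ, modelRadius]
    generalize meanRadius ε A Q (Real.exp (-s)) + radiusPart (Q (Real.exp (-s))) (θ u) = b
    have e2 := (hθ.deriv_pos u).ne'
    have e3 : 1 + b ^ 2 ≠ 0 := by positivity
    rw [show deriv θ u ^ 2 + (b * deriv θ u) ^ 2 = deriv θ u ^ 2 * (1 + b ^ 2) by ring]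
    field_simp
  have hW : ContDiff ℝ ∞ fun x : ℝ × ℝ =>
      -(Real.exp (-x.1) * angleVelocity ε A Q (Real.exp (-x.1)) x.2) :=
    (contDiff_exp_neg_fst.mul ((hQ.contDiff_angleVelocity hA).comp
      (f := fun x : ℝ × ℝ => ((Real.exp (-x.1), x.2) : ℝ × ℝ))
      (contDiff_exp_neg_fst.prodMk contDiff_snd))).neg
  obtain ⟨K, hK⟩ := exists_lipschitz
    (W := fun s x => -(Real.exp (-s) * angleVelocity ε A Q (Real.exp (-s)) x)) hW
    (fun s x => by simp only [hQ.angleVelocity_periodic (Real.exp (-s)) x]) 0 t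
  have hψ : ∀ s, HasDerivAt (fun s => Θ (Real.exp (-s)) (u + c))
      (-(Real.exp (-s) * angleVelocity ε A Q (Real.exp (-s)) (Θ (Real.exp (-s)) (u + c)))) s := by
    intro s
    have hσ : HasDerivAt (fun t => Real.exp (-t)) (-Real.exp (-s)) s := by
      simpa using (hasDerivAt_neg s).exp
    refine ((hΘd (Real.exp (-s)) (u + c)).comp s hσ).congr_deriv ?_
    ring
  have huniq := ODE_solution_unique_of_mem_Icc_right (s := fun _ => univ) (K := K)
    (v := fun s x => -(Real.exp (-s) * angleVelocity ε A Q (Real.exp (-s)) x))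
    (f := φ) (g := fun s => Θ (Real.exp (-s)) (u + c)) (a := 0) (b := t)
    (fun s hs => (hK s (Ico_subset_Icc_self hs)).lipschitzOnWith)
    (fun s hs => (hφd s hs.1).continuousAt.continuousWithinAt)
    (fun s hs => by
      have := hφd s hs.1
      rw [hrW s ⟨hs.1, hs.2.trans ht.2⟩] at this
      exact this.hasDerivWithinAt)
    (fun _ _ => mem_univ _)
    (fun s _ => (hψ s).continuousAt.continuousWithinAt)
    (fun s _ => (hψ s).hasDerivWithinAt) (fun _ _ => mem_univ _) (by simp [hφ0, hΘ1])
  rw [hφ t ht.1, huniq ⟨ht.1, le_rfl⟩]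

variable (hang : ∀ τ, IsAngle fun u => Θ τ (u + c))

include hang

/-- A solution stays `ℓ`-convex: at a first time at which `ℓ` vanishes somewhere, the solution would
still be given by the characteristics, for which `ℓ > 0`. -/
lemma EvolvesBy.ell_pos {t : ℝ} (ht : 0 ≤ t) (u : ℝ) : 0 < ell (ν t) u := by
  by_contra hcon
  set B : Set ℝ := {t | 0 ≤ t ∧ ∃ u, ell (ν t) u ≤ 0} with hB
  have hBne : B.Nonempty := ⟨t, ht, u, not_lt.1 hcon⟩
  have hBbdd : BddBelow B := ⟨0, fun s hs => hs.1⟩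
  set T := sInf B with hT
  have hT0 : 0 ≤ T := le_csInf hBne fun s hs => hs.1
  have hpos : ∀ t ∈ Ico 0 T, ∀ u, 0 < ell (ν t) u := by
    intro s hs v
    by_contra h
    exact absurd (csInf_le hBbdd ⟨hs.1, v, not_lt.1 h⟩) (not_le.2 hs.2)
  have hTpos : ∀ v, 0 < ell (ν T) v := by
    rcases hT0.eq_or_lt with h | h
    · intro v
      rw [← h, E.initial_normal, hℓ]
      exact one_pos
    · have hνT : ν T = fun v => circ (Θ (Real.exp (-T)) (v + c)) := by
        funext v
        have cν : ContinuousOn (fun t => ν t v) (Icc 0 T) :=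
          (E.continuousOn_normal (T + 1) v).mono fun s hs => ⟨hs.1, by linarith [hs.2]⟩
        have cΘ : Continuous fun t => circ (Θ (Real.exp (-t)) (v + c)) :=
          contDiff_circ.continuous.comp ((continuous_iff_continuousAt.2 fun τ =>
            (hΘd τ (v + c)).continuousAt).comp (Real.continuous_exp.comp continuous_neg))
        exact EqOn.of_subset_closure (s := Ico 0 T)
          (fun s hs => E.normal_eq_circ h₀ hℓ hQ hA hε hγ hν hΘ1 hΘd hpos hs v) cν
          cΘ.continuousOn Ico_subset_Icc_self (closure_Ico h.ne).ge ⟨hT0, le_rfl⟩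
      intro v
      rw [hνT, ell_circ_comp (hang (Real.exp (-T)))]
      exact (hang (Real.exp (-T))).deriv_pos v
  have hcont : Continuous fun x : ℝ × ℝ => ell (ν (max x.1 0)) x.2 := by
    have h1 : ContinuousOn (fun x : ℝ × ℝ => ell (ν x.1) x.2) (Ici 0 ×ˢ univ) :=
      ((contDiffOn_deriv_snd (uniqueDiffOn_Ici 0) E.smooth_normal).inner ℝ
        (contDiffOn_const.mul E.smooth_normal)).continuousOn
    exact h1.comp_continuous (f := fun x : ℝ × ℝ => ((max x.1 0, x.2) : ℝ × ℝ)) (by fun_prop)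
      fun x => ⟨le_max_right x.1 0, mem_univ _⟩
  have hev : ∀ᶠ s in 𝓝 T, ∀ v ∈ Icc 0 (2 * Real.pi), 0 < ell (ν (max s 0)) v := by
    refine isCompact_Icc.eventually_forall_of_forall_eventually fun v _ => ?_
    refine (hcont.tendsto (T, v)).eventually_const_lt ?_
    simp only [max_eq_left hT0]
    exact hTpos v
  obtain ⟨b, hb, hbT⟩ := exists_Ico_subset_of_mem_nhds hev ⟨T + 1, by linarith⟩
  obtain ⟨s, ⟨hs0, v, hv⟩, hsb⟩ := exists_lt_of_csInf_lt hBne hb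
  obtain ⟨w, hw, hvw⟩ := (ell_periodic (E.periodic_normal s hs0)).exists_mem_Ico₀
    Real.two_pi_pos v
  have := hbT ⟨csInf_le hBbdd ⟨hs0, v, hv⟩, hsb⟩ w (Ico_subset_Icc_self hw)
  rw [max_eq_left hs0, ← hvw] at this
  exact absurd this (not_lt.2 hv)

lemma EvolvesBy.eq_flow {t : ℝ} (ht : 0 ≤ t) :
    (γ t = fun u => modelCurve S ε A Q (Real.exp (-t)) (Θ (Real.exp (-t)) (u + c))) ∧
      ν t = fun u => circ (Θ (Real.exp (-t)) (u + c)) := by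
  have hpos : ∀ s ∈ Ico 0 (t + 1), ∀ u, 0 < ell (ν s) u := fun s hs u =>
    E.ell_pos h₀ hℓ hQ hA hε hγ hν hΘ1 hΘd hang hs.1 u
  have ht' : t ∈ Ico 0 (t + 1) := ⟨ht, by linarith⟩
  have hν' : ν t = fun u => circ (Θ (Real.exp (-t)) (u + c)) := funext fun u =>
    E.normal_eq_circ h₀ hℓ hQ hA hε hγ hν hΘ1 hΘd hpos ht' u
  refine ⟨?_, hν'⟩
  obtain ⟨θ, -, h1, h2⟩ := (E.flowSegment h₀ hℓ hpos).eq_modelCurve hQ hA hε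
    (by rw [E.initial_curve, hγ]) (by rw [E.initial_normal, hν]) ht'
  rw [hν'] at h2
  rw [h1]
  exact funext fun u => eq_of_circ_eq (hQ.modelCurve_periodic _) (congrFun h2 u).symm

end Characteristics

end Uniqueness

end LegendreFlow

/-! ### The two flows -/

namespace LegendreFlow

open Set Filter Topology MeasureTheory

section Main

variable {Q : ℝ → ℝ → ℝ} {A ε c : ℝ} {S : ℂ}

/-- The characteristics of the normal angle under the flow which is not normalized. -/
lemma LinearFlow.exists_characteristics (hQ : LinearFlow Q) (hA : 0 < A) (c : ℝ) :
    ∃ Θ : ℝ → ℝ → ℝ, (ContDiff ℝ ∞ fun x : ℝ × ℝ => Θ x.1 x.2) ∧ (∀ u, Θ 1 u = u) ∧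
      (∀ τ u, HasDerivAt (fun s => Θ s u) (angleVelocity ε A Q τ (Θ τ u)) τ) ∧
      ∀ τ, IsAngle fun u => Θ τ (u + c) := by
  obtain ⟨Θ, h1, h2, h3, h4, h5⟩ := exists_smooth_flow (hQ.contDiff_angleVelocity (ε := ε) hA)
    hQ.angleVelocity_periodic 1
  refine ⟨Θ, h1, h2, h3, fun τ => ⟨(contDiff_comp_mk h1 τ).comp (by fun_prop), fun u => ?_,
    fun u => ?_⟩⟩
  · rw [deriv_comp_add_const]
    exact h4 τ (u + c)
  · rw [show u + 2 * Real.pi + c = u + c + 2 * Real.pi by ring, h5]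

lemma LinearFlow.isEllConvex_modelCurve (hQ : LinearFlow Q) (S : ℂ) (ε A τ : ℝ) {θ : ℝ → ℝ}
    (hθ : IsAngle θ) :
    IsEllConvex (fun u => modelCurve S ε A Q τ (θ u)) fun u => circ (θ u) :=
  isEllConvex_supportCurve_comp (hQ.admissible τ) hθ S _

lemma LinearFlow.algArea_modelCurve (hQ : LinearFlow Q) (hA : 0 < A) (hε : ε ^ 2 = 1) (S : ℂ)
    (τ : ℝ) {θ : ℝ → ℝ} (hθ : IsAngle θ) :
    algArea (fun u => modelCurve S ε A Q τ (θ u)) (fun u => circ (θ u)) = A := by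
  have h := algArea_supportCurve_comp (hQ.admissible τ) hθ S (meanRadius ε A Q τ)
  rw [hQ.meanRadius_sq hA hε, mul_div_cancel₀ _ Real.pi_ne_zero, add_sub_cancel_right] at h
  exact h

lemma LinearFlow.steinerPoint_modelCurve (hQ : LinearFlow Q) (S : ℂ) (ε A τ : ℝ) {θ : ℝ → ℝ}
    (hθ : IsAngle θ) :
    steinerPoint (fun u => modelCurve S ε A Q τ (θ u)) (fun u => circ (θ u)) = S :=
  steinerPoint_supportCurve_comp (hQ.admissible τ) hθ S _

end Main

end LegendreFlow

open LegendreFlow in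
theorem theorem1p1 (γ₀ ν₀ : ℝ → ℂ) (h_legendre : IsLegendreCurve γ₀ ν₀)
    (h_ell : ∀ u, ell ν₀ u = 1) (h_area : 0 < algArea γ₀ ν₀) :
    -- the flow exists for all time
    ((∃ γ ν : ℝ → ℝ → ℂ, EvolvesBy flowVelocity γ₀ ν₀ γ ν) ∧
      ∀ γ ν : ℝ → ℝ → ℂ, EvolvesBy flowVelocity γ₀ ν₀ γ ν →
        (∀ t, 0 ≤ t → IsEllConvex (γ t) (ν t)) ∧
        (∀ t, 0 ≤ t → algArea (γ t) (ν t) = algArea γ₀ ν₀) ∧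
        (∀ t, 0 ≤ t → steinerPoint (γ t) (ν t) = steinerPoint γ₀ ν₀) ∧
        ∃ γ_lim ν_lim : ℝ → ℂ, IsEllConvex γ_lim ν_lim ∧
          (∀ u, γ_lim u = steinerPoint γ₀ ν₀ +
            (Real.sign (algLength γ₀ ν₀) * Real.sqrt (algArea γ₀ ν₀ / Real.pi)) • ν_lim u) ∧
          -- the limit traces the circle exactly once
          Set.BijOn γ_lim (Set.Ico 0 (2 * Real.pi))
            (Metric.sphere (steinerPoint γ₀ ν₀) (Real.sqrt (algArea γ₀ ν₀ / Real.pi))) ∧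
          ConvergesSmoothly γ γ_lim ∧ ConvergesSmoothly ν ν_lim) ∧
    -- the same flow with the tangential field that keeps `ℓ = 1`
    ((∃ γ ν : ℝ → ℝ → ℂ, EvolvesBy normalizedFlowVelocity γ₀ ν₀ γ ν) ∧
      ∀ γ ν : ℝ → ℝ → ℂ, EvolvesBy normalizedFlowVelocity γ₀ ν₀ γ ν →
        (∀ t, 0 ≤ t → IsLegendreCurve (γ t) (ν t) ∧ ∀ u, ell (ν t) u = 1) ∧
        (∀ t, 0 ≤ t → algArea (γ t) (ν t) = algArea γ₀ ν₀) ∧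
        (∀ t, 0 ≤ t → steinerPoint (γ t) (ν t) = steinerPoint γ₀ ν₀) ∧
        ∃ γ_lim : ℝ → ℂ,
          (∀ u, γ_lim u = steinerPoint γ₀ ν₀ +
            (Real.sign (algLength γ₀ ν₀) * Real.sqrt (algArea γ₀ ν₀ / Real.pi)) • ν₀ u) ∧
          Set.BijOn γ_lim (Set.Ico 0 (2 * Real.pi))
            (Metric.sphere (steinerPoint γ₀ ν₀) (Real.sqrt (algArea γ₀ ν₀ / Real.pi))) ∧
          ConvergesSmoothly γ γ_lim) := by
  obtain ⟨c, Q, hQ, hε, hγ, hν⟩ := exists_model h_legendre h_ell h_area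
  obtain ⟨Θ, hΘ, hΘ1, hΘd, hang⟩ := hQ.exists_characteristics (A := algArea γ₀ ν₀)
    (ε := Real.sign (algLength γ₀ ν₀)) h_area c
  have hr : 0 < Real.sqrt (algArea γ₀ ν₀ / Real.pi) := Real.sqrt_pos.2 (div_pos h_area Real.pi_pos)
  set S := steinerPoint γ₀ ν₀
  set ε := Real.sign (algLength γ₀ ν₀)
  set A := algArea γ₀ ν₀
  have hp := isAngle_add c
  have hmc := hQ.contDiff_modelCurve (ε := ε) h_area S
  have hflow := hQ.evolvesBy_flow (S := S) h_area hε c hΘ hΘ1 hΘd hang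
  have hnormalized := hQ.evolvesBy_normalized (S := S) h_area hε c
  rw [← hγ, ← hν] at hflow hnormalized
  refine ⟨⟨⟨_, _, hflow⟩, fun γ ν E => ?_⟩, ⟨_, _, hnormalized⟩, fun γ ν E => ?_⟩
  · have hsol := fun t ht =>
      E.eq_flow h_legendre h_ell hQ h_area hε hγ hν hΘ1 hΘd hang (t := t) ht
    have hΘc : ContDiff ℝ ∞ fun x : ℝ × ℝ => Θ x.1 (x.2 + c) :=
      hΘ.comp (f := fun x : ℝ × ℝ => ((x.1, x.2 + c) : ℝ × ℝ)) (by fun_prop)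
    refine ⟨fun t ht => ?_, fun t ht => ?_, fun t ht => ?_,
      fun u => modelCurve S ε A Q 0 (Θ 0 (u + c)), fun u => circ (Θ 0 (u + c)),
      hQ.isEllConvex_modelCurve S ε A 0 (hang 0), fun u => hQ.modelCurve_zero S ε A _, ?_, ?_, ?_⟩
    · rw [(hsol t ht).1, (hsol t ht).2]
      exact hQ.isEllConvex_modelCurve S ε A _ (hang _)
    · rw [(hsol t ht).1, (hsol t ht).2]
      exact hQ.algArea_modelCurve h_area hε S _ (hang _)
    · rw [(hsol t ht).1, (hsol t ht).2]
      exact hQ.steinerPoint_modelCurve S ε A _ (hang _)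
    · simp only [hQ.modelCurve_zero]
      exact bijOn_circle (hang 0) S hε hr
    · exact convergesSmoothly_of_smooth (F := fun τ u => modelCurve S ε A Q τ (Θ τ (u + c)))
        (hmc.comp (f := fun x : ℝ × ℝ => ((x.1, Θ x.1 (x.2 + c)) : ℝ × ℝ))
          (contDiff_fst.prodMk hΘc))
        (fun τ => (hQ.isEllConvex_modelCurve S ε A τ (hang τ)).1.periodic_curve)
        fun t ht => (hsol t ht).1
    · exact convergesSmoothly_of_smooth (F := fun τ u => circ (Θ τ (u + c)))
        (contDiff_circ.comp hΘc)
        (fun τ => (hQ.isEllConvex_modelCurve S ε A τ (hang τ)).1.periodic_normal)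
        fun t ht => (hsol t ht).2
  · have hsol : ∀ t, 0 ≤ t → (γ t = fun u => modelCurve S ε A Q (Real.exp (-t)) (u + c)) ∧
        ν t = fun u => circ (u + c) := fun t ht =>
      ⟨E.eq_normalized h_legendre h_ell hQ h_area hε hγ hν ht, (E.normal_eq ht).trans hν⟩
    refine ⟨fun t ht => ⟨?_, fun u => ?_⟩, fun t ht => ?_, fun t ht => ?_,
      fun u => modelCurve S ε A Q 0 (u + c), fun u => ?_, ?_, ?_⟩
    · rw [(hsol t ht).1, (hsol t ht).2]
      exact (hQ.isEllConvex_modelCurve S ε A _ hp).1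
    · rw [E.normal_eq ht, h_ell]
    · rw [(hsol t ht).1, (hsol t ht).2]
      exact hQ.algArea_modelCurve h_area hε S _ hp
    · rw [(hsol t ht).1, (hsol t ht).2]
      exact hQ.steinerPoint_modelCurve S ε A _ hp
    · rw [hν]
      exact hQ.modelCurve_zero S ε A (u + c)
    · simp only [hQ.modelCurve_zero]
      exact bijOn_circle hp S hε hr
    · exact convergesSmoothly_of_smooth (F := fun τ u => modelCurve S ε A Q τ (u + c))
        (hmc.comp (f := fun x : ℝ × ℝ => ((x.1, x.2 + c) : ℝ × ℝ)) (by fun_prop))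
        (fun τ => (hQ.isEllConvex_modelCurve S ε A τ hp).1.periodic_curve)
        fun t ht => (hsol t ht).1
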